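/- Let $\mathbf{k}$ be a field of characteristic different from $2$ and let $p,q\in\mathbf{k}^\times$ be such that $p$ is not a (possibly negative) power of $q$, $q$ is not a power of $p$, and $p$ is not a root of unity. Let $I=\{p^{2n}q^{\pm1}\mid n\in\mathbb{Z}\}$ and assume that $\pm 1\notin I$ and $p\notin I$. Let $\Gamma$ be the quiver with vertex set $I$ and one arrow $p^2i\to i$ for every $i\in I$. Write $i\nleftrightarrow j$ if there is no arrow between $i$ and $j$, $i\leftrightarrow j$ if there are arrows in both directions, and $i\to j$ (or $j\leftarrow i$) in the relations below if there is an arrow from $i$ to $j$ but none from $j$ to $i$. Let $\nu=\sum_{i\in I}\nu_i\, i$ be a finitely supported dimension vector, with $\nu_i\in\mathbb{Z}_{\ge0}$ and $\nu_i=\nu_{i^{-1}}$ for all $i\in I$, such that * $\nu$ has multiplicity one: $\nu_i\le 1$ for all $i\in I$; * $\nu_q\geq 1$; * $\nu$ has connected support (up to the involution $i\mapsto i^{-1}$): the only nonempty subset of $\operatorname{supp}\nu$ that is stable under $i\mapsto i^{-1}$ and under passing to neighbours in $\operatorname{supp}\nu$ along arrows of $\Gamma$ (in either direction) is $\operatorname{supp}\nu$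 itself. Let $|\nu|=\sum_i\nu_i=2m$ with $m\ge1$, and let ${}^\theta I^\nu$ be the set of sequences $\mathbf{i}=(i_1,\dots,i_m)\in I^m$ with $\sum_k i_k+\sum_k i_k^{-1}=\nu$ (formal sums). Let $s_k$ denote the transposition of $k$ and $k+1$, acting also on sequences. Let $\mathfrak{W}_\nu$ be the VV algebra: the unital associative $\mathbf{k}$-algebra generated by $x_1,\dots,x_m$, $\sigma_1,\dots,\sigma_{m-1}$, $\mathbf{e}(\mathbf{i})$ ($\mathbf{i}\in{}^\theta I^\nu$) and $\pi$, subject to the following relations. 1. $\mathbf{e}(\mathbf{i})\mathbf{e}(\mathbf{j})=\delta_{\mathbf{i}\mathbf{j}}\mathbf{e}(\mathbf{i})$, $\sum_{\mathbf{i}}\mathbf{e}(\mathbf{i})=1$, $\sigma_k\mathbf{e}(\mathbf{i})=\mathbf{e}(s_k\mathbf{i})\sigma_k$, $x_l\mathbf{e}(\mathbf{i})=\mathbf{e}(\mathbf{i})x_l$, and the $x_l$ commute with each other. 2. $\sigma_k^2\mathbf{e}(\mathbf{i})$ equals $\mathbf{e}(\mathbf{i})$ if $i_k\ne i_{k+1}$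 and $i_k\nleftrightarrow i_{k+1}$; $(x_{k+1}-x_k)\mathbf{e}(\mathbf{i})$ if $i_k\leftarrow i_{k+1}$; $(x_k-x_{k+1})\mathbf{e}(\mathbf{i})$ if $i_k\to i_{k+1}$; $(x_{k+1}-x_k)(x_k-x_{k+1})\mathbf{e}(\mathbf{i})$ if $i_k\leftrightarrow i_{k+1}$; and $0$ if $i_k=i_{k+1}$. 3. $\sigma_j\sigma_k=\sigma_k\sigma_j$ for $j\ne k\pm1$. 4. $(\sigma_{k+1}\sigma_k\sigma_{k+1}-\sigma_k\sigma_{k+1}\sigma_k)\mathbf{e}(\mathbf{i})$ equals $0$ if $i_k\neq i_{k+2}$ or $i_k\nleftrightarrow i_{k+1}$; and, if $i_k=i_{k+2}$, it equals $\mathbf{e}(\mathbf{i})$ if $i_k\to i_{k+1}$, $-\mathbf{e}(\mathbf{i})$ if $i_k\leftarrow i_{k+1}$, and $(2x_{k+1}-x_{k+2}-x_k)\mathbf{e}(\mathbf{i})$ if $i_k\leftrightarrow i_{k+1}$. 5. $(\sigma_kx_l-x_{s_k(l)}\sigma_k)\mathbf{e}(\mathbf{i})$ equals $-\mathbf{e}(\mathbf{i})$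 if $l=k$ and $i_k=i_{k+1}$; $\mathbf{e}(\mathbf{i})$ if $l=k+1$ and $i_k=i_{k+1}$; and $0$ otherwise. 6. $\pi\,\mathbf{e}(i_1,\dots,i_m)=\mathbf{e}(i_1^{-1},i_2,\dots,i_m)\,\pi$. 7. $\pi^2\mathbf{e}(\mathbf{i})$ equals $x_1\mathbf{e}(\mathbf{i})$ if $i_1=q$; $-x_1\mathbf{e}(\mathbf{i})$ if $i_1=q^{-1}$; and $\mathbf{e}(\mathbf{i})$ otherwise. 8. $\pi x_1=-x_1\pi$, and $\pi x_l=x_l\pi$ for $l>1$. 9. $(\sigma_1\pi)^2\mathbf{e}(\mathbf{i})-(\pi\sigma_1)^2\mathbf{e}(\mathbf{i})$ equals $0$ if $i_1^{-1}\neq i_2$ or $i_1\ne q^{\pm1}$; $\sigma_1\mathbf{e}(\mathbf{i})$ if $i_1^{-1}=i_2=q^{-1}$; and $-\sigma_1\mathbf{e}(\mathbf{i})$ if $i_1^{-1}=i_2=q$. 10. $\pi\sigma_k=\sigma_k\pi$ for $k\ne1$. Let $A$ and $\tilde A$ be two copies of the path algebra over $\mathbf{k}$ of the $2$-cycle quiver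 (two vertices and one arrow in each direction between them, no relations). Then the $\mathbf{k}$-algebras $\mathfrak{W}_\nu$ and $A^{\otimes(m-1)}\otimes_{\mathbf{k}}\tilde A$ are Morita equivalent, i.e. their module categories are equivalent as $\mathbf{k}$-linear categories. (Here $A^{\otimes 0}=\mathbf{k}$.) -/

import Mathlib

noncomputable section

open scoped TensorProduct

universe u v w

/-! ### Path algebras -/

/-- A path in a quiver, bundled together with its source and its target. -/
structure AnyPath (V : Type v) [Quiver.{w} V] : Type (max v w) where
  {src : V}
  {tgt : V}
  path : Quiver.Path src tgt

/-- The path algebra of a quiver `V` over `k`: the vector space with basis all paths of `V`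
(including the trivial path at every vertex). -/
def PathAlgebra (k : Type u) (V : Type v) [Quiver.{w} V] [Field k] : Type (max u v w) :=
  AnyPath V →₀ k

namespace PathAlgebra

variable (k : Type u) (V : Type v) [Quiver.{w} V] [Field k]

instance : AddCommGroup (PathAlgebra k V) := inferInstanceAs (AddCommGroup (AnyPath V →₀ k))

instance : Module k (PathAlgebra k V) := inferInstanceAs (Module k (AnyPath V →₀ k))

variable {V}

/-- The basis of the path algebra that consists of all paths. -/
def pathBasis : Module.Basis (AnyPath V) k (PathAlgebra k V) :=
  ⟨LinearEquiv.refl k (AnyPath V →₀ k)⟩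

/-- The basis element given by a path. -/
def ofPath (a : AnyPath V) : PathAlgebra k V := pathBasis k a

open Classical in
/-- The product `a b` of two paths: first `b`, then `a`, if `b` ends where `a` starts, and `0`
otherwise. -/
def mulPath (a b : AnyPath V) : PathAlgebra k V :=
  if h : b.tgt = a.src then ofPath k ⟨(b.path.cast rfl h).comp a.path⟩ else 0

variable {k}

/-- The bilinear extension of the product of paths, as a bilinear map. -/
def mulLin : PathAlgebra k V →ₗ[k] PathAlgebra k V →ₗ[k] PathAlgebra k V :=
  (pathBasis k).constr k fun a => (pathBasis k).constr k fun b => mulPath k a b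

instance : Mul (PathAlgebra k V) := ⟨fun f g => mulLin f g⟩

/-- The unit of the path algebra of a quiver with finitely many vertices: the sum of the trivial
paths. -/
instance [Fintype V] : One (PathAlgebra k V) :=
  ⟨∑ a : V, ofPath k ⟨(Quiver.Path.nil : Quiver.Path a a)⟩⟩

theorem mul_def (f g : PathAlgebra k V) : f * g = mulLin f g := rfl

theorem one_def [Fintype V] :
    (1 : PathAlgebra k V) = ∑ a : V, ofPath k ⟨(Quiver.Path.nil : Quiver.Path a a)⟩ := rfl

theorem ofPath_mul_ofPath (a b : AnyPath V) : ofPath k a * ofPath k b = mulPath k a b := by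
  rw [mul_def, mulLin, ofPath, ofPath, Module.Basis.constr_basis, Module.Basis.constr_basis]

theorem induction {P : PathAlgebra k V → Prop} (h0 : P 0) (hadd : ∀ f g, P f → P g → P (f + g))
    (hsmul : ∀ (c : k) (a : AnyPath V), P (c • ofPath k a)) (f : PathAlgebra k V) : P f := by
  have hf : f ∈ Submodule.span k (Set.range (pathBasis (V := V) k)) := by
    rw [Module.Basis.span_eq]
    trivial
  refine Submodule.span_induction (p := fun x _ => ∀ c : k, P (c • x)) ?_ ?_ ?_ ?_ hf 1 |> fun h => by
    rwa [one_smul] at h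
  · rintro _ ⟨a, rfl⟩ c
    exact hsmul c a
  · intro c
    rwa [smul_zero]
  · intro x y _ _ hx hy c
    rw [smul_add]
    exact hadd _ _ (hx c) (hy c)
  · intro d x _ hx c
    rw [smul_smul]
    exact hx _

theorem add_mul_aux (f g h : PathAlgebra k V) : (f + g) * h = f * h + g * h := by
  simp only [mul_def, map_add, LinearMap.add_apply]

theorem mul_add_aux (f g h : PathAlgebra k V) : f * (g + h) = f * g + f * h := by
  simp only [mul_def, map_add]

theorem smul_mul_aux (c : k) (f g : PathAlgebra k V) : (c • f) * g = c • (f * g) := by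
  simp only [mul_def, map_smul, LinearMap.smul_apply]

theorem mul_smul_aux (c : k) (f g : PathAlgebra k V) : f * (c • g) = c • (f * g) := by
  simp only [mul_def, map_smul]

theorem zero_mul_aux (f : PathAlgebra k V) : 0 * f = 0 := by
  simp only [mul_def, map_zero, LinearMap.zero_apply]

theorem mul_zero_aux (f : PathAlgebra k V) : f * 0 = 0 := by
  simp only [mul_def, map_zero]

theorem mulPath_assoc (a b c : AnyPath V) :
    mulPath k a b * ofPath k c = ofPath k a * mulPath k b c := by
  obtain ⟨a⟩ := a
  obtain ⟨b⟩ := b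
  obtain ⟨c⟩ := c
  unfold mulPath
  split_ifs with h1 h2 h2
  · dsimp only at h1 h2
    subst h1 h2
    simp [ofPath_mul_ofPath, mulPath]
  · dsimp only at h1 h2
    subst h1
    simp [ofPath_mul_ofPath, mulPath, h2, mul_zero_aux]
  · dsimp only at h1 h2
    subst h2
    simp [ofPath_mul_ofPath, mulPath, h1, zero_mul_aux]
  · simp [zero_mul_aux, mul_zero_aux]

theorem mul_assoc_aux (f g h : PathAlgebra k V) : f * g * h = f * (g * h) := by
  induction f using PathAlgebra.induction with
  | h0 => simp only [zero_mul_aux]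
  | hadd f₁ f₂ h₁ h₂ => simp only [add_mul_aux, h₁, h₂]
  | hsmul c a =>
    induction g using PathAlgebra.induction with
    | h0 => simp only [zero_mul_aux, mul_zero_aux]
    | hadd f₁ f₂ h₁ h₂ => simp only [add_mul_aux, mul_add_aux, h₁, h₂]
    | hsmul d b =>
      induction h using PathAlgebra.induction with
      | h0 => simp only [mul_zero_aux]
      | hadd f₁ f₂ h₁ h₂ => simp only [mul_add_aux, h₁, h₂]
      | hsmul e b' =>
        simp only [smul_mul_aux, mul_smul_aux, ofPath_mul_ofPath, mulPath_assoc]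

theorem sum_mul_aux {ι : Type*} (s : Finset ι) (F : ι → PathAlgebra k V) (f : PathAlgebra k V) :
    (∑ i ∈ s, F i) * f = ∑ i ∈ s, F i * f := by
  simp only [mul_def, map_sum, LinearMap.sum_apply]

theorem mul_sum_aux {ι : Type*} (s : Finset ι) (F : ι → PathAlgebra k V) (f : PathAlgebra k V) :
    f * (∑ i ∈ s, F i) = ∑ i ∈ s, f * F i := by
  simp only [mul_def, map_sum]

theorem one_mul_aux [Fintype V] (f : PathAlgebra k V) : 1 * f = f := by
  classical
  induction f using PathAlgebra.induction with
  | h0 => simp only [mul_zero_aux]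
  | hadd f₁ f₂ h₁ h₂ => simp only [mul_add_aux, h₁, h₂]
  | hsmul c a =>
    obtain ⟨a⟩ := a
    rw [mul_smul_aux, one_def, sum_mul_aux]
    simp only [ofPath_mul_ofPath, mulPath]
    rw [Finset.sum_eq_single _ (fun b _ hb => dif_neg fun h => hb h.symm) (by simp), dif_pos rfl]
    rfl

theorem mul_one_aux [Fintype V] (f : PathAlgebra k V) : f * 1 = f := by
  classical
  induction f using PathAlgebra.induction with
  | h0 => simp only [zero_mul_aux]
  | hadd f₁ f₂ h₁ h₂ => simp only [add_mul_aux, h₁, h₂]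
  | hsmul c a =>
    obtain ⟨a⟩ := a
    rw [smul_mul_aux, one_def, mul_sum_aux]
    simp only [ofPath_mul_ofPath, mulPath]
    rw [Finset.sum_eq_single _ (fun b _ hb => dif_neg fun h => hb h) (by simp), dif_pos rfl]
    simp

instance [Fintype V] : Ring (PathAlgebra k V) where
  __ := (inferInstance : AddCommGroup (PathAlgebra k V))
  mul_assoc := mul_assoc_aux
  one_mul := one_mul_aux
  mul_one := mul_one_aux
  left_distrib := mul_add_aux
  right_distrib := add_mul_aux
  zero_mul := zero_mul_aux
  mul_zero := mul_zero_aux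

instance [Fintype V] : Algebra k (PathAlgebra k V) :=
  Algebra.ofModule smul_mul_aux mul_smul_aux

end PathAlgebra

/-- The two vertices of the `2`-cycle quiver. -/
inductive TwoCycle : Type
  | one
  | two

namespace TwoCycle

instance : Fintype TwoCycle := ⟨⟨[one, two], by simp⟩, fun a => by cases a <;> simp⟩

/-- The arrows of the `2`-cycle quiver: one arrow in each direction. -/
inductive Arrow : TwoCycle → TwoCycle → Type
  | u₁ : Arrow one two
  | u₂ : Arrow two one

instance : Quiver TwoCycle := ⟨Arrow⟩

end TwoCycle

/-- The path algebra `A` of the `2`-cycle quiver. -/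
abbrev TwoCycleAlgebra (k : Type u) [Field k] : Type u := PathAlgebra k TwoCycle

/-! ### Orbits, quivers and dimension vectors -/

namespace VV

variable {k : Type u} [Field k]

/-- The orbit `I = {p ^ (2n) c ^ (± 1)}` of `c` under the action of `ℤ ⋊ ℤ/2` on `kˣ`. -/
def orbit (p c : kˣ) : Set kˣ :=
  {i | ∃ n : ℤ, i = p ^ (2 * n) * c ∨ i = p ^ (2 * n) * c⁻¹}

/-- There is an arrow `i ⟶ j` in the quiver `Γ`, whose arrows are `p² j ⟶ j`. -/
def Arr (p i j : kˣ) : Prop := i = p ^ 2 * j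

/-- The vertices `i` and `j` are not joined by an arrow. -/
def NoArr (p i j : kˣ) : Prop := ¬ Arr p i j ∧ ¬ Arr p j i

/-- There is an arrow `i ⟶ j`, but no arrow `j ⟶ i`. -/
def OnlyArr (p i j : kˣ) : Prop := Arr p i j ∧ ¬ Arr p j i

/-- There are arrows in both directions. -/
def BothArr (p i j : kˣ) : Prop := Arr p i j ∧ Arr p j i

/-- A finitely supported `ν` is a dimension vector for `I` if it is supported in `I` and is
invariant under the involution `i ↦ i⁻¹`. -/
def IsDimVector (I : Set kˣ) (ν : kˣ →₀ ℕ) : Prop :=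
  (∀ i ∈ ν.support, i ∈ I) ∧ ∀ i, ν i⁻¹ = ν i

/-- The height `|ν|`. -/
def height (ν : kˣ →₀ ℕ) : ℕ := ν.sum fun _ a => a

/-- `ν` has multiplicity one. -/
def MultiplicityOne (ν : kˣ →₀ ℕ) : Prop := ∀ i, ν i ≤ 1

/-- `ν` has connected support, up to the involution `i ↦ i⁻¹`: the only nonempty subset of the
support that is stable under the involution and under passing to neighbours (in the support) in
the quiver is the whole support. Equivalently, `ν` is not the sum of two nonzero involution-invariant
dimension vectors with disjoint supports between which there are no arrows. -/
def ConnectedSupport (p : kˣ) (ν : kˣ →₀ ℕ) : Prop :=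
  ∀ S : Set kˣ, S ⊆ (ν.support : Set kˣ) → S.Nonempty → (∀ i ∈ S, i⁻¹ ∈ S) →
    (∀ i ∈ S, ∀ j ∈ ν.support, Arr p i j ∨ Arr p j i → j ∈ S) → S = (ν.support : Set kˣ)

/-- The sequences `(i₁, …, i_m)` with `∑ i_r + ∑ i_r⁻¹ = ν`. -/
def Seqs (ν : kˣ →₀ ℕ) (m : ℕ) : Type u :=
  {i : Fin m → kˣ // ∑ r, Finsupp.single (i r) 1 + ∑ r, Finsupp.single (i r)⁻¹ 1 = ν}

namespace Seqs

variable {ν : kˣ →₀ ℕ}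

theorem mem_support {m : ℕ} (i : Seqs ν m) (r : Fin m) : i.1 r ∈ ν.support := by
  classical
  have e := DFunLike.congr_fun i.2 (i.1 r)
  rw [Finsupp.add_apply, Finsupp.finsetSum_apply] at e
  have h : Finsupp.single (i.1 r) 1 (i.1 r) ≤ ∑ s, Finsupp.single (i.1 s) 1 (i.1 r) :=
    Finset.single_le_sum (f := fun s => Finsupp.single (i.1 s) 1 (i.1 r))
      (fun _ _ => Nat.zero_le _) (Finset.mem_univ r)
  rw [Finsupp.single_eq_same] at h
  rw [Finsupp.mem_support_iff]
  omega

instance (m : ℕ) : Finite (Seqs ν m) :=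
  Finite.of_injective (fun (i : Seqs ν m) (r : Fin m) => (⟨i.1 r, i.mem_support r⟩ : ν.support))
    fun _ _ h => Subtype.ext (funext fun r => congrArg Subtype.val (congrFun h r))

instance (m : ℕ) : Fintype (Seqs ν m) := Fintype.ofFinite _

/-- The action of the simple transposition `s_k` on sequences. -/
def swap {n : ℕ} (k : Fin n) (i : Seqs ν (n + 1)) : Seqs ν (n + 1) :=
  ⟨fun r => i.1 (Equiv.swap k.castSucc k.succ r), by
    rw [Equiv.sum_comp (Equiv.swap k.castSucc k.succ) fun r => Finsupp.single (i.1 r) 1,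
      Equiv.sum_comp (Equiv.swap k.castSucc k.succ) fun r => Finsupp.single (i.1 r)⁻¹ 1]
    exact i.2⟩

/-- The replacement of the first entry of a sequence by its inverse. -/
def flip {n : ℕ} (i : Seqs ν (n + 1)) : Seqs ν (n + 1) :=
  ⟨Function.update i.1 0 (i.1 0)⁻¹, by
    refine Eq.trans ?_ i.2
    simp only [Fin.sum_univ_succ, Function.update_self, inv_inv, ne_eq, Fin.succ_ne_zero,
      not_false_eq_true, Function.update_of_ne]
    abel⟩

end Seqs

/-! ### The algebras -/

/-- The generators of the algebra attached to `ν` with `|ν| = 2m`, where `m = n + 1`: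
`x_1, …, x_m`, `σ_1, …, σ_{m-1}`, the idempotents `e(i)`, and `π`. Indices start at `0` here. -/
inductive Gen (ν : kˣ →₀ ℕ) (n : ℕ) : Type u
  | x (l : Fin (n + 1))
  | s (r : Fin n)
  | e (i : Seqs ν (n + 1))
  | pi

section Relations

variable {ν : kˣ →₀ ℕ} {n : ℕ}

/-- The generator `x_l` of the free algebra. -/
def X (l : Fin (n + 1)) : FreeAlgebra k (Gen ν n) := FreeAlgebra.ι k (Gen.x l)

/-- The generator `σ_r` of the free algebra. -/
def σ (r : Fin n) : FreeAlgebra k (Gen ν n) := FreeAlgebra.ι k (Gen.s r)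

/-- The generator `e(i)` of the free algebra. -/
def E (i : Seqs ν (n + 1)) : FreeAlgebra k (Gen ν n) := FreeAlgebra.ι k (Gen.e i)

/-- The generator `π` of the free algebra. -/
def Pi : FreeAlgebra k (Gen ν n) := FreeAlgebra.ι k Gen.pi

end Relations

/-- The defining relations. For `r : Fin n` the entries of `i` in the places that `σ_r`
interchanges are `i.1 r.castSucc` and `i.1 r.succ`. -/
inductive Rel (p q : kˣ) (ν : kˣ →₀ ℕ) (n : ℕ) :
    FreeAlgebra k (Gen ν n) → FreeAlgebra k (Gen ν n) → Prop
  -- idempotents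
  | e_mul_self (i) : Rel p q ν n (E i * E i) (E i)
  | e_mul_ne (i j) (h : i ≠ j) : Rel p q ν n (E i * E j) 0
  | e_sum : Rel p q ν n (∑ i, E i) 1
  | s_e (r i) : Rel p q ν n (σ r * E i) (E (i.swap r) * σ r)
  | x_e (l i) : Rel p q ν n (X l * E i) (E i * X l)
  | x_x (l l') : Rel p q ν n (X l * X l') (X l' * X l)
  -- the squares of the `σ_r`
  | s_sq_none (r i) (hne : i.1 r.castSucc ≠ i.1 r.succ)
      (h : NoArr p (i.1 r.castSucc) (i.1 r.succ)) :
      Rel p q ν n (σ r ^ 2 * E i) (E i)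
  | s_sq_left (r i) (h : OnlyArr p (i.1 r.succ) (i.1 r.castSucc)) :
      Rel p q ν n (σ r ^ 2 * E i) ((X r.succ - X r.castSucc) * E i)
  | s_sq_right (r i) (h : OnlyArr p (i.1 r.castSucc) (i.1 r.succ)) :
      Rel p q ν n (σ r ^ 2 * E i) ((X r.castSucc - X r.succ) * E i)
  | s_sq_both (r i) (h : BothArr p (i.1 r.castSucc) (i.1 r.succ)) :
      Rel p q ν n (σ r ^ 2 * E i)
        ((X r.succ - X r.castSucc) * (X r.castSucc - X r.succ) * E i)
  | s_sq_eq (r i) (h : i.1 r.castSucc = i.1 r.succ) : Rel p q ν n (σ r ^ 2 * E i) 0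
  -- commutation and braid relations; `t` is the successor of `r` in the latter
  | s_s (r t : Fin n) (h : (r : ℕ) ≠ t + 1) (h' : (t : ℕ) ≠ r + 1) :
      Rel p q ν n (σ r * σ t) (σ t * σ r)
  | braid_none (r t : Fin n) (ht : (t : ℕ) = r + 1) (i)
      (h : i.1 r.castSucc ≠ i.1 t.succ ∨ NoArr p (i.1 r.castSucc) (i.1 r.succ)) :
      Rel p q ν n ((σ t * σ r * σ t - σ r * σ t * σ r) * E i) 0
  | braid_right (r t : Fin n) (ht : (t : ℕ) = r + 1) (i) (h : i.1 r.castSucc = i.1 t.succ)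
      (h' : OnlyArr p (i.1 r.castSucc) (i.1 r.succ)) :
      Rel p q ν n ((σ t * σ r * σ t - σ r * σ t * σ r) * E i) (E i)
  | braid_left (r t : Fin n) (ht : (t : ℕ) = r + 1) (i) (h : i.1 r.castSucc = i.1 t.succ)
      (h' : OnlyArr p (i.1 r.succ) (i.1 r.castSucc)) :
      Rel p q ν n ((σ t * σ r * σ t - σ r * σ t * σ r) * E i) (-E i)
  | braid_both (r t : Fin n) (ht : (t : ℕ) = r + 1) (i) (h : i.1 r.castSucc = i.1 t.succ)
      (h' : BothArr p (i.1 r.castSucc) (i.1 r.succ)) :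
      Rel p q ν n ((σ t * σ r * σ t - σ r * σ t * σ r) * E i)
        ((2 * X r.succ - X t.succ - X r.castSucc) * E i)
  -- the `σ_r` and the `x_l`
  | s_x_left (r i) (h : i.1 r.castSucc = i.1 r.succ) :
      Rel p q ν n ((σ r * X r.castSucc - X r.succ * σ r) * E i) (-E i)
  | s_x_right (r i) (h : i.1 r.castSucc = i.1 r.succ) :
      Rel p q ν n ((σ r * X r.succ - X r.castSucc * σ r) * E i) (E i)
  | s_x_else (r : Fin n) (l) (i)
      (h : ¬ (i.1 r.castSucc = i.1 r.succ ∧ (l = r.castSucc ∨ l = r.succ))) :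
      Rel p q ν n ((σ r * X l - X (Equiv.swap r.castSucc r.succ l) * σ r) * E i) 0
  -- the relations for `π`
  | pi_e (i) : Rel p q ν n (Pi * E i) (E i.flip * Pi)
  | pi_sq_q (i) (h : i.1 0 = q) : Rel p q ν n (Pi ^ 2 * E i) (X 0 * E i)
  | pi_sq_q_inv (i) (h : i.1 0 = q⁻¹) : Rel p q ν n (Pi ^ 2 * E i) (-X 0 * E i)
  | pi_sq_ne (i) (h : i.1 0 ≠ q) (h' : i.1 0 ≠ q⁻¹) : Rel p q ν n (Pi ^ 2 * E i) (E i)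
  | pi_x_zero : Rel p q ν n (Pi * X 0) (-X 0 * Pi)
  | pi_x (l) (h : l ≠ 0) : Rel p q ν n (Pi * X l) (X l * Pi)
  | s_pi_none (r : Fin n) (hr : (r : ℕ) = 0) (i)
      (h : (i.1 0)⁻¹ ≠ i.1 r.succ ∨ (i.1 0 ≠ q ∧ i.1 0 ≠ q⁻¹)) :
      Rel p q ν n ((σ r * Pi) ^ 2 * E i - (Pi * σ r) ^ 2 * E i) 0
  | s_pi_q (r : Fin n) (hr : (r : ℕ) = 0) (i) (h : (i.1 0)⁻¹ = i.1 r.succ)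
      (h' : i.1 r.succ = q⁻¹) :
      Rel p q ν n ((σ r * Pi) ^ 2 * E i - (Pi * σ r) ^ 2 * E i) (σ r * E i)
  | s_pi_q_inv (r : Fin n) (hr : (r : ℕ) = 0) (i) (h : (i.1 0)⁻¹ = i.1 r.succ)
      (h' : i.1 r.succ = q) :
      Rel p q ν n ((σ r * Pi) ^ 2 * E i - (Pi * σ r) ^ 2 * E i) (-σ r * E i)
  | pi_s (r : Fin n) (hr : (r : ℕ) ≠ 0) : Rel p q ν n (Pi * σ r) (σ r * Pi)

/-- The VV algebra attached to `p`, `q` and a dimension vector `ν` with `|ν| = 2(n + 1)`. -/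
abbrev VVAlgebra (p q : kˣ) (ν : kˣ →₀ ℕ) (n : ℕ) : Type u := RingQuot (Rel p q ν n)

end VV

end

/-! In multiplicity one no sequence contains an element twice, or together with its inverse. The
correction terms of the defining relations therefore never occur: `π` and the `σ_r` satisfy the
braid relations of type `B` exactly, and they permute the `x_l` up to sign. The support is a chain
`c_0, …, c_n` with arrows `c_{j+1} → c_j` and `c_s = q`, together with the inverses
(`exists_isChain`), and the sequences are the signed orderings of the `c_j`.

For every `j` the elements `± x_l`, taken at the place where `c_j` or its inverse sits, add up to a
central element `y_j`. So the algebra is an algebra over the polynomials in the `n` differences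
`y_{t+1} - y_t` and in `y_s`. Over this ring it is spanned by products `tau i j` of generators along
a shortest way from `i` to `j` (`exists_eq_sum`); as in Matsumoto's theorem, the choice of the way
does not matter (`tau_of_desc`).

Each of the `n + 1` variables belongs to a wall: one compares the signed positions of `c_t` and
`c_{t+1}`, and the last one records the sign of the position of `q`. In the polynomial
representation `tau i j` becomes a matrix unit times the product of the variables whose wall is
crossed from `one` to `two` (`rep_tau`); the other direction is free. Hence the representation is
faithful, and its image consists of the matrices whose entry at `(g, h)` is divisible by `crossing
(side g) (side h)`.

The path algebra of the `2`-cycle consists likewise of the `2 × 2` matrices over `k[X]` whose entry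
at `(two, one)` is divisible by `X`. Its tensor power is thus given by the same divisibility
condition on matrices indexed by all sign vectors (`exists_toMatrix`). Every sign vector is the side
of some sequence (`exists_side_eq`). With one sequence chosen for each, the tensor power becomes the
corner of the algebra at the sum of the corresponding idempotents. This idempotent is full, because
sequences with the same side are joined by mutually inverse elements `tau`, and a full corner is
Morita equivalent to the whole algebra (`IsMoritaEquivalent.of_corner`). -/

noncomputable section

open scoped TensorProduct

universe u

/-! ### Morita equivalence of an algebra with a full corner -/

section Corner

open CategoryTheory
open scoped ModuleCat.Algebra

variable {k : Type u} [CommRing k] {A B : Type u} [Ring A] [Algebra k A] [Ring B] [Algebra k B]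

/-- The fixed points of the idempotent `φ 1` in an `A`-module, for a non-unital homomorphism
`φ : B → A`. -/
def cornerModule (φ : B →ₙₐ[k] A) (M : Type u) [AddCommGroup M] [Module A M] : AddSubgroup M where
  carrier := {m | φ 1 • m = m}
  add_mem' := by
    intro a b ha hb
    simp only [Set.mem_ofPred_eq] at ha hb ⊢
    rw [smul_add, ha, hb]
  zero_mem' := smul_zero _
  neg_mem' := by
    intro a ha
    simp only [Set.mem_ofPred_eq] at ha ⊢
    rw [smul_neg, ha]

namespace cornerModule

variable (φ : B →ₙₐ[k] A)

section

variable {M : Type u} [AddCommGroup M] [Module A M]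

theorem smul_coe (m : cornerModule φ M) : φ 1 • (m : M) = m := m.2

theorem smul_mem (b : B) (m : M) : φ b • m ∈ cornerModule φ M := by
  change φ 1 • φ b • m = φ b • m
  rw [smul_smul, ← map_mul, one_mul]

instance : Module B (cornerModule φ M) where
  smul b m := ⟨φ b • (m : M), smul_mem φ b _⟩
  one_smul m := Subtype.ext m.2
  mul_smul a b m := Subtype.ext (by
    change φ (a * b) • (m : M) = φ a • φ b • (m : M)
    rw [map_mul, mul_smul])
  smul_zero a := Subtype.ext (smul_zero _)
  smul_add a x y := Subtype.ext (smul_add _ _ _)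
  add_smul a b x := Subtype.ext (by
    change φ (a + b) • (x : M) = φ a • (x : M) + φ b • (x : M)
    rw [map_add, add_smul])
  zero_smul x := Subtype.ext (by
    change φ 0 • (x : M) = 0
    rw [map_zero, zero_smul])

theorem coe_smul (b : B) (m : cornerModule φ M) :
    ((b • m : cornerModule φ M) : M) = φ b • (m : M) :=
  rfl

/-- The restriction of a linear map to the fixed points of `φ 1`. -/
def map {N : Type u} [AddCommGroup N] [Module A N] (f : M →ₗ[A] N) :
    cornerModule φ M →ₗ[B] cornerModule φ N where
  toFun m := ⟨f m, by
    change φ 1 • f m = f m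
    rw [← map_smul, m.2]⟩
  map_add' x y := Subtype.ext (map_add f _ _)
  map_smul' b x := Subtype.ext (map_smul f _ _)

end

/-- The functor `M ↦ φ(1) M`. -/
def functor : ModuleCat.{u} A ⥤ ModuleCat.{u} B where
  obj M := ModuleCat.of B (cornerModule φ M)
  map f := ModuleCat.ofHom (map φ f.hom)

instance : (functor φ).Additive where

instance : (functor φ).Linear k where
  map_smul f r := by
    refine ModuleCat.hom_ext (LinearMap.ext fun (m : cornerModule φ _) => Subtype.ext ?_)
    -- Since `φ` need not be unital, the scalar `r` of `B` acts as `r • φ 1`; this agrees with `r`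
    -- on fixed points of `φ 1`.
    change algebraMap k A r • f.hom m.1 = φ (algebraMap k B r) • f.hom m.1
    have h : φ 1 • f.hom m.1 = f.hom m.1 := (map φ f.hom m).2
    rw [Algebra.algebraMap_eq_smul_one, Algebra.algebraMap_eq_smul_one, map_smul, ← h, smul_smul,
      smul_smul, smul_mul_assoc, smul_mul_assoc, one_mul, ← map_mul, one_mul]

variable {ι : Type*} [Fintype ι] {φ} {a b : ι → A}

/-- Writing `m = ∑ a i • φ 1 • b i • m` shows that the fixed points of `φ 1` generate the module, so
a linear map is determined by its restriction to them. -/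
theorem functor_faithful (hfull : ∑ i, a i * φ 1 * b i = 1) : (functor φ).Faithful where
  map_injective {M N f g} h := by
    ext m
    have key : ∀ m : M, f.hom (φ 1 • m) = g.hom (φ 1 • m) := fun m =>
      congrArg Subtype.val
        (LinearMap.congr_fun (congrArg ModuleCat.Hom.hom h) ⟨φ 1 • m, smul_mem φ 1 m⟩)
    rw [← one_smul A m, ← hfull, Finset.sum_smul, map_sum, map_sum]
    refine Finset.sum_congr rfl fun i _ => ?_
    rw [mul_smul, mul_smul, map_smul f.hom, map_smul g.hom, key]

/-- The expansion `m = ∑ a i • φ 1 • b i • m` dictates the extension of `g`, namely `m ↦ ∑ a i • g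
(φ 1 • b i • m)`. It is `A`-linear because the elements `φ 1 * x * φ 1` come from `B`. -/
theorem functor_full (hfull : ∑ i, a i * φ 1 * b i = 1)
    (hrange : ∀ x, ∃ y, φ y = φ 1 * x * φ 1) : (functor φ).Full where
  map_surjective {M N} g₀ := by
    let g : cornerModule φ M →ₗ[B] cornerModule φ N := g₀.hom
    -- This is the `B`-linearity of `g`, applied to a preimage of `φ 1 * x * φ 1`.
    have key : ∀ (x : A) (m : M), (g ⟨φ 1 • x • φ 1 • m, smul_mem φ 1 _⟩ : N)
        = φ 1 • x • (g ⟨φ 1 • m, smul_mem φ 1 _⟩ : N) := by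
      intro x m
      obtain ⟨y, hy⟩ := hrange x
      have h := congrArg Subtype.val (g.map_smul y ⟨φ 1 • m, smul_mem φ 1 _⟩)
      have h2 : y • (⟨φ 1 • m, smul_mem φ 1 _⟩ : cornerModule φ M)
          = ⟨φ 1 • x • φ 1 • m, smul_mem φ 1 _⟩ := by
        refine Subtype.ext ?_
        change φ y • φ 1 • m = _
        rw [hy, mul_smul, mul_smul, smul_smul (φ 1) (φ 1) m, ← map_mul, one_mul]
      rw [← h2]
      refine h.trans ?_
      change φ y • (g ⟨φ 1 • m, smul_mem φ 1 _⟩ : N) = _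
      rw [hy, mul_smul, mul_smul, smul_coe]
    have gsum : ∀ (m : ι → M), (g ⟨φ 1 • ∑ i, m i, smul_mem φ 1 _⟩ : N)
        = ∑ i, (g ⟨φ 1 • m i, smul_mem φ 1 _⟩ : N) := by
      intro m
      have : (⟨φ 1 • ∑ i, m i, smul_mem φ 1 _⟩ : cornerModule φ M)
          = ∑ i, ⟨φ 1 • m i, smul_mem φ 1 _⟩ := by
        refine Subtype.ext ?_
        change φ 1 • ∑ i, m i = _
        rw [AddSubgroup.val_finsetSum, Finset.smul_sum]
      rw [this]
      exact (congrArg Subtype.val (map_sum g _ _)).trans (AddSubgroup.val_finsetSum _ _ _)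
    have expand : ∀ {L : ModuleCat.{u} A} (m : L), ∑ j, a j • φ 1 • b j • m = m := by
      intro L m
      conv_rhs => rw [← one_smul A m, ← hfull, Finset.sum_smul]
      simp only [mul_smul]
    let f : M →ₗ[A] N :=
      { toFun := fun m => ∑ i, a i • (g ⟨φ 1 • b i • m, smul_mem φ 1 _⟩ : N)
        map_add' := by
          intro x y
          rw [← Finset.sum_add_distrib]
          refine Finset.sum_congr rfl fun i _ => ?_
          rw [← smul_add]
          congr 1
          refine Eq.trans ?_ (congrArg Subtype.val (g.map_add
            ⟨φ 1 • b i • x, smul_mem φ 1 _⟩ ⟨φ 1 • b i • y, smul_mem φ 1 _⟩))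
          congr 2
          refine Subtype.ext ?_
          change φ 1 • b i • (x + y) = φ 1 • b i • x + φ 1 • b i • y
          rw [smul_add, smul_add]
        map_smul' := by
          intro x m
          have : ∀ i, (g ⟨φ 1 • b i • x • m, smul_mem φ 1 _⟩ : N)
              = φ 1 • b i • x • ∑ j, a j • (g ⟨φ 1 • b j • m, smul_mem φ 1 _⟩ : N) := by
            intro i
            have h1 : b i • x • m = ∑ j, (b i * x * a j) • φ 1 • b j • m := by
              conv_lhs => rw [← expand m]
              simp only [Finset.smul_sum, mul_smul]
            calc _ = (g ⟨φ 1 • ∑ j, (b i * x * a j) • φ 1 • b j • m, smul_mem φ 1 _⟩ : N) := by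
                  congr 2; exact Subtype.ext (congrArg (φ 1 • ·) h1)
              _ = _ := by
                rw [gsum]
                simp only [key]
                simp only [Finset.smul_sum, mul_smul]
          simp only [this, expand, RingHom.id_apply] }
    refine ⟨ModuleCat.ofHom f, ?_⟩
    refine ModuleCat.hom_ext (LinearMap.ext fun (m : cornerModule φ M) => Subtype.ext ?_)
    change ∑ i, a i • (g ⟨φ 1 • b i • (m : M), smul_mem φ 1 _⟩ : N) = (g m : N)
    rw [← expand (g m : N)]
    refine Finset.sum_congr rfl fun i _ => ?_
    congr 1
    have h := key (b i) (m : M)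
    have h2 : (⟨φ 1 • (m : M), smul_mem φ 1 _⟩ : cornerModule φ M) = m := Subtype.ext m.2
    rw [h2] at h
    rw [← h]
    congr 2
    refine Subtype.ext ?_
    change φ 1 • b i • (m : M) = φ 1 • b i • φ 1 • (m : M)
    rw [smul_coe]

/-- Right multiplication by an element of `A` on `φ(1) A`. -/
def rightMul (φ : B →ₙₐ[k] A) (x : A) : cornerModule φ A →ₗ[B] cornerModule φ A :=
  map φ (LinearMap.toSpanSingleton A A x)

variable (φ) in
/-- The module `Hom_B(φ(1) A, N)`. -/
def Coinduced (N : Type u) [AddCommGroup N] [Module B N] : Type u := cornerModule φ A →ₗ[B] N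

instance (N : Type u) [AddCommGroup N] [Module B N] : AddCommGroup (Coinduced φ N) :=
  inferInstanceAs (AddCommGroup (cornerModule φ A →ₗ[B] N))

/-- An element of the coinduced module, as a linear map. -/
def Coinduced.hom {N : Type u} [AddCommGroup N] [Module B N] (f : Coinduced φ N) :
    cornerModule φ A →ₗ[B] N := f

/-- The right action of `A` on `φ(1) A` in the argument turns into a left action on maps: `(x • f) m
= f (m x)`. -/
instance (N : Type u) [AddCommGroup N] [Module B N] : Module A (Coinduced φ N) where
  smul x f := LinearMap.comp f (rightMul φ x)
  one_smul f := LinearMap.ext fun m => congrArg f.hom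
    (Subtype.ext (mul_one _))
  mul_smul x y f := LinearMap.ext fun m =>
    congrArg f.hom (Subtype.ext (mul_assoc _ _ _).symm)
  smul_zero x := LinearMap.zero_comp _
  smul_add x f g := LinearMap.add_comp _ _ _
  add_smul x y f := LinearMap.ext fun m => by
    refine Eq.trans ?_ (LinearMap.map_add f.hom _ _)
    exact congrArg f.hom (Subtype.ext (mul_add _ _ _))
  zero_smul f := LinearMap.ext fun m => by
    refine Eq.trans ?_ (LinearMap.map_zero f.hom)
    exact congrArg f.hom (Subtype.ext (mul_zero _))

variable (φ) in
/-- The idempotent `φ 1`, as an element of `φ(1) A`. -/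
def unit : cornerModule φ A := ⟨φ 1, by
  change φ 1 * φ 1 = φ 1
  rw [← map_mul, one_mul]⟩

/-- The preimage of `N` is `Hom_B(φ(1) A, N)`. A map `f` fixed by `φ 1` satisfies `f x = f (x
φ(1))`, and `x φ(1)` lies in the image of `B`. So `f` is determined by its value at `φ 1`, and this
value is arbitrary. -/
theorem functor_essSurj (hinj : Function.Injective φ)
    (hrange : ∀ x, ∃ y, φ y = φ 1 * x * φ 1) : (functor φ).EssSurj where
  mem_essImage N := by
    choose ψ hψ using hrange
    have unit_smul (y : B) : (y • unit φ : cornerModule φ A) = ⟨φ y, by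
        change φ 1 * φ y = φ y
        rw [← map_mul, one_mul]⟩ := by
      refine Subtype.ext ?_
      change φ y * φ 1 = φ y
      rw [← map_mul, mul_one]
    let ev : cornerModule φ (Coinduced φ N) →ₗ[B] N :=
      { toFun := fun f => f.1.hom (unit φ)
        map_add' := fun f g => rfl
        map_smul' := fun y f => by
          refine Eq.trans ?_ (LinearMap.map_smul f.1.hom y (unit φ))
          refine congrArg f.1.hom (Subtype.ext ?_)
          change φ 1 * φ y = φ y * φ 1
          rw [← map_mul, ← map_mul, one_mul, mul_one] }
    have fix (f : cornerModule φ (Coinduced φ N)) (x : cornerModule φ A) :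
        f.1.hom x
          = ψ (x : A) • f.1.hom (unit φ) := by
      have h : f.1.hom (rightMul φ (φ 1) x)
          = f.1.hom x :=
        LinearMap.congr_fun (f := (φ 1 • f.1).hom) f.2 x
      rw [← h, ← LinearMap.map_smul]
      refine congrArg f.1.hom (Subtype.ext ?_)
      change (x : A) * φ 1 = φ (ψ x) * φ 1
      have hx : φ 1 * (x : A) = x := x.2
      rw [hψ, hx, mul_assoc, ← map_mul, one_mul]
    have bij : Function.Bijective ev := by
      constructor
      · intro f g hfg
        refine Subtype.ext (LinearMap.ext fun x => ?_)
        refine (fix f x).trans (Eq.trans ?_ (fix g x).symm)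
        exact congrArg _ hfg
      · intro y
        have hφ1 : φ 1 * φ 1 = φ 1 := by rw [← map_mul, one_mul]
        let f : cornerModule φ A →ₗ[B] N :=
          { toFun := fun x => ψ x • y
            map_add' := fun x x' => by
              rw [← add_smul]
              congr 1
              apply hinj
              simp only [map_add, hψ, AddSubgroup.coe_add, mul_add, add_mul]
            map_smul' := fun z x => by
              rw [RingHom.id_apply, smul_smul]
              congr 1
              apply hinj
              have hx : φ 1 * (x : A) = x := x.2
              rw [hψ, map_mul, hψ, coe_smul, smul_eq_mul, ← mul_assoc, ← map_mul, one_mul,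
                hx, mul_assoc] }
        refine ⟨⟨(f : Coinduced φ N), LinearMap.ext fun x => ?_⟩, ?_⟩
        · change ψ ((x : A) * φ 1) • y = ψ x • y
          congr 1
          apply hinj
          rw [hψ, hψ, mul_assoc, mul_assoc, mul_assoc, hφ1]
        · change ψ (φ 1) • y = y
          have : ψ (φ 1) = 1 := hinj (by rw [hψ, hφ1, hφ1])
          rw [this, one_smul]
    exact ⟨ModuleCat.of A (Coinduced φ N), ⟨(LinearEquiv.ofBijective ev bij).toModuleIso⟩⟩

end cornerModule

/-- An algebra is Morita equivalent to its corner at a full idempotent. -/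
theorem IsMoritaEquivalent.of_corner (φ : B →ₙₐ[k] A) (hinj : Function.Injective φ)
    (hrange : ∀ x, ∃ y, φ y = φ 1 * x * φ 1) {ι : Type*} [Fintype ι] (a b : ι → A)
    (hfull : ∑ i, a i * φ 1 * b i = 1) : IsMoritaEquivalent k A B := by
  have := cornerModule.functor_faithful hfull
  have := cornerModule.functor_full hfull hrange
  have := cornerModule.functor_essSurj hinj hrange
  have : (cornerModule.functor φ).IsEquivalence := {}
  exact ⟨⟨⟨(cornerModule.functor φ).asEquivalence,
    inferInstanceAs ((cornerModule.functor φ).Linear k)⟩⟩⟩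

end Corner

/-! ### Tensor powers of the path algebra as algebras of polynomial matrices -/

namespace TwoCycle

instance : DecidableEq TwoCycle := fun a b => by
  cases a <;> cases b <;> first | exact isTrue rfl | exact isFalse (by simp)

/-- The weight of an arrow: only `u₁` counts. -/
def Arrow.weight : {a b : TwoCycle} → Arrow a b → ℕ
  | _, _, .u₁ => 1
  | _, _, .u₂ => 0

/-- The number of times that a path runs through the arrow `u₁`. -/
def weight {a : TwoCycle} : {b : TwoCycle} → Quiver.Path a b → ℕ
  | _, .nil => 0
  | _, .cons P e => weight P + Arrow.weight e

theorem weight_comp {a b c : TwoCycle} (P : Quiver.Path a b) (Q : Quiver.Path b c) :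
    weight (P.comp Q) = weight P + weight Q := by
  induction Q with
  | nil => rfl
  | cons Q e ih => rw [Quiver.Path.comp_cons, weight, weight, ih, add_assoc]

theorem one_le_weight {a b : TwoCycle} (P : Quiver.Path a b) (ha : a = one) (hb : b = two) :
    1 ≤ weight P := by
  cases P with
  | nil => rw [ha] at hb; cases hb
  | cons P e =>
    change Arrow _ _ at e
    cases e with
    | u₁ => exact Nat.le_add_left _ _
    | u₂ => cases hb

/-- Exactly one arrow ends at each vertex, so a path can be traced back from its end; as `u₁` and
`u₂` alternate, the end points and the number of arrows `u₁` fix where the tracing stops. -/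
theorem weight_injective {a b : TwoCycle} (P : Quiver.Path a b) :
    ∀ Q : Quiver.Path a b, weight P = weight Q → P = Q := by
  induction P with
  | nil =>
    intro Q h
    cases Q with
    | nil => rfl
    | cons Q e =>
      change Arrow _ _ at e
      cases e with
      | u₁ => simp [weight, Arrow.weight] at h
      | u₂ =>
        have := one_le_weight Q rfl rfl
        simp [weight, Arrow.weight] at h
        omega
  | cons P e ih =>
    intro Q h
    cases Q with
    | nil =>
      change Arrow _ _ at e
      cases e with
      | u₁ => simp [weight, Arrow.weight] at h
      | u₂ =>
        have := one_le_weight P rfl rfl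
        simp [weight, Arrow.weight] at h
        omega
    | cons Q f =>
      change Arrow _ _ at e
      change Arrow _ _ at f
      cases e with
      | u₁ =>
        cases f with
        | u₁ => rw [ih Q (by simpa [weight, Arrow.weight] using h)]
      | u₂ =>
        cases f with
        | u₂ => rw [ih Q (by simpa [weight, Arrow.weight] using h)]

theorem AnyPath.ext_of_weight {P Q : AnyPath TwoCycle} (h1 : P.tgt = Q.tgt) (h2 : P.src = Q.src)
    (h3 : weight P.path = weight Q.path) : P = Q := by
  obtain ⟨P⟩ := P
  obtain ⟨Q⟩ := Q
  dsimp only at h1 h2 h3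
  subst h1 h2
  rw [weight_injective _ _ h3]

/-- Going round the cycle once raises the weight by one. The least weight is zero, except from `one`
to `two`, where `u₁` cannot be avoided. -/
theorem exists_weight_eq (a b : TwoCycle) (m : ℕ) (h : a = one → b = two → 1 ≤ m) :
    ∃ P : Quiver.Path a b, weight P = m := by
  induction m generalizing a b with
  | zero =>
    cases a <;> cases b
    · exact ⟨.nil, rfl⟩
    · exact absurd (h rfl rfl) (by omega)
    · exact ⟨Quiver.Path.nil.cons Arrow.u₂, rfl⟩
    · exact ⟨.nil, rfl⟩
  | succ m ih =>
    cases b with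
    | one =>
      obtain ⟨P, hP⟩ := ih a one (by rintro - ⟨⟩)
      exact ⟨(P.cons Arrow.u₁).cons Arrow.u₂, by simp [weight, Arrow.weight, hP]⟩
    | two =>
      obtain ⟨P, hP⟩ := ih a one (by rintro - ⟨⟩)
      exact ⟨P.cons Arrow.u₁, by simp [weight, Arrow.weight, hP]⟩

section

variable {k : Type u} [Field k] {R : Type u} [CommRing R] [Algebra k R]

/-- The representation of the path algebra by matrices that sends a path from `a` to `b` of weight
`m` to `x ^ m` times the matrix unit at `(b, a)`. -/
def toMatrix (x : R) : TwoCycleAlgebra k →ₐ[k] Matrix TwoCycle TwoCycle R :=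
  AlgHom.ofLinearMap
    ((PathAlgebra.pathBasis k).constr k fun a : AnyPath TwoCycle =>
      Matrix.single a.tgt a.src (x ^ weight a.path))
    (by
      rw [PathAlgebra.one_def, map_sum, ← Matrix.diagonal_one, ← Matrix.sum_single_eq_diagonal]
      refine Finset.sum_congr rfl fun a _ => ?_
      exact (Module.Basis.constr_basis (PathAlgebra.pathBasis k) k
        (fun a : AnyPath TwoCycle => Matrix.single a.tgt a.src (x ^ weight a.path))
        ⟨(Quiver.Path.nil : Quiver.Path a a)⟩).trans (by rw [weight, pow_zero]))
    (by
      intro f g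
      induction f using PathAlgebra.induction with
      | h0 => rw [PathAlgebra.zero_mul_aux, map_zero, zero_mul]
      | hadd f₁ f₂ h₁ h₂ => rw [PathAlgebra.add_mul_aux, map_add, h₁, h₂, map_add, add_mul]
      | hsmul c a =>
        induction g using PathAlgebra.induction with
        | h0 => rw [PathAlgebra.mul_zero_aux, map_zero, mul_zero]
        | hadd f₁ f₂ h₁ h₂ => rw [PathAlgebra.mul_add_aux, map_add, h₁, h₂, map_add, mul_add]
        | hsmul d b =>
          rw [PathAlgebra.smul_mul_aux, PathAlgebra.mul_smul_aux, map_smul, map_smul, map_smul,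
            map_smul, smul_mul_assoc, mul_smul_comm, PathAlgebra.ofPath_mul_ofPath]
          congr 2
          rw [PathAlgebra.ofPath, PathAlgebra.ofPath, Module.Basis.constr_basis,
            Module.Basis.constr_basis]
          obtain ⟨a⟩ := a
          obtain ⟨b⟩ := b
          unfold PathAlgebra.mulPath
          split_ifs with h
          · dsimp only at h
            subst h
            rw [PathAlgebra.ofPath, Module.Basis.constr_basis, Quiver.Path.cast_rfl_rfl,
              weight_comp, Matrix.single_mul_single_same, pow_add, mul_comm]
          · rw [map_zero, Matrix.single_mul_single_of_ne]
            exact fun h' => h h'.symm)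

theorem toMatrix_basis (x : R) (a : AnyPath TwoCycle) :
    toMatrix (k := k) x (PathAlgebra.pathBasis k a)
      = Matrix.single a.tgt a.src (x ^ weight a.path) :=
  Module.Basis.constr_basis _ k _ _

end

section

variable (k : Type u) [Field k] (K : Type) [Fintype K] [DecidableEq K]

/-- The tensor product of the representations `toMatrix (X κ)`. -/
def tensorMatrix : MultilinearMap k (fun _ : K => TwoCycleAlgebra k)
    (Matrix (K → TwoCycle) (K → TwoCycle) (MvPolynomial K k)) :=
  MultilinearMap.pi fun g => MultilinearMap.pi fun h =>
    (MultilinearMap.mkPiAlgebra k K (MvPolynomial K k)).compLinearMap fun κ =>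
      (Matrix.entryLinearMap k (MvPolynomial K k) (g κ) (h κ)).comp
        (toMatrix (MvPolynomial.X κ : MvPolynomial K k)).toLinearMap

variable {k K}

omit [DecidableEq K] in
theorem tensorMatrix_apply (a : K → TwoCycleAlgebra k) (g h : K → TwoCycle) :
    tensorMatrix k K a g h =
      ∏ κ, toMatrix (MvPolynomial.X κ : MvPolynomial K k) (a κ) (g κ) (h κ) :=
  rfl

variable (k K) in
/-- The representation of the tensor power of the path algebra by matrices of polynomials. -/
def piToMatrix : (⨂[k] _ : K, TwoCycleAlgebra k) →ₐ[k]
    Matrix (K → TwoCycle) (K → TwoCycle) (MvPolynomial K k) :=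
  PiTensorProduct.liftAlgHom (tensorMatrix k K)
    (by
      ext1 g h
      simp only [tensorMatrix_apply, Pi.one_apply, map_one, Matrix.one_apply]
      rw [Finset.prod_ite_zero]
      simp [funext_iff])
    (by
      intro a b
      ext1 g h
      simp only [tensorMatrix_apply, Matrix.mul_apply, Pi.mul_apply, map_mul]
      rw [Finset.prod_univ_sum]
      simp [Finset.prod_mul_distrib])

/-- The paths from `h κ` to `g κ` of weight `e κ`: the triple `(g, h, e)`. -/
def index (P : K → AnyPath TwoCycle) : (K → TwoCycle) × (K → TwoCycle) × (K →₀ ℕ) :=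
  (fun κ => (P κ).tgt, fun κ => (P κ).src, Finsupp.equivFunOnFinite.symm fun κ => weight (P κ).path)

omit [DecidableEq K] in
theorem index_injective : Function.Injective (index (K := K)) := by
  intro P Q h
  simp only [index, Prod.mk.injEq, EmbeddingLike.apply_eq_iff_eq, funext_iff] at h
  obtain ⟨h1, h2, h3⟩ := h
  funext κ
  exact AnyPath.ext_of_weight (h1 κ) (h2 κ) (h3 κ)

/-- The factor `X κ` if one passes from `one` to `two`. -/
def wt (κ : K) : TwoCycle → TwoCycle → MvPolynomial K k
  | two, one => MvPolynomial.X κ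
  | _, _ => 1

variable (k) in
/-- The product of the variables at which one passes from `one` to `two`. -/
def crossing (g h : K → TwoCycle) : MvPolynomial K k := ∏ κ, wt κ (g κ) (h κ)

theorem piToMatrix_basis (P : K → AnyPath TwoCycle) :
    piToMatrix k K (Basis.piTensorProduct (fun _ => PathAlgebra.pathBasis k) P)
      = Matrix.single (index P).1 (index P).2.1 (MvPolynomial.monomial (index P).2.2 1) := by
  rw [Basis.piTensorProduct_apply]
  refine (PiTensorProduct.lift.tprod _).trans ?_
  ext1 g h
  simp only [tensorMatrix_apply, toMatrix_basis, Matrix.single_apply]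
  rw [Finset.prod_ite_zero]
  have : (∀ i ∈ Finset.univ, (P i).tgt = g i ∧ (P i).src = h i) ↔
      (index P).1 = g ∧ (index P).2.1 = h := by
    simp [index, funext_iff, forall_and]
  simp only [this]
  split_ifs
  · rw [MvPolynomial.monomial_eq, map_one, one_mul, Finsupp.prod_fintype _ _ (by simp)]
    rfl
  · rfl

/-- Distinct basis tensors go to matrix units times monomials that differ in the place or in the
exponent. Each coordinate of `f` is therefore a coefficient of one entry of its image. -/
theorem piToMatrix_injective : Function.Injective (piToMatrix k K) := by
  rw [injective_iff_map_eq_zero]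
  intro f hf
  let b := Basis.piTensorProduct (R := k) (fun _ : K => PathAlgebra.pathBasis (V := TwoCycle) k)
  refine b.ext_elem fun P => ?_
  have key : (b.coord P) = (MvPolynomial.lcoeff k (index P).2.2) ∘ₗ
      (Matrix.entryLinearMap k (MvPolynomial K k) (index P).1 (index P).2.1) ∘ₗ
        (piToMatrix k K).toLinearMap := by
    refine b.ext fun Q => ?_
    rw [Module.Basis.coord_apply, Module.Basis.repr_self]
    change _ = MvPolynomial.coeff (index P).2.2
      ((piToMatrix k K (b Q)) (index P).1 (index P).2.1)
    rw [piToMatrix_basis, Matrix.single_apply]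
    by_cases hPQ : Q = P
    · subst hPQ
      simp
    · rw [Finsupp.single_eq_of_ne (Ne.symm hPQ)]
      split_ifs with h
      · rw [MvPolynomial.coeff_monomial, if_neg]
        intro h3
        exact hPQ (index_injective (Prod.ext h.1 (Prod.ext h.2 h3)))
      · simp
  have h := LinearMap.congr_fun key f
  rw [map_zero]
  refine h.trans ?_
  simp [hf]

/-- The divisibility holds factor by factor: a path from `one` to `two` has weight at least one. -/
theorem crossing_dvd_piToMatrix (f : ⨂[k] _ : K, TwoCycleAlgebra k) (g h : K → TwoCycle) :
    crossing k g h ∣ piToMatrix k K f g h := by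
  induction f using PiTensorProduct.induction_on with
  | smul_tprod r a =>
    rw [map_smul, Matrix.smul_apply]
    refine Dvd.dvd.mul_left ?_ (MvPolynomial.C r) |>.trans (by rw [MvPolynomial.C_mul'])
    have : piToMatrix k K (PiTensorProduct.tprod k a) = tensorMatrix k K a :=
      PiTensorProduct.lift.tprod _
    rw [this, tensorMatrix_apply]
    refine Finset.prod_dvd_prod_of_dvd _ _ fun κ _ => ?_
    generalize a κ = b
    induction b using PathAlgebra.induction with
    | h0 => simp
    | hadd f₁ f₂ h₁ h₂ => rw [map_add]; exact dvd_add h₁ h₂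
    | hsmul c P =>
      rw [map_smul, Matrix.smul_apply]
      refine Dvd.dvd.mul_left ?_ (MvPolynomial.C c) |>.trans (by rw [MvPolynomial.C_mul'])
      rw [PathAlgebra.ofPath, toMatrix_basis, Matrix.single_apply]
      split_ifs with hP
      · rw [← hP.1, ← hP.2]
        obtain @⟨x, y, P⟩ := P
        cases x <;> cases y <;> simp only [wt, one_dvd]
        exact dvd_pow_self _ (by have := one_le_weight P rfl rfl; omega)
      · exact dvd_zero _
  | add x y hx hy => rw [map_add]; exact dvd_add hx hy

omit [Fintype K] [DecidableEq K] in
theorem wt_eq (κ : K) (a b : TwoCycle) :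
    wt (k := k) κ a b = MvPolynomial.X κ ^ (if b = one ∧ a = two then 1 else 0) := by
  cases a <;> cases b <;> simp [wt]

/-- For a monomial `N` the preimage is a tensor product of paths, one in each factor, whose weights
are the exponents of the product `crossing k g h * N`. -/
theorem exists_piToMatrix_eq_single (g h : K → TwoCycle) (N : MvPolynomial K k) :
    ∃ f, piToMatrix k K f = Matrix.single g h (crossing k g h * N) := by
  induction N using MvPolynomial.induction_on' with
  | monomial e c =>
    -- The first summand is the exponent contributed by `crossing`; it is also what makes a path of
    -- this weight exist.
    let e' : K → ℕ := fun κ => (if h κ = one ∧ g κ = two then 1 else 0) + e κ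
    have hex : ∀ κ, ∃ P : Quiver.Path (h κ) (g κ), weight P = e' κ := fun κ =>
      exists_weight_eq _ _ _ fun h1 h2 => by simp [e', h1, h2]
    choose P hP using hex
    refine ⟨c • Basis.piTensorProduct (R := k)
      (fun _ : K => PathAlgebra.pathBasis (V := TwoCycle) k)
      fun κ => ⟨P κ⟩, ?_⟩
    rw [map_smul, piToMatrix_basis, Matrix.smul_single]
    change Matrix.single g h _ = _
    congr 1
    rw [MvPolynomial.smul_monomial, smul_eq_mul, mul_one, MvPolynomial.monomial_eq,
      MvPolynomial.monomial_eq, Finsupp.prod_fintype _ _ (by simp),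
      Finsupp.prod_fintype _ _ (by simp), crossing, mul_left_comm, ← Finset.prod_mul_distrib]
    congr 1
    refine Finset.prod_congr rfl fun κ _ => ?_
    rw [wt_eq, ← pow_add]
    congr 1
    exact hP κ
  | add p q hp hq =>
    obtain ⟨f, hf⟩ := hp
    obtain ⟨f', hf'⟩ := hq
    exact ⟨f + f', by rw [map_add, hf, hf', mul_add, Matrix.single_add]⟩

theorem exists_piToMatrix_eq (M : Matrix (K → TwoCycle) (K → TwoCycle) (MvPolynomial K k))
    (hM : ∀ g h, crossing k g h ∣ M g h) : ∃ f, piToMatrix k K f = M := by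
  choose N hN using hM
  choose F hF using fun g h => exists_piToMatrix_eq_single g h (N g h)
  refine ⟨∑ g, ∑ h, F g h, ?_⟩
  rw [Matrix.matrix_eq_sum_single M]
  simp only [map_sum, hF, hN]

theorem elim_update {n : ℕ} {A : Type*} (c : A) (a : Fin n → A) (i : Fin n) [DecidableEq (Fin n)]
    (z : A) : (fun o : Option (Fin n) => o.elim c (Function.update a i z))
      = Function.update (fun o => o.elim c a) (some i) z := by
  funext o
  cases o with
  | none => simp
  | some j =>
    by_cases hj : j = i
    · subst hj; simp
    · simp [hj]

variable (k) in
/-- The multilinear map that puts `1` in the additional place. -/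
def tprodOption (n : ℕ) : MultilinearMap k (fun _ : Fin n => TwoCycleAlgebra k)
    (⨂[k] _ : Option (Fin n), TwoCycleAlgebra k) where
  toFun a := PiTensorProduct.tprod k fun o => o.elim 1 a
  map_update_add' a i x y := by
    simp only [elim_update, MultilinearMap.map_update_add]
  map_update_smul' a i c x := by
    simp only [elim_update, MultilinearMap.map_update_smul]

variable (k) in
/-- The tensor product of a tensor power with one more factor. -/
def tensorOption (n : ℕ) : ((⨂[k] _ : Fin n, TwoCycleAlgebra k) ⊗[k] TwoCycleAlgebra k) →ₐ[k]
    ⨂[k] _ : Option (Fin n), TwoCycleAlgebra k :=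
  Algebra.TensorProduct.lift
    (PiTensorProduct.liftAlgHom (tprodOption k n)
      (by
        refine congrArg (PiTensorProduct.tprod k) (funext fun o => ?_)
        cases o <;> rfl)
      (by
        intro x y
        refine Eq.trans (congrArg (PiTensorProduct.tprod k) (funext fun o => ?_))
          (PiTensorProduct.tprod_mul_tprod _ _).symm
        cases o
        · exact (one_mul _).symm
        · rfl))
    (PiTensorProduct.singleAlgHom (R := k) (A := fun _ => TwoCycleAlgebra k) none)
    (by
      intro x y
      induction x using PiTensorProduct.induction_on with
      | smul_tprod r a =>
        have hr : r • PiTensorProduct.tprod k a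
            = algebraMap k (⨂[k] _ : Fin n, TwoCycleAlgebra k) r * PiTensorProduct.tprod k a := by
          exact Algebra.smul_def (A := ⨂[k] _ : Fin n, TwoCycleAlgebra k) r _
        rw [hr, map_mul, AlgHom.commutes]
        refine Commute.mul_left (Algebra.commutes
          (A := ⨂[k] _ : Option (Fin n), TwoCycleAlgebra k) r _) ?_
        have h : PiTensorProduct.lift (tprodOption k n) (PiTensorProduct.tprod k a)
          = tprodOption k n a := PiTensorProduct.lift.tprod _
        change Commute (PiTensorProduct.lift (tprodOption k n) (PiTensorProduct.tprod k a)) _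
        rw [h]
        refine Commute.tprod (funext fun o => ?_)
        cases o with
        | none => simp
        | some i => simp
      | add x x' hx hx' => rw [map_add]; exact hx.add_left hx')

theorem tensorOption_tmul (n : ℕ) (a : Fin n → TwoCycleAlgebra k) (b : TwoCycleAlgebra k) :
    tensorOption k n (PiTensorProduct.tprod k a ⊗ₜ b)
      = PiTensorProduct.tprod k fun o => o.elim b a := by
  refine (Algebra.TensorProduct.lift_tmul _ _ _ _ _).trans ?_
  refine (congrArg (· * _) (PiTensorProduct.lift.tprod (φ := tprodOption k n) a)).trans ?_
  refine (PiTensorProduct.tprod_mul_tprod _ _).trans (congrArg _ (funext fun o => ?_))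
  cases o with
  | none => simp
  | some i => simp

/-- Tensor products of paths form bases on both sides, and the map matches these bases. -/
theorem tensorOption_bijective (n : ℕ) : Function.Bijective (tensorOption k n) := by
  let b := PathAlgebra.pathBasis (V := TwoCycle) k
  let e : (Fin n → AnyPath TwoCycle) × AnyPath TwoCycle ≃ (Option (Fin n) → AnyPath TwoCycle) :=
    { toFun := fun P o => o.elim P.2 P.1
      invFun := fun P => (fun i => P (some i), P none)
      left_inv := fun P => rfl
      right_inv := fun P => funext fun o => by cases o <;> rfl }
  let L := ((Basis.piTensorProduct fun _ : Fin n => b).tensorProduct b).equiv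
    (Basis.piTensorProduct fun _ : Option (Fin n) => b) e
  have h : (tensorOption k n).toLinearMap = L.toLinearMap := by
    refine ((Basis.piTensorProduct fun _ : Fin n => b).tensorProduct b).ext fun P => ?_
    have h2 := ((Basis.piTensorProduct fun _ : Fin n => b).tensorProduct b).equiv_apply P
      (Basis.piTensorProduct fun _ : Option (Fin n) => b) e
    refine Eq.trans ?_ h2.symm
    rw [Module.Basis.tensorProduct_apply', Basis.piTensorProduct_apply,
      Basis.piTensorProduct_apply]
    refine (tensorOption_tmul n _ _).trans (congrArg _ (funext fun o => ?_))
    cases o <;> rfl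
  have h' : ⇑(tensorOption k n) = ⇑L := congrArg DFunLike.coe h
  rw [h']
  exact L.bijective

/-- The representation of `A ^ ⊗ n ⊗ A` by matrices of polynomials. -/
theorem exists_toMatrix (n : ℕ) :
    ∃ Ψ : ((⨂[k] _ : Fin n, TwoCycleAlgebra k) ⊗[k] TwoCycleAlgebra k) →ₐ[k]
      Matrix (Option (Fin n) → TwoCycle) (Option (Fin n) → TwoCycle)
        (MvPolynomial (Option (Fin n)) k),
    Function.Injective Ψ ∧ (∀ f g h, crossing k g h ∣ Ψ f g h) ∧
    ∀ M, (∀ g h, crossing k g h ∣ M g h) → ∃ f, Ψ f = M := by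
  refine ⟨(piToMatrix k (Option (Fin n))).comp (tensorOption k n),
    piToMatrix_injective.comp (tensorOption_bijective n).1,
    fun f => crossing_dvd_piToMatrix _, fun M hM => ?_⟩
  obtain ⟨f, rfl⟩ := exists_piToMatrix_eq M hM
  obtain ⟨f, rfl⟩ := (tensorOption_bijective n).2 f
  exact ⟨f, rfl⟩

end

end TwoCycle

/-! ### The support of the dimension vector as a chain -/

namespace VV

variable {k : Type u} [Field k] {p q : kˣ} {ν : kˣ →₀ ℕ}

/-- An enumeration `c₀, …, c_n` of representatives of the orbits of the involution on the support of
a dimension vector of multiplicity one such that the arrows are those from `c_{j+1}` to `c_j` and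
their images under the involution; and `c_s = q`. -/
structure IsChain (p q : kˣ) (ν : kˣ →₀ ℕ) (n : ℕ) (c : ℕ → kˣ) (s : ℕ) : Prop where
  le_one : ∀ u, ν u ≤ 1
  s_le : s ≤ n
  c_s : c s = q
  mem : ∀ u, u ∈ ν.support ↔ ∃ j ≤ n, u = c j ∨ u = (c j)⁻¹
  inj : ∀ i ≤ n, ∀ j ≤ n, c i = c j → i = j
  ne_inv : ∀ i ≤ n, ∀ j ≤ n, c i ≠ (c j)⁻¹
  -- Arrows between mutually inverse vertices are excluded: two such vertices never occur in the
  -- same sequence, so these arrows play no role.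
  arr : ∀ u ∈ ν.support, ∀ v ∈ ν.support, v ≠ u⁻¹ →
    (Arr p u v ↔ ∃ j < n, u = c (j + 1) ∧ v = c j ∨ u = (c j)⁻¹ ∧ v = (c (j + 1))⁻¹)
  arr_irrefl : ∀ u v, Arr p u v → ¬ Arr p v u

theorem arr_inv {u v : kˣ} : Arr p u⁻¹ v⁻¹ ↔ Arr p v u := by
  rw [Arr, Arr, inv_eq_iff_eq_inv, mul_inv, inv_inv, eq_inv_mul_iff_mul_eq, eq_comm]

section Existence

/-- The element `p ^ (2d) q` of the orbit. -/
def orb (p q : kˣ) (d : ℤ) : kˣ := p ^ (2 * d) * q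

theorem orb_zero : orb p q 0 = q := by simp [orb]

theorem orb_succ (d : ℤ) : orb p q (d + 1) = p ^ 2 * orb p q d := by
  rw [orb, orb, mul_add, mul_one, zpow_add, ← mul_assoc, mul_comm (p ^ (2 * d))]
  rfl

theorem zpow_injective (hroot : ∀ n : ℕ, 0 < n → p ^ n ≠ 1) :
    Function.Injective fun d : ℤ => p ^ d := by
  rw [injective_zpow_iff_not_isOfFinOrder, isOfFinOrder_iff_pow_eq_one]
  rintro ⟨n, hn, h⟩
  exact hroot n hn h

theorem orb_injective (hroot : ∀ n : ℕ, 0 < n → p ^ n ≠ 1) : Function.Injective (orb p q) := by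
  intro d e h
  have := zpow_injective hroot (mul_right_cancel h)
  omega

/-- In a field only `1` and `-1` are their own inverses, and neither lies in the orbit. -/
theorem orb_mul_self_ne_one (hone : (1 : kˣ) ∉ orbit p q) (hnegone : (-1 : kˣ) ∉ orbit p q)
    (d : ℤ) :
    orb p q d * orb p q d ≠ 1 := by
  intro h
  have h' := congrArg Units.val h
  rw [Units.val_mul, Units.val_one, mul_self_eq_one_iff] at h'
  rcases h' with h' | h'
  · exact hone ⟨d, Or.inl (Units.ext h'.symm)⟩
  · exact hnegone ⟨d, Or.inl (Units.ext (by rw [Units.val_neg, Units.val_one]; exact h'.symm))⟩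

/-- The representatives with index in `[-a, b]` are in the support and lie in different orbits. -/
def IsGood (p q : kˣ) (ν : kˣ →₀ ℕ) (a b : ℕ) : Prop :=
  (∀ d : ℤ, -a ≤ d → d ≤ b → orb p q d ∈ ν.support) ∧
  ∀ d e : ℤ, -a ≤ d → d ≤ b → -a ≤ e → e ≤ b → orb p q d * orb p q e ≠ 1

/-- The elements `orb p q d` with `d` in a good interval are distinct members of the support. This
bounds `a + b`, and a pair with the largest `a + b` is as required. -/
theorem exists_maximal_isGood (hroot : ∀ n : ℕ, 0 < n → p ^ n ≠ 1)
    (hone : (1 : kˣ) ∉ orbit p q) (hnegone : (-1 : kˣ) ∉ orbit p q) (hq : 1 ≤ ν q) :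
    ∃ a b, IsGood p q ν a b ∧ ¬ IsGood p q ν (a + 1) b ∧ ¬ IsGood p q ν a (b + 1) := by
  have hbound : ∀ a b, IsGood p q ν a b → a + b < ν.support.card := by
    intro a b h
    have : (Finset.Icc (-(a : ℤ)) b).card ≤ ν.support.card := by
      refine Finset.card_le_card_of_injOn (orb p q) ?_ (orb_injective hroot).injOn
      intro d hd
      rw [Finset.coe_Icc, Set.mem_Icc] at hd
      exact h.1 d hd.1 hd.2
    rw [Int.card_Icc] at this
    omega
  have h0 : IsGood p q ν 0 0 := by
    constructor
    · intro d h1 h2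
      obtain rfl : d = 0 := by simp at h1 h2; omega
      rw [orb_zero, Finsupp.mem_support_iff]
      omega
    · intro d e h1 h2 h3 h4
      obtain rfl : d = 0 := by simp at h1 h2; omega
      obtain rfl : e = 0 := by simp at h3 h4; omega
      exact orb_mul_self_ne_one hone hnegone 0
  let A : Set ℕ := {N | ∃ a b, a + b = N ∧ IsGood p q ν a b}
  have hA : sSup A ∈ A := by
    refine Nat.sSup_mem ⟨0, 0, 0, rfl, h0⟩ ⟨ν.support.card, ?_⟩
    rintro _ ⟨a, b, rfl, h⟩
    exact (hbound a b h).le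
  have hmax : ∀ N ∈ A, N ≤ sSup A := fun N hN => by
    refine le_csSup ⟨ν.support.card, ?_⟩ hN
    rintro _ ⟨a, b, rfl, h⟩
    exact (hbound a b h).le
  obtain ⟨a, b, hab, h⟩ := hA
  refine ⟨a, b, h, fun h' => ?_, fun h' => ?_⟩
  · have := hmax (a + 1 + b) ⟨_, _, rfl, h'⟩
    omega
  · have := hmax (a + (b + 1)) ⟨_, _, rfl, h'⟩
    omega

/-- The elements of the orbit with index in `[-a, b]`, and their inverses. -/
def segment (p q : kˣ) (a b : ℕ) : Set kˣ :=
  {u | ∃ d : ℤ, -a ≤ d ∧ d ≤ b ∧ (u = orb p q d ∨ u = (orb p q d)⁻¹)}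

theorem inv_mem_segment {a b : ℕ} {u : kˣ} (h : u ∈ segment p q a b) : u⁻¹ ∈ segment p q a b := by
  obtain ⟨d, h1, h2, rfl | rfl⟩ := h
  · exact ⟨d, h1, h2, Or.inr rfl⟩
  · exact ⟨d, h1, h2, Or.inl (inv_inv _)⟩

/-- An element just outside the interval that is in the support must be inverse to one inside, since
otherwise the good interval could be lengthened by one. -/
theorem orb_mem_segment (hone : (1 : kˣ) ∉ orbit p q) (hnegone : (-1 : kˣ) ∉ orbit p q) {a b : ℕ}
    (h : IsGood p q ν a b) (ha : ¬ IsGood p q ν (a + 1) b) (hb : ¬ IsGood p q ν a (b + 1)) {d : ℤ}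
    (hd : -a - 1 ≤ d) (hd' : d ≤ b + 1) (hmem : orb p q d ∈ ν.support) :
    orb p q d ∈ segment p q a b := by
  by_cases h1 : -a ≤ d ∧ d ≤ b
  · exact ⟨d, h1.1, h1.2, Or.inl rfl⟩
  by_contra hnot
  have key : ∀ e : ℤ, -a ≤ e → e ≤ b → orb p q d * orb p q e ≠ 1 := fun e he he' h' =>
    hnot ⟨e, he, he', Or.inr (eq_inv_of_mul_eq_one_left h')⟩
  have key' : ∀ e e' : ℤ, (-a ≤ e ∧ e ≤ b ∨ e = d) → (-a ≤ e' ∧ e' ≤ b ∨ e' = d) →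
      orb p q e * orb p q e' ≠ 1 := by
    rintro e e' (he | rfl) (he' | rfl)
    · exact h.2 e e' he.1 he.2 he'.1 he'.2
    · rw [mul_comm]
      exact key e he.1 he.2
    · exact key e' he'.1 he'.2
    · exact orb_mul_self_ne_one hone hnegone _
  -- As `d` is `-a - 1` or `b + 1`, its sign tells at which end the interval would grow.
  rcases lt_or_ge d 0 with h0 | h0
  · refine ha ⟨fun e he he' => ?_, fun e e' he he' hf hf' => key' e e' ?_ ?_⟩
    · by_cases hed : e = d
      · rwa [hed]
      · exact h.1 e (by push_cast at he; omega) he'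
    all_goals push_cast at *; omega
  · refine hb ⟨fun e he he' => ?_, fun e e' he he' hf hf' => key' e e' ?_ ?_⟩
    · by_cases hed : e = d
      · rwa [hed]
      · exact h.1 e he (by push_cast at he'; omega)
    all_goals push_cast at *; omega

/-- The only possible neighbours of `orb p q d` are `orb p q (d - 1)` and `orb p q (d + 1)`.
Inversion reverses the arrows, which reduces the inverses to this case. -/
theorem segment_stable (hone : (1 : kˣ) ∉ orbit p q) (hnegone : (-1 : kˣ) ∉ orbit p q) {a b : ℕ}
    (h : IsGood p q ν a b) (ha : ¬ IsGood p q ν (a + 1) b) (hb : ¬ IsGood p q ν a (b + 1))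
    (hinv : ∀ i, ν i⁻¹ = ν i) {i j : kˣ} (hi : i ∈ segment p q a b) (hj : j ∈ ν.support)
    (hij : Arr p i j ∨ Arr p j i) : j ∈ segment p q a b := by
  have main : ∀ i j, (∃ d : ℤ, -a ≤ d ∧ d ≤ b ∧ i = orb p q d) → j ∈ ν.support →
      (Arr p i j ∨ Arr p j i) → j ∈ segment p q a b := by
    rintro i j ⟨d, h1, h2, rfl⟩ hj hij
    obtain ⟨e, he, he', rfl⟩ : ∃ e : ℤ, d - 1 ≤ e ∧ e ≤ d + 1 ∧ j = orb p q e := by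
      rcases hij with hij | hij
      · refine ⟨d - 1, by omega, by omega, ?_⟩
        have := orb_succ (p := p) (q := q) (d - 1)
        rw [sub_add_cancel, hij] at this
        exact mul_left_cancel this
      · exact ⟨d + 1, by omega, by omega, by rw [orb_succ]; exact hij⟩
    exact orb_mem_segment hone hnegone h ha hb (by omega) (by omega) hj
  obtain ⟨d, h1, h2, rfl | rfl⟩ := hi
  · exact main _ j ⟨d, h1, h2, rfl⟩ hj hij
  · rw [← inv_inv j]
    refine inv_mem_segment (main _ j⁻¹ ⟨d, h1, h2, rfl⟩ ?_ ?_)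
    · rwa [Finsupp.mem_support_iff, hinv, ← Finsupp.mem_support_iff]
    · exact hij.symm.imp (fun h => arr_inv.1 (by rwa [inv_inv]))
        fun h => arr_inv.1 (by rwa [inv_inv])

/-- Connectedness makes the maximal segment the whole support. Its `2(a + b + 1)` elements are
distinct, whence `a + b = n`, and `c_j = orb p q (j - a)` with `s = a` is the chain. -/
theorem exists_isChain (hone : (1 : kˣ) ∉ orbit p q) (hnegone : (-1 : kˣ) ∉ orbit p q)
    (hroot : ∀ n : ℕ, 0 < n → p ^ n ≠ 1) (hinv : ∀ i, ν i⁻¹ = ν i)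
    (hmult : MultiplicityOne ν) (hconn : ConnectedSupport p ν) (hq : 1 ≤ ν q)
    (n : ℕ) (hheight : height ν = 2 * (n + 1)) : ∃ c s, IsChain p q ν n c s := by
  classical
  obtain ⟨a, b, h, ha, hb⟩ := exists_maximal_isGood hroot hone hnegone hq
  have hinj := orb_injective (q := q) hroot
  have hsupp : segment p q a b = (ν.support : Set kˣ) := by
    refine hconn _ ?_ ⟨q, 0, by omega, by omega, Or.inl orb_zero.symm⟩
      (fun i => inv_mem_segment) fun i hi j hj => segment_stable hone hnegone h ha hb hinv hi hj
    rintro u ⟨d, h1, h2, rfl | rfl⟩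
    · exact h.1 d h1 h2
    · rw [Finset.mem_coe, Finsupp.mem_support_iff, hinv, ← Finsupp.mem_support_iff]
      exact h.1 d h1 h2
  have hcard : ν.support.card = 2 * (n + 1) := by
    rw [← hheight, height, Finsupp.sum, Finset.card_eq_sum_ones]
    refine Finset.sum_congr rfl fun u hu => ?_
    have := hmult u
    rw [Finsupp.mem_support_iff] at hu
    omega
  have hn : a + b = n := by
    have hI : ν.support = (Finset.Icc (-(a : ℤ)) b).image (orb p q)
        ∪ (Finset.Icc (-(a : ℤ)) b).image fun d => (orb p q d)⁻¹ := by
      ext u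
      rw [← Finset.mem_coe, ← hsupp]
      simp only [segment, Set.mem_ofPred_eq, Finset.mem_union, Finset.mem_image, Finset.mem_Icc]
      constructor
      · rintro ⟨d, h1, h2, rfl | rfl⟩
        · exact Or.inl ⟨d, ⟨h1, h2⟩, rfl⟩
        · exact Or.inr ⟨d, ⟨h1, h2⟩, rfl⟩
      · rintro (⟨d, ⟨h1, h2⟩, rfl⟩ | ⟨d, ⟨h1, h2⟩, rfl⟩)
        · exact ⟨d, h1, h2, Or.inl rfl⟩
        · exact ⟨d, h1, h2, Or.inr rfl⟩
    rw [hI, Finset.card_union_of_disjoint, Finset.card_image_of_injective _ hinj,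
      Finset.card_image_of_injective (f := fun d => (orb p q d)⁻¹) _ (inv_injective.comp hinj),
        Int.card_Icc] at hcard
    · omega
    · rw [Finset.disjoint_left]
      simp only [Finset.mem_image, Finset.mem_Icc]
      rintro _ ⟨d, hd, rfl⟩ ⟨e, he, hed⟩
      refine h.2 e d he.1 he.2 hd.1 hd.2 ?_
      rw [← hed, mul_inv_cancel]
  subst hn
  -- This excludes arrows between `orb p q d` and the inverse of `orb p q e` for `d ≠ e`: moving one
  -- index by a step towards the other would give two elements of the interval with product `1`.
  have hshift : ∀ d e : ℤ, orb p q d * orb p q (e + 1) = p ^ 2 * (orb p q d * orb p q e) := by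
    intro d e
    rw [orb_succ, mul_left_comm]
  refine ⟨fun j => orb p q (j - a), a, hmult, by omega, by simp [orb_zero], ?_, ?_, ?_, ?_, ?_⟩
  · intro u
    rw [← Finset.mem_coe, ← hsupp]
    constructor
    · rintro ⟨d, h1, h2, hu⟩
      exact ⟨(d + a).toNat, by omega, by
        rwa [show (((d + a).toNat : ℕ) : ℤ) - a = d by omega]⟩
    · rintro ⟨j, hj, hu⟩
      exact ⟨j - a, by omega, by omega, hu⟩
  · intro i _ j _ hij
    have := hinj hij
    omega
  · intro i hi j hj hij
    refine h.2 (i - a) (j - a) (by omega) (by omega) (by omega) (by omega) ?_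
    rw [hij, inv_mul_cancel]
  · intro u hu v hv huv
    rw [← Finset.mem_coe, ← hsupp] at hu hv
    constructor
    · intro harr
      rw [Arr] at harr
      obtain ⟨d, h1, h2, rfl | rfl⟩ := hu
      · obtain ⟨e, h3, h4, rfl | rfl⟩ := hv
        · rw [← orb_succ] at harr
          obtain rfl := hinj harr
          exact ⟨(e + a).toNat, by omega, Or.inl ⟨congrArg _ (by omega), congrArg _ (by omega)⟩⟩
        · exfalso
          rw [eq_mul_inv_iff_mul_eq] at harr
          rcases lt_trichotomy d e with hde | rfl | hde
          · have := hshift d (e - 1)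
            rw [sub_add_cancel, harr] at this
            exact h.2 d (e - 1) h1 h2 (by omega) (by omega) (by simpa using this)
          · exact huv rfl
          · have := hshift e (d - 1)
            rw [sub_add_cancel, mul_comm, harr] at this
            exact h.2 e (d - 1) h3 h4 (by omega) (by omega) (by simpa using this)
      · obtain ⟨e, h3, h4, rfl | rfl⟩ := hv
        · exfalso
          have harr : p ^ 2 * (orb p q d * orb p q e) = 1 := by
            rw [mul_left_comm, ← harr, mul_inv_cancel]
          rcases lt_trichotomy d e with hde | rfl | hde
          · rw [mul_comm (orb p q d), ← hshift] at harr
            exact h.2 _ _ h3 h4 (by omega) (by omega) harr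
          · exact huv (inv_inv _).symm
          · rw [← hshift] at harr
            exact h.2 _ _ h1 h2 (by omega) (by omega) harr
        · rw [eq_mul_inv_iff_mul_eq, inv_mul_eq_iff_eq_mul, mul_comm, ← orb_succ] at harr
          obtain rfl := hinj harr
          exact ⟨(d + a).toNat, by omega, Or.inr ⟨congrArg (fun x => (orb p q x)⁻¹) (by omega),
            congrArg (fun x => (orb p q x)⁻¹) (by omega)⟩⟩
    · rintro ⟨j, hj, ⟨rfl, rfl⟩ | ⟨rfl, rfl⟩⟩
      · rw [Arr, ← orb_succ]
        congr 1
        push_cast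
        ring
      · rw [arr_inv, Arr, show ((j + 1 : ℕ) : ℤ) - a = (j - a) + 1 by push_cast; ring, orb_succ]
  · intro u v h1 h2
    rw [Arr] at h1 h2
    rw [h2, ← mul_assoc] at h1
    -- Arrows in both directions would give `u = p ^ 4 * u`.
    refine hroot 4 (by norm_num) ?_
    have := mul_right_cancel ((one_mul u).trans h1)
    rw [this, ← pow_add]

end Existence

end VV

namespace VV

open scoped Classical

variable {k : Type u} [Field k] {p q : kˣ} {ν : kˣ →₀ ℕ} {n : ℕ}

/-! ### Sequences of multiplicity one -/

namespace Seqs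

theorem count {m : ℕ} (i : Seqs ν m) (u : kˣ) :
    (∑ r, if i.1 r = u then 1 else 0) + (∑ r, if (i.1 r)⁻¹ = u then 1 else 0) = ν u := by
  have h := DFunLike.congr_fun i.2 u
  rw [Finsupp.add_apply, Finsupp.finsetSum_apply, Finsupp.finsetSum_apply] at h
  simpa only [Finsupp.single_apply] using h

theorem exists_of_mem {m : ℕ} (i : Seqs ν m) {u : kˣ} (h : u ∈ ν.support) :
    ∃ r, i.1 r = u ∨ (i.1 r)⁻¹ = u := by
  by_contra hne
  push Not at hne
  have := i.count u
  rw [Finset.sum_eq_zero fun r _ => if_neg (hne r).1, Finset.sum_eq_zero fun r _ =>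
    if_neg (hne r).2] at this
  exact (Finsupp.mem_support_iff.1 h) this.symm

theorem val_injective {m : ℕ} (h1 : ∀ u, ν u ≤ 1) (i : Seqs ν m) : Function.Injective i.1 := by
  intro r t h
  by_contra hrt
  have h2 := i.count (i.1 r)
  have h3 : ∑ x ∈ {r, t}, (if i.1 x = i.1 r then 1 else 0)
      ≤ ∑ x, if i.1 x = i.1 r then 1 else 0 :=
    Finset.sum_le_sum_of_subset (Finset.subset_univ _)
  rw [Finset.sum_pair hrt, if_pos rfl, if_pos h.symm] at h3
  have := h1 (i.1 r)
  omega

/-- Such a value would be counted once in each of the two sums, hence twice in `ν`. The case `r = t`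
says that no entry is its own inverse. -/
theorem val_ne_inv {m : ℕ} (h1 : ∀ u, ν u ≤ 1) (i : Seqs ν m) (r t : Fin m) :
    i.1 r ≠ (i.1 t)⁻¹ := by
  intro h
  have h2 := i.count (i.1 r)
  have h3 := Finset.single_le_sum (f := fun x => if i.1 x = i.1 r then 1 else 0)
    (fun _ _ => Nat.zero_le _) (Finset.mem_univ r)
  have h4 := Finset.single_le_sum (f := fun x => if (i.1 x)⁻¹ = i.1 r then 1 else 0)
    (fun _ _ => Nat.zero_le _) (Finset.mem_univ t)
  rw [if_pos rfl] at h3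
  rw [if_pos h.symm] at h4
  have := h1 (i.1 r)
  omega

theorem swap_val (r : Fin n) (i : Seqs ν (n + 1)) (l : Fin (n + 1)) :
    (i.swap r).1 l = i.1 (Equiv.swap r.castSucc r.succ l) := rfl

theorem swap_val_castSucc (r : Fin n) (i : Seqs ν (n + 1)) :
    (i.swap r).1 r.castSucc = i.1 r.succ := by
  rw [swap_val, Equiv.swap_apply_left]

theorem swap_val_succ (r : Fin n) (i : Seqs ν (n + 1)) : (i.swap r).1 r.succ = i.1 r.castSucc := by
  rw [swap_val, Equiv.swap_apply_right]

theorem swap_val_of_ne {r : Fin n} (i : Seqs ν (n + 1)) {l : Fin (n + 1)} (h : l ≠ r.castSucc)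
    (h' : l ≠ r.succ) : (i.swap r).1 l = i.1 l := by
  rw [swap_val, Equiv.swap_apply_of_ne_of_ne h h']

theorem flip_val_zero (i : Seqs ν (n + 1)) : i.flip.1 0 = (i.1 0)⁻¹ :=
  (Function.update_self (0 : Fin (n + 1)) (i.1 0)⁻¹ i.1 : Function.update i.1 0 (i.1 0)⁻¹ 0 = _)

theorem flip_val_of_ne (i : Seqs ν (n + 1)) {l : Fin (n + 1)} (h : l ≠ 0) : i.flip.1 l = i.1 l :=
  Function.update_of_ne h _ _

theorem swap_swap (r : Fin n) (i : Seqs ν (n + 1)) : (i.swap r).swap r = i :=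
  Subtype.ext (funext fun l => by rw [swap_val, swap_val, Equiv.swap_apply_self])

theorem flip_flip (i : Seqs ν (n + 1)) : i.flip.flip = i :=
  Subtype.ext (funext fun l => by
    by_cases h : l = 0
    · rw [h, flip_val_zero, flip_val_zero, inv_inv]
    · rw [flip_val_of_ne _ h, flip_val_of_ne _ h])

theorem swap_comm {r t : Fin n} (h : (r : ℕ) ≠ t + 1) (h' : (t : ℕ) ≠ r + 1) (i : Seqs ν (n + 1)) :
    (i.swap t).swap r = (i.swap r).swap t := by
  by_cases hrt : r = t
  · rw [hrt]
  refine Subtype.ext (funext fun l => ?_)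
  simp only [swap_val]
  have hrt' : (r : ℕ) ≠ t := fun h => hrt (Fin.ext h)
  have := Equiv.Perm.Disjoint.commute (f := Equiv.swap r.castSucc r.succ)
    (g := Equiv.swap t.castSucc t.succ) (by
      intro x
      by_cases h1 : x = r.castSucc ∨ x = r.succ
      · right
        refine Equiv.swap_apply_of_ne_of_ne ?_ ?_
        all_goals
          rintro rfl
          simp only [Fin.ext_iff, Fin.val_castSucc, Fin.val_succ] at h1
          omega
      · left
        push Not at h1
        exact Equiv.swap_apply_of_ne_of_ne h1.1 h1.2)
  exact congrArg i.1 (Equiv.congr_fun this.eq l).symm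

theorem succ_eq_castSucc {r t : Fin n} (ht : (t : ℕ) = r + 1) : r.succ = t.castSucc :=
  Fin.ext (by simp [ht])

theorem swap_braid {r t : Fin n} (ht : (t : ℕ) = r + 1) (i : Seqs ν (n + 1)) :
    ((i.swap t).swap r).swap t = ((i.swap r).swap t).swap r := by
  refine Subtype.ext (funext fun l => ?_)
  simp only [swap_val, ← succ_eq_castSucc ht]
  have h1 : r.castSucc ≠ r.succ := by simp [Fin.ext_iff]
  have h2 : r.castSucc ≠ t.succ := by simp [Fin.ext_iff, ht]; omega
  have h3 : r.succ ≠ t.succ := by simp [Fin.ext_iff, ht]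
  have e1 := Equiv.swap_mul_swap_mul_swap h1 h2
  have e2 := Equiv.swap_mul_swap_mul_swap h3.symm h2.symm
  rw [Equiv.swap_comm t.succ r.succ, Equiv.swap_comm r.succ r.castSucc,
    Equiv.swap_comm r.castSucc t.succ] at e2
  exact congrArg i.1 (Equiv.congr_fun (e1.trans e2.symm) l)

theorem flip_swap {r : Fin n} (hr : (r : ℕ) ≠ 0) (i : Seqs ν (n + 1)) :
    (i.swap r).flip = i.flip.swap r := by
  have h1 : r.castSucc ≠ 0 := fun h => hr (congrArg Fin.val h)
  refine Subtype.ext (funext fun l => ?_)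
  by_cases hl : l = 0
  · subst hl
    rw [flip_val_zero, swap_val_of_ne _ h1.symm (Fin.succ_ne_zero r).symm,
      swap_val_of_ne _ h1.symm (Fin.succ_ne_zero r).symm, flip_val_zero]
  · rw [flip_val_of_ne _ hl, swap_val, swap_val, flip_val_of_ne]
    intro h
    rw [Equiv.swap_apply_eq_iff, Equiv.swap_apply_of_ne_of_ne h1.symm (Fin.succ_ne_zero r).symm]
      at h
    exact hl h

theorem castSucc_eq_zero {r : Fin n} (hr : (r : ℕ) = 0) : r.castSucc = 0 := Fin.ext (by simp [hr])

/-- Both sides invert the first two entries: this is the relation of length four in type `B`. -/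
theorem flip_swap_braid {r : Fin n} (hr : (r : ℕ) = 0) (i : Seqs ν (n + 1)) :
    ((i.flip.swap r).flip).swap r = (((i.swap r).flip).swap r).flip := by
  have h0 := castSucc_eq_zero hr
  have h1 : ∀ j : Seqs ν (n + 1), (j.swap r).1 0 = j.1 r.succ := fun j => by
    rw [← h0, swap_val_castSucc]
  have h1' : ∀ j : Seqs ν (n + 1), (j.swap r).1 r.succ = j.1 0 := fun j => by
    rw [← h0, swap_val_succ]
  have h2 := Fin.succ_ne_zero r
  refine Subtype.ext (funext fun l => ?_)
  by_cases hl : l = 0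
  · subst hl
    rw [h1, flip_val_of_ne _ h2, h1', flip_val_zero, flip_val_zero, h1, flip_val_of_ne _ h2, h1']
  by_cases hl' : l = r.succ
  · subst hl'
    rw [h1', flip_val_zero, h1, flip_val_of_ne _ h2, flip_val_of_ne _ h2, h1', flip_val_zero, h1]
  · have h3 : l ≠ r.castSucc := h0 ▸ hl
    rw [swap_val_of_ne _ h3 hl', flip_val_of_ne _ hl, swap_val_of_ne _ h3 hl', flip_val_of_ne _ hl,
      flip_val_of_ne _ hl, swap_val_of_ne _ h3 hl', flip_val_of_ne _ hl, swap_val_of_ne _ h3 hl']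

end Seqs

/-! ### The polynomial representation -/

/-- The number `1` if `u = v`, and `-1` if `u = v⁻¹`. -/
def pair (u v : kˣ) : ℤ := (if u = v then 1 else 0) - (if u = v⁻¹ then 1 else 0)

theorem pair_inv_left (u v : kˣ) : pair u⁻¹ v = -pair u v := by
  simp only [pair, neg_sub, inv_eq_iff_eq_inv, inv_inv]

theorem pair_inv_right (u v : kˣ) : pair u v⁻¹ = -pair u v := by
  rw [pair, pair, neg_sub, inv_inv]

theorem pair_self {u : kˣ} (h : u ≠ u⁻¹) : pair u u = 1 := by
  rw [pair, if_pos rfl, if_neg h, sub_zero]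

theorem pair_of_ne {u v : kˣ} (h : u ≠ v) (h' : u ≠ v⁻¹) : pair u v = 0 := by
  rw [pair, if_neg h, if_neg h', sub_zero]

variable (k n) in
/-- The ring of polynomials in one variable for every `j < n`, and one more variable. -/
abbrev Poly : Type u := MvPolynomial (Option (Fin n)) k

/-- The sum of the first `j` variables. -/
def partialSum (j : ℕ) : Poly k n :=
  ∑ i ∈ Finset.range j, if h : i < n then MvPolynomial.X (some ⟨i, h⟩) else 0

/-- The polynomials `y_0, …, y_n` with `y_{j+1} - y_j = X_j` and `y_s = X_none`. -/
def y (s j : ℕ) : Poly k n := MvPolynomial.X none + partialSum j - partialSum s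

theorem y_self (s : ℕ) : y (k := k) (n := n) s s = MvPolynomial.X none := by
  rw [y, add_sub_cancel_right]

theorem y_succ_sub (s : ℕ) {j : ℕ} (h : j < n) :
    y s (j + 1) - y s j = (MvPolynomial.X (some ⟨j, h⟩) : Poly k n) := by
  have : (partialSum (j + 1) : Poly k n) = partialSum j + MvPolynomial.X (some ⟨j, h⟩) := by
    rw [partialSum, Finset.sum_range_succ, dif_pos h, partialSum]
  rw [y, y, this]
  ring

/-- The odd function on the support with values `y_j` at `c_j`. -/
def yhat (n : ℕ) (c : ℕ → kˣ) (s : ℕ) (u : kˣ) : Poly k n :=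
  ∑ j ∈ Finset.range (n + 1), pair u (c j) • y s j

variable {c : ℕ → kˣ} {s : ℕ}

theorem yhat_inv (u : kˣ) : yhat n c s u⁻¹ = -yhat n c s u := by
  rw [yhat, yhat, ← Finset.sum_neg_distrib]
  refine Finset.sum_congr rfl fun j _ => ?_
  rw [pair_inv_left, neg_smul]

theorem IsChain.yhat_c (hc : IsChain p q ν n c s) {j : ℕ} (hj : j ≤ n) :
    yhat n c s (c j) = y s j := by
  rw [yhat, Finset.sum_eq_single j, pair_self (hc.ne_inv j hj j hj), one_smul]
  · intro i hi hij
    rw [Finset.mem_range] at hi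
    rw [pair_of_ne (fun h => hij (hc.inj _ hj _ (by omega) h).symm)
      (hc.ne_inv _ hj _ (by omega)), zero_smul]
  · intro h
    exact absurd (Finset.mem_range.2 (by omega)) h

theorem IsChain.q_mem (hc : IsChain p q ν n c s) : q ∈ ν.support :=
  (hc.mem q).2 ⟨s, hc.s_le, Or.inl hc.c_s.symm⟩

theorem IsChain.q_ne_inv (hc : IsChain p q ν n c s) : q ≠ q⁻¹ := by
  have := hc.ne_inv s hc.s_le s hc.s_le
  rwa [hc.c_s] at this

theorem IsChain.yhat_q (hc : IsChain p q ν n c s) : yhat n c s q = MvPolynomial.X none := by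
  have := hc.yhat_c hc.s_le
  rwa [hc.c_s, y_self] at this

/-- The weight of the exchange of two neighbours. -/
def omega (p : kˣ) (n : ℕ) (c : ℕ → kˣ) (s : ℕ) (a b : kˣ) : Poly k n :=
  if Arr p b a then yhat n c s b - yhat n c s a else 1

/-- The weight of the inversion of the first entry. -/
def omegaZero (q : kˣ) (n : ℕ) (c : ℕ → kˣ) (s : ℕ) (a : kˣ) : Poly k n :=
  if a = q then yhat n c s a else 1

/-- Inversion reverses arrows and `yhat` is odd. This symmetry makes the braid relation of length
four hold in the polynomial representation. -/
theorem omega_inv (a b : kˣ) : omega p n c s b⁻¹ a⁻¹ = omega p n c s a b := by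
  rw [omega, omega, arr_inv, yhat_inv, yhat_inv, neg_sub_neg]

/-- The monomial matrix that sends the basis vector at `i` to `a i` times that at `t i`. -/
def mono (t : Seqs ν (n + 1) → Seqs ν (n + 1)) (a : Seqs ν (n + 1) → Poly k n) :
    Matrix (Seqs ν (n + 1)) (Seqs ν (n + 1)) (Poly k n) :=
  Matrix.of fun g h => if g = t h then a h else 0

theorem mono_apply (t : Seqs ν (n + 1) → Seqs ν (n + 1)) (a : Seqs ν (n + 1) → Poly k n)
    (g h : Seqs ν (n + 1)) : mono t a g h = if g = t h then a h else 0 := rfl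

theorem mono_mul (t t' : Seqs ν (n + 1) → Seqs ν (n + 1)) (a a' : Seqs ν (n + 1) → Poly k n) :
    mono t a * mono t' a' = mono (fun i => t (t' i)) fun i => a (t' i) * a' i := by
  ext1 g h
  rw [Matrix.mul_apply, Finset.sum_eq_single (t' h)]
  · simp only [mono_apply, if_true]
    split_ifs <;> simp
  · intro l _ hl
    simp only [mono_apply, if_neg hl, mul_zero]
  · simp

theorem mono_sub (t : Seqs ν (n + 1) → Seqs ν (n + 1)) (a a' : Seqs ν (n + 1) → Poly k n) :
    mono t a - mono t a' = mono t fun i => a i - a' i := by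
  ext1 g h
  simp only [Matrix.sub_apply, mono_apply]
  split_ifs <;> simp

theorem mono_neg (t : Seqs ν (n + 1) → Seqs ν (n + 1)) (a : Seqs ν (n + 1) → Poly k n) :
    -mono t a = mono t fun i => -a i := by
  ext1 g h
  simp only [Matrix.neg_apply, mono_apply]
  split_ifs <;> simp

theorem mono_zero (t : Seqs ν (n + 1) → Seqs ν (n + 1)) :
    mono t (fun _ => (0 : Poly k n)) = 0 := by
  ext1 g h
  simp [mono_apply]

theorem mono_one : mono (fun i => i) (fun _ => (1 : Poly k n)) =
    (1 : Matrix (Seqs ν (n + 1)) (Seqs ν (n + 1)) (Poly k n)) := by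
  ext1 g h
  rw [mono_apply, Matrix.one_apply]

/-- The images of the generators in the polynomial representation. -/
def genMatrix (p q : kˣ) (ν : kˣ →₀ ℕ) (n : ℕ) (c : ℕ → kˣ) (s : ℕ) :
    Gen ν n → Matrix (Seqs ν (n + 1)) (Seqs ν (n + 1)) (Poly k n)
  | .x l => mono (fun i => i) fun i => yhat n c s (i.1 l)
  | .s r => mono (Seqs.swap r) fun i => omega p n c s (i.1 r.castSucc) (i.1 r.succ)
  | .e j => mono (fun i => i) fun i => if i = j then 1 else 0
  | .pi => mono Seqs.flip fun i => omegaZero q n c s (i.1 0)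

/-- The polynomial representation of the free algebra. -/
def freeRep (p q : kˣ) (ν : kˣ →₀ ℕ) (n : ℕ) (c : ℕ → kˣ) (s : ℕ) : FreeAlgebra k (Gen ν n) →ₐ[k]
    Matrix (Seqs ν (n + 1)) (Seqs ν (n + 1)) (Poly k n) :=
  FreeAlgebra.lift k (genMatrix p q ν n c s)

theorem freeRep_X (l) : freeRep p q ν n c s (X l) = mono (fun i => i) fun i => yhat n c s (i.1 l) :=
  FreeAlgebra.lift_ι_apply _ _

theorem freeRep_σ (r) : freeRep p q ν n c s (σ r) =
    mono (Seqs.swap r) fun i => omega p n c s (i.1 r.castSucc) (i.1 r.succ) :=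
  FreeAlgebra.lift_ι_apply _ _

theorem freeRep_E (j) : freeRep p q ν n c s (E j) =
    mono (fun i => i) fun i => if i = j then 1 else 0 :=
  FreeAlgebra.lift_ι_apply _ _

theorem freeRep_Pi : freeRep p q ν n c s Pi = mono Seqs.flip fun i => omegaZero q n c s (i.1 0) :=
  FreeAlgebra.lift_ι_apply _ _

theorem mono_congr {t t' : Seqs ν (n + 1) → Seqs ν (n + 1)} {a a' : Seqs ν (n + 1) → Poly k n}
    (ht : ∀ i, t i = t' i) (ha : ∀ i, a i = a' i) : mono t a = mono t' a' := by
  rw [funext ht, funext ha]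

/-- Monomial matrices with at most one nonzero column. -/
theorem mono_congr_single {t t' : Seqs ν (n + 1) → Seqs ν (n + 1)}
    {a a' : Seqs ν (n + 1) → Poly k n} (j : Seqs ν (n + 1)) (ht : t j = t' j)
    (h : ∀ i, i ≠ j → a i = 0) (h' : ∀ i, i ≠ j → a' i = 0) (ha : a j = a' j) :
    mono t a = mono t' a' := by
  ext1 g l
  simp only [mono_apply]
  by_cases hj : l = j
  · subst hj
    rw [ht, ha]
  · simp [h l hj, h' l hj]

/-- All relations that involve equal or mutually inverse entries at different places are vacuous. In
a square `σ_r ^ 2` the two weights are `omega a b` and `omega b a`, of which at most one differs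
from `1`. In a braid relation the two sides multiply the same weights in different orders. -/
theorem IsChain.freeRep_rel (hc : IsChain p q ν n c s) {a b : FreeAlgebra k (Gen ν n)}
    (h : Rel p q ν n a b) : freeRep p q ν n c s a = freeRep p q ν n c s b := by
  have hne_inv := fun i : Seqs ν (n + 1) => i.val_ne_inv hc.le_one
  have hinj := fun i : Seqs ν (n + 1) => i.val_injective hc.le_one
  have hadj : ∀ (i : Seqs ν (n + 1)) (r : Fin n), i.1 r.castSucc ≠ i.1 r.succ := fun i r h =>
    (Fin.castSucc_lt_succ (i := r)).ne (hinj i h)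
  have hfar : ∀ (i : Seqs ν (n + 1)) (r t : Fin n), (t : ℕ) = r + 1 →
      i.1 r.castSucc ≠ i.1 t.succ := by
    intro i r t ht h
    have := congrArg Fin.val (hinj i h)
    simp at this
    omega
  have hzero : ∀ (i : Seqs ν (n + 1)) (r : Fin n), (r : ℕ) = 0 → (i.1 0)⁻¹ ≠ i.1 r.succ :=
    fun i r _ h => hne_inv i _ _ h.symm
  cases h <;> simp only [map_mul, map_sub, map_neg, map_zero, map_one, map_sum, pow_two,
    freeRep_X, freeRep_σ, freeRep_E, freeRep_Pi, mono_mul, mono_sub, mono_neg]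
  case e_mul_self => exact mono_congr (fun _ => rfl) fun i => by split_ifs <;> simp
  case e_mul_ne i j h =>
    rw [← mono_zero fun i => i]
    refine mono_congr (fun _ => rfl) fun l => ?_
    split_ifs with h1 h2
    · exact absurd (h1.symm.trans h2) h
    all_goals simp
  case e_sum =>
    rw [← mono_one]
    ext1 g h
    rw [Matrix.sum_apply]
    simp only [mono_apply]
    split_ifs <;> simp
  case s_e r i =>
    refine mono_congr (fun _ => rfl) fun j => ?_
    have : (j.swap r = i.swap r) = (j = i) := propext
      ⟨fun h => by rw [← Seqs.swap_swap r j, h, Seqs.swap_swap], fun h => by rw [h]⟩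
    simp only [this]
    split_ifs <;> simp
  case x_e l i => exact mono_congr (fun _ => rfl) fun j => mul_comm _ _
  case x_x l l' => exact mono_congr (fun _ => rfl) fun j => mul_comm _ _
  case s_sq_none r i hne h =>
    refine mono_congr_single i (Seqs.swap_swap _ _) ?_ ?_ ?_ <;>
      simp +contextual [Seqs.swap_val_castSucc, Seqs.swap_val_succ, omega, h.1, h.2]
  case s_sq_left r i h =>
    refine mono_congr_single i (Seqs.swap_swap _ _) ?_ ?_ ?_ <;>
      simp +contextual [Seqs.swap_val_castSucc, Seqs.swap_val_succ, omega, h.1, h.2]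
  case s_sq_right r i h =>
    refine mono_congr_single i (Seqs.swap_swap _ _) ?_ ?_ ?_ <;>
      simp +contextual [Seqs.swap_val_castSucc, Seqs.swap_val_succ, omega, h.1, h.2]
  case s_sq_both r i h => exact absurd h.2 (hc.arr_irrefl _ _ h.1)
  case s_sq_eq r i h => exact absurd h (hadj i r)
  case s_s r t h h' =>
    refine mono_congr (fun i => Seqs.swap_comm h h' i) fun i => ?_
    by_cases hrt : r = t
    · rw [hrt]
    have hrt' : (r : ℕ) ≠ t := fun h => hrt (Fin.ext h)
    have e : ∀ r t : Fin n, (r : ℕ) ≠ t + 1 → (t : ℕ) ≠ r + 1 → (r : ℕ) ≠ t →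
        (i.swap t).1 r.castSucc = i.1 r.castSucc ∧ (i.swap t).1 r.succ = i.1 r.succ := by
      intro r t h1 h2 h3
      constructor <;> refine Seqs.swap_val_of_ne _ ?_ ?_ <;>
        simp only [ne_eq, Fin.ext_iff, Fin.val_castSucc, Fin.val_succ] <;> omega
    rw [(e r t h h' hrt').1, (e r t h h' hrt').2, (e t r h' h hrt'.symm).1,
      (e t r h' h hrt'.symm).2, mul_comm]
  case braid_none r t ht i h =>
    rw [sub_mul, mono_mul, mono_mul, sub_eq_zero]
    refine mono_congr (fun j => Seqs.swap_braid ht j) fun j => ?_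
    congr 1
    have h1 : r.succ = t.castSucc := Seqs.succ_eq_castSucc ht
    have h2 : r.castSucc ≠ t.castSucc := by rw [← h1]; exact Fin.castSucc_lt_succ.ne
    have h3 : r.castSucc ≠ t.succ := fun h => by
      have := congrArg Fin.val h
      simp at this
      omega
    have h4 : t.succ ≠ t.castSucc := Fin.castSucc_lt_succ.ne'
    have e1 : ∀ j : Seqs ν (n + 1), (j.swap t).1 r.castSucc = j.1 r.castSucc := fun j =>
      Seqs.swap_val_of_ne _ h2 h3
    have e2 : ∀ j : Seqs ν (n + 1), (j.swap r).1 t.succ = j.1 t.succ := fun j =>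
      Seqs.swap_val_of_ne _ h3.symm (h1 ▸ h4)
    have e3 : ∀ j : Seqs ν (n + 1), (j.swap r).1 t.castSucc = j.1 r.castSucc := fun j => by
      rw [← h1, Seqs.swap_val_succ]
    have e4 : ∀ j : Seqs ν (n + 1), (j.swap r).1 r.castSucc = j.1 t.castSucc := fun j => by
      rw [← h1, Seqs.swap_val_castSucc]
    -- Both sides become the product of the weights of the three pairs among three consecutive
    -- entries.
    simp only [h1, e1, e2, e3, e4, Seqs.swap_val_castSucc, Seqs.swap_val_succ]
    ring
  case braid_right r t ht i h h' => exact absurd h (hfar i r t ht)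
  case braid_left r t ht i h h' => exact absurd h (hfar i r t ht)
  case braid_both r t ht i h h' => exact absurd h (hfar i r t ht)
  case s_x_left r i h => exact absurd h (hadj i r)
  case s_x_right r i h => exact absurd h (hadj i r)
  case s_x_else r l i h =>
    rw [← mono_zero fun j => j.swap r]
    refine mono_congr (fun j => rfl) fun j => ?_
    rw [Seqs.swap_val, Equiv.swap_apply_self]
    ring
  case pi_e i =>
    refine mono_congr (fun _ => rfl) fun j => ?_
    have : (j.flip = i.flip) = (j = i) := propext
      ⟨fun h => by rw [← Seqs.flip_flip j, h, Seqs.flip_flip], fun h => by rw [h]⟩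
    simp only [this]
    split_ifs <;> simp
  case pi_sq_q i h =>
    refine mono_congr_single i (Seqs.flip_flip _) ?_ ?_ ?_ <;>
      simp +contextual [Seqs.flip_val_zero, omegaZero, h, hc.q_ne_inv.symm]
  case pi_sq_q_inv i h =>
    refine mono_congr_single i (Seqs.flip_flip _) ?_ ?_ ?_ <;>
      simp +contextual [Seqs.flip_val_zero, omegaZero, h, hc.q_ne_inv.symm, yhat_inv]
  case pi_sq_ne i h h' =>
    have h1 : (i.1 0)⁻¹ ≠ q := fun e => h' (by rw [← e, inv_inv])
    refine mono_congr_single i (Seqs.flip_flip _) ?_ ?_ ?_ <;>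
      simp +contextual [Seqs.flip_val_zero, omegaZero, h, h1]
  case pi_x_zero =>
    refine mono_congr (fun _ => rfl) fun j => ?_
    rw [Seqs.flip_val_zero, yhat_inv, neg_neg, mul_comm]
  case pi_x l h =>
    refine mono_congr (fun _ => rfl) fun j => ?_
    rw [Seqs.flip_val_of_ne _ h, mul_comm]
  case s_pi_none r hr i h =>
    rw [sub_eq_zero]
    refine mono_congr (fun j => Seqs.flip_swap_braid hr j) fun j => ?_
    congr 1
    have h0 := Seqs.castSucc_eq_zero hr
    have e1 : ∀ j : Seqs ν (n + 1), (j.swap r).1 0 = j.1 r.succ := fun j => by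
      rw [← h0, Seqs.swap_val_castSucc]
    have e2 : ∀ j : Seqs ν (n + 1), (j.swap r).1 r.succ = j.1 0 := fun j => by
      rw [← h0, Seqs.swap_val_succ]
    have e3 : ∀ j : Seqs ν (n + 1), j.flip.1 r.succ = j.1 r.succ := fun j =>
      Seqs.flip_val_of_ne _ (Fin.succ_ne_zero r)
    simp only [h0, e1, e2, e3, Seqs.flip_val_zero]
    -- The two sides differ only in that some weights are taken at the inverted and exchanged pair.
    have h3 := omega_inv (p := p) (n := n) (c := c) (s := s) (j.1 0) (j.1 r.succ)
    have h4 := omega_inv (p := p) (n := n) (c := c) (s := s) (j.1 0)⁻¹ (j.1 r.succ)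
    rw [inv_inv] at h4
    rw [h3, h4]
    ring
  case s_pi_q r hr i h h' => exact absurd h (hzero i r hr)
  case s_pi_q_inv r hr i h h' => exact absurd h (hzero i r hr)
  case pi_s r hr =>
    refine mono_congr (fun i => Seqs.flip_swap hr i) fun i => ?_
    have h1 : r.castSucc ≠ 0 := fun h => hr (congrArg Fin.val h)
    rw [Seqs.flip_val_of_ne _ h1, Seqs.flip_val_of_ne _ (Fin.succ_ne_zero r),
      Seqs.swap_val_of_ne _ h1.symm (Fin.succ_ne_zero r).symm, mul_comm]

/-- The algebra attached to `ν`, as a type of its own. -/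
def Alg (p q : kˣ) (ν : kˣ →₀ ℕ) (n : ℕ) : Type u := VVAlgebra p q ν n

instance : Ring (Alg p q ν n) := inferInstanceAs (Ring (VVAlgebra p q ν n))

instance : Algebra k (Alg p q ν n) := inferInstanceAs (Algebra k (VVAlgebra p q ν n))

variable (p q ν n) in
/-- The quotient map from the free algebra. -/
def toAlg : FreeAlgebra k (Gen ν n) →ₐ[k] Alg p q ν n := RingQuot.mkAlgHom k (Rel p q ν n)

theorem toAlg_eq {a b : FreeAlgebra k (Gen ν n)} (h : Rel p q ν n a b) :
    toAlg p q ν n a = toAlg p q ν n b :=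
  RingQuot.mkAlgHom_rel k h

theorem toAlg_surjective : Function.Surjective (toAlg p q ν n) :=
  RingQuot.mkAlgHom_surjective k (Rel p q ν n)

/-- The polynomial representation. -/
def IsChain.rep (hc : IsChain p q ν n c s) :
    Alg p q ν n →ₐ[k] Matrix (Seqs ν (n + 1)) (Seqs ν (n + 1)) (Poly k n) :=
  RingQuot.liftAlgHom k ⟨freeRep p q ν n c s, fun _ _ => hc.freeRep_rel⟩

theorem IsChain.rep_mk (hc : IsChain p q ν n c s) (a : FreeAlgebra k (Gen ν n)) :
    hc.rep (toAlg p q ν n a) = freeRep p q ν n c s a :=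
  RingQuot.liftAlgHom_mkAlgHom_apply _ _ _ _

end VV

namespace VV

open scoped Classical

variable {k : Type u} [Field k] {p q : kˣ} {ν : kˣ →₀ ℕ} {n : ℕ}

/-! ### The generators of the algebra -/

variable (p q) in
/-- The element `x_l` of the algebra. -/
def hx (l : Fin (n + 1)) : Alg p q ν n := toAlg p q ν n (X l)

variable (p q) in
/-- The idempotent `e(i)` of the algebra. -/
def he (i : Seqs ν (n + 1)) : Alg p q ν n := toAlg p q ν n (E i)

variable (p q ν n) in
/-- The elements `π` and `σ_r` of the algebra. -/
def hT : Option (Fin n) → Alg p q ν n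
  | none => toAlg p q ν n Pi
  | some r => toAlg p q ν n (σ r)

/-- The action of the simple reflections of type `B` on sequences. -/
def act : Option (Fin n) → Seqs ν (n + 1) → Seqs ν (n + 1)
  | none => Seqs.flip
  | some r => Seqs.swap r

theorem act_act (o : Option (Fin n)) (i : Seqs ν (n + 1)) : act o (act o i) = i := by
  cases o with
  | none => exact i.flip_flip
  | some r => exact i.swap_swap r

theorem eq_top_of_generators (U : Subalgebra k (Alg p q ν n)) (h1 : ∀ l, hx p q l ∈ U)
    (h2 : ∀ i, he p q i ∈ U) (h3 : ∀ o, hT p q ν n o ∈ U) (a : Alg p q ν n) : a ∈ U := by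
  obtain ⟨a, rfl⟩ := toAlg_surjective a
  induction a using FreeAlgebra.induction with
  | grade0 r => rw [AlgHom.commutes]; exact U.algebraMap_mem r
  | grade1 g =>
    cases g with
    | x l => exact h1 l
    | s r => exact h3 (some r)
    | e i => exact h2 i
    | pi => exact h3 none
  | mul a b ha hb => rw [map_mul]; exact U.mul_mem ha hb
  | add a b ha hb => rw [map_add]; exact U.add_mem ha hb

theorem he_mul_self (i : Seqs ν (n + 1)) : he p q i * he p q i = he p q i := by
  rw [he, ← map_mul]
  exact toAlg_eq (Rel.e_mul_self i)

theorem he_mul_ne {i j : Seqs ν (n + 1)} (h : i ≠ j) : he p q i * he p q j = 0 := by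
  rw [he, he, ← map_mul, ← map_zero (toAlg p q ν n)]
  exact toAlg_eq (Rel.e_mul_ne i j h)

theorem sum_he : ∑ i : Seqs ν (n + 1), he p q i = 1 := by
  rw [← map_one (toAlg p q ν n), ← toAlg_eq Rel.e_sum, map_sum]
  rfl

theorem eq_of_mul_he {a b : Alg p q ν n} (h : ∀ i, a * he p q i = b * he p q i) : a = b := by
  rw [← mul_one a, ← mul_one b, ← sum_he, Finset.mul_sum, Finset.mul_sum]
  exact Finset.sum_congr rfl fun i _ => h i

theorem hT_mul_he (o : Option (Fin n)) (i : Seqs ν (n + 1)) :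
    hT p q ν n o * he p q i = he p q (act o i) * hT p q ν n o := by
  cases o with
  | none =>
    rw [hT, he, he, ← map_mul, ← map_mul]
    exact toAlg_eq (Rel.pi_e i)
  | some r =>
    rw [hT, he, he, ← map_mul, ← map_mul]
    exact toAlg_eq (Rel.s_e r i)

theorem hx_mul_he (l) (i : Seqs ν (n + 1)) : hx p q l * he p q i = he p q i * hx p q l := by
  rw [hx, he, ← map_mul, ← map_mul]
  exact toAlg_eq (Rel.x_e l i)

theorem hx_mul_hx (l l') : hx p q l * hx p q l' = hx (ν := ν) (n := n) p q l' * hx p q l := by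
  rw [hx, hx, ← map_mul, ← map_mul]
  exact toAlg_eq (Rel.x_x l l')

theorem pi_mul_hx_zero :
    hT p q ν n none * hx p q 0 = -hx p q 0 * hT p q ν n none := by
  rw [hT, hx, ← map_mul, toAlg_eq Rel.pi_x_zero, map_mul, map_neg]

theorem pi_mul_hx {l : Fin (n + 1)} (h : l ≠ 0) :
    hT p q ν n none * hx p q l = hx p q l * hT p q ν n none := by
  rw [hT, hx, ← map_mul, toAlg_eq (Rel.pi_x l h), map_mul]

theorem pi_mul_σ {r : Fin n} (h : (r : ℕ) ≠ 0) :
    hT p q ν n none * hT p q ν n (some r) = hT p q ν n (some r) * hT p q ν n none := by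
  rw [hT, hT, ← map_mul, toAlg_eq (Rel.pi_s r h), map_mul]

theorem σ_mul_σ {r t : Fin n} (h : (r : ℕ) ≠ t + 1) (h' : (t : ℕ) ≠ r + 1) :
    hT p q ν n (some r) * hT p q ν n (some t) = hT p q ν n (some t) * hT p q ν n (some r) := by
  rw [hT, hT, ← map_mul, toAlg_eq (Rel.s_s r t h h'), map_mul]

variable {c : ℕ → kˣ} {s : ℕ}

namespace IsChain

variable (hc : IsChain p q ν n c s)
include hc

theorem adj (i : Seqs ν (n + 1)) (r : Fin n) : i.1 r.castSucc ≠ i.1 r.succ := fun h =>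
  (Fin.castSucc_lt_succ (i := r)).ne (i.val_injective hc.le_one h)

theorem adj_inv (i : Seqs ν (n + 1)) (r : Fin n) : i.1 r.succ ≠ (i.1 r.castSucc)⁻¹ :=
  i.val_ne_inv hc.le_one _ _

/-- Adjacent entries differ, so the correction term is absent at every idempotent. The two braid
relations below hold without corrections for similar reasons. -/
theorem σ_mul_hx (r : Fin n) (l : Fin (n + 1)) : hT p q ν n (some r) * hx p q l
    = hx p q (Equiv.swap r.castSucc r.succ l) * hT p q ν n (some r) := by
  refine eq_of_mul_he fun i => ?_
  have h := toAlg_eq (Rel.s_x_else (p := p) (q := q) r l i fun h => hc.adj i r h.1)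
  rw [map_mul, map_sub, map_mul, map_mul, map_zero, sub_mul, sub_eq_zero] at h
  exact h

theorem σ_braid {r t : Fin n} (ht : (t : ℕ) = r + 1) :
    hT p q ν n (some t) * hT p q ν n (some r) * hT p q ν n (some t)
      = hT p q ν n (some r) * hT p q ν n (some t) * hT p q ν n (some r) := by
  refine eq_of_mul_he fun i => ?_
  have h := toAlg_eq (Rel.braid_none (p := p) (q := q) r t ht i (Or.inl fun h => by
    have := congrArg Fin.val (i.val_injective hc.le_one h)
    simp at this
    omega))
  rw [map_mul, map_sub, map_zero, sub_mul, sub_eq_zero] at h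
  simpa only [map_mul, hT, he] using h

theorem pi_σ_braid {r : Fin n} (hr : (r : ℕ) = 0) :
    hT p q ν n (some r) * hT p q ν n none * hT p q ν n (some r) * hT p q ν n none
      = hT p q ν n none * hT p q ν n (some r) * hT p q ν n none * hT p q ν n (some r) := by
  refine eq_of_mul_he fun i => ?_
  have h := toAlg_eq (Rel.s_pi_none (p := p) (q := q) r hr i
    (Or.inl fun h => i.val_ne_inv hc.le_one _ _ h.symm))
  rw [map_sub, map_zero, sub_eq_zero] at h
  simpa only [map_mul, pow_two, mul_assoc, hT, he] using h

omit hc in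
variable (p q ν n) in
/-- The central element that corresponds to `y_j`. -/
def _root_.VV.central (d : kˣ) : Alg p q ν n :=
  ∑ i, ∑ l, pair (i.1 l) d • (hx p q l * he p q i)

omit hc in
theorem _root_.VV.central_mul_he (d : kˣ) (i : Seqs ν (n + 1)) :
    central p q ν n d * he p q i = ∑ l, pair (i.1 l) d • (hx p q l * he p q i) := by
  rw [central, Finset.sum_mul, Finset.sum_eq_single i]
  · simp only [Finset.sum_mul, smul_mul_assoc, mul_assoc, he_mul_self]
  · intro j _ hj
    simp only [Finset.sum_mul, smul_mul_assoc, mul_assoc, he_mul_ne hj, mul_zero, smul_zero,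
      Finset.sum_const_zero]
  · simp

/-- At `e(i)` the element is `± x_l`, where `l` is the place of `d` or `d⁻¹` in `i`, if there is
one. A `σ_r` moves this place and `x_l` alike; `π` changes the sign of `x_0` and also that of the
pairing at the first place. -/
theorem central_commute (d : kˣ) (a : Alg p q ν n) : Commute (central p q ν n d) a := by
  have hmem := eq_top_of_generators (Subalgebra.centralizer k {central p q ν n d}) ?_ ?_ ?_ a
  · exact Subalgebra.mem_centralizer_iff k |>.1 hmem _ rfl
  · intro l
    rw [Subalgebra.mem_centralizer_iff]
    rintro _ rfl
    refine eq_of_mul_he fun i => ?_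
    rw [mul_assoc, hx_mul_he, ← mul_assoc, central_mul_he, mul_assoc, central_mul_he,
      Finset.sum_mul, Finset.mul_sum]
    refine Finset.sum_congr rfl fun l' _ => ?_
    rw [smul_mul_assoc, mul_smul_comm, mul_assoc, ← hx_mul_he, ← mul_assoc, ← mul_assoc, hx_mul_hx]
  · intro i
    rw [Subalgebra.mem_centralizer_iff]
    rintro _ rfl
    rw [central_mul_he, central, Finset.mul_sum, Finset.sum_eq_single i]
    · rw [Finset.mul_sum]
      refine Finset.sum_congr rfl fun l _ => ?_
      rw [mul_smul_comm, ← mul_assoc, ← hx_mul_he, mul_assoc, he_mul_self]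
    · intro j _ hj
      rw [Finset.mul_sum]
      refine Finset.sum_eq_zero fun l _ => ?_
      rw [mul_smul_comm, ← mul_assoc, ← hx_mul_he, mul_assoc, he_mul_ne hj.symm, mul_zero,
        smul_zero]
    · simp
  · intro o
    rw [Subalgebra.mem_centralizer_iff]
    rintro _ rfl
    refine eq_of_mul_he fun i => ?_
    rw [mul_assoc, hT_mul_he, ← mul_assoc, central_mul_he, mul_assoc, central_mul_he,
      Finset.sum_mul, Finset.mul_sum]
    simp only [smul_mul_assoc, mul_smul_comm]
    have key : ∀ l, hx p q l * he p q (act o i) * hT p q ν n o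
        = hx p q l * hT p q ν n o * he p q i :=
      fun l => by rw [mul_assoc, ← hT_mul_he, mul_assoc]
    simp only [key]
    cases o with
    | none =>
      refine Finset.sum_congr rfl fun l _ => ?_
      change pair (i.flip.1 l) d • _ = _
      by_cases hl : l = 0
      · rw [hl, Seqs.flip_val_zero, pair_inv_left, ← mul_assoc, pi_mul_hx_zero, neg_mul, neg_mul,
          smul_neg, neg_smul]
      · rw [Seqs.flip_val_of_ne _ hl, ← mul_assoc, pi_mul_hx hl]
    | some r =>
      -- The exchange of `x_l` with the `x` of the other place is absorbed by reindexing the sum.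
      rw [← Equiv.sum_comp (Equiv.swap r.castSucc r.succ)]
      refine Finset.sum_congr rfl fun l _ => ?_
      change pair ((i.swap r).1 _) d • _ = _
      rw [Seqs.swap_val, Equiv.swap_apply_self, ← mul_assoc, hc.σ_mul_hx]

/-- The homomorphism from the polynomial ring to the center. -/
def toCenter : Poly k n →ₐ[k] Alg p q ν n :=
  (Subalgebra.center k (Alg p q ν n)).val.comp
    (MvPolynomial.aeval fun o : Option (Fin n) =>
      (⟨o.elim (central p q ν n (c s)) fun j =>
        central p q ν n (c (j + 1)) - central p q ν n (c j), by
        cases o with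
        | none =>
          exact Subalgebra.mem_center_iff.2 fun a => (hc.central_commute _ a).symm.eq
        | some j =>
          exact Subalgebra.mem_center_iff.2 fun a =>
            ((hc.central_commute _ a).sub_left (hc.central_commute _ a)).symm.eq⟩ :
        Subalgebra.center k (Alg p q ν n)))

theorem toCenter_X (o : Option (Fin n)) : hc.toCenter (MvPolynomial.X o)
    = o.elim (central p q ν n (c s)) fun j =>
        central p q ν n (c (j + 1)) - central p q ν n (c j) := by
  rw [toCenter, AlgHom.comp_apply, MvPolynomial.aeval_X]
  rfl

theorem toCenter_commute (P : Poly k n) (a : Alg p q ν n) : hc.toCenter P * a = a * hc.toCenter P :=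
  (Subalgebra.mem_center_iff.1 (Subtype.prop (MvPolynomial.aeval _ P)) a).symm

theorem toCenter_partialSum {j : ℕ} (hj : j ≤ n) : hc.toCenter (partialSum j)
    = central p q ν n (c j) - central p q ν n (c 0) := by
  induction j with
  | zero => rw [partialSum, Finset.sum_range_zero, map_zero, sub_self]
  | succ j ih =>
    rw [partialSum, Finset.sum_range_succ, ← partialSum, map_add, ih (by omega),
      dif_pos (by omega : j < n), toCenter_X]
    simp only [Option.elim]
    abel

theorem toCenter_y {j : ℕ} (hj : j ≤ n) : hc.toCenter (y s j) = central p q ν n (c j) := by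
  rw [y, map_sub, map_add, hc.toCenter_partialSum hj, hc.toCenter_partialSum hc.s_le, toCenter_X]
  simp only [Option.elim]
  abel

theorem central_val_mul_he (i : Seqs ν (n + 1)) (l : Fin (n + 1)) :
    central p q ν n (i.1 l) * he p q i = hx p q l * he p q i := by
  rw [central_mul_he, Finset.sum_eq_single l]
  · rw [pair_self (i.val_ne_inv hc.le_one l l), one_smul]
  · intro t _ ht
    rw [pair_of_ne (fun h => ht (i.val_injective hc.le_one h)) (i.val_ne_inv hc.le_one _ _),
      zero_smul]
  · simp

omit hc in
theorem _root_.VV.central_inv (d : kˣ) : central p q ν n d⁻¹ = -central p q ν n d := by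
  simp only [central, pair_inv_right, neg_smul, Finset.sum_neg_distrib]

/-- The entry `i_l` and its inverse occur at no other place, so at `e(i)` the central element of
`i_l` reduces to `x_l`; and `i_l` is some `c_j` or its inverse. -/
theorem hx_mul_he_eq (l : Fin (n + 1)) (i : Seqs ν (n + 1)) :
    hx p q l * he p q i = hc.toCenter (yhat n c s (i.1 l)) * he p q i := by
  obtain ⟨j, hj, h | h⟩ := (hc.mem _).1 (i.mem_support l)
  · rw [← hc.central_val_mul_he, h, hc.yhat_c hj, hc.toCenter_y hj]
  · rw [← hc.central_val_mul_he, h, yhat_inv, hc.yhat_c hj, map_neg, hc.toCenter_y hj, central_inv]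

/-- The relations express these squares by the `x_l`, which act centrally on each idempotent. -/
theorem exists_hT_mul_hT_mul_he (o : Option (Fin n)) (i : Seqs ν (n + 1)) :
    ∃ P, hT p q ν n o * hT p q ν n o * he p q i = hc.toCenter P * he p q i := by
  cases o with
  | none =>
    have h2 := hc.hx_mul_he_eq 0 i
    by_cases h : i.1 0 = q
    · have := toAlg_eq (Rel.pi_sq_q (p := p) i h)
      rw [pow_two, map_mul, map_mul, map_mul] at this
      exact ⟨_, this.trans h2⟩
    by_cases h' : i.1 0 = q⁻¹
    · have := toAlg_eq (Rel.pi_sq_q_inv (p := p) i h')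
      rw [pow_two, map_mul, map_mul, map_mul, map_neg, neg_mul] at this
      exact ⟨_, this.trans ((congrArg Neg.neg h2).trans (by rw [← neg_mul, ← map_neg]))⟩
    · have := toAlg_eq (Rel.pi_sq_ne (p := p) i h h')
      rw [pow_two, map_mul, map_mul] at this
      exact ⟨1, this.trans (by rw [map_one, one_mul]; rfl)⟩
  | some r =>
    have h2 := hc.hx_mul_he_eq r.castSucc i
    have h3 := hc.hx_mul_he_eq r.succ i
    by_cases h : Arr p (i.1 r.succ) (i.1 r.castSucc)
    · have := toAlg_eq (Rel.s_sq_left (p := p) (q := q) r i ⟨h, hc.arr_irrefl _ _ h⟩)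
      rw [pow_two, map_mul, map_mul, map_mul, map_sub, sub_mul] at this
      exact ⟨_, this.trans ((congrArg₂ (· - ·) h3 h2).trans (by rw [← sub_mul, ← map_sub]))⟩
    by_cases h' : Arr p (i.1 r.castSucc) (i.1 r.succ)
    · have := toAlg_eq (Rel.s_sq_right (p := p) (q := q) r i ⟨h', hc.arr_irrefl _ _ h'⟩)
      rw [pow_two, map_mul, map_mul, map_mul, map_sub, sub_mul] at this
      exact ⟨_, this.trans ((congrArg₂ (· - ·) h2 h3).trans (by rw [← sub_mul, ← map_sub]))⟩
    · have := toAlg_eq (Rel.s_sq_none (p := p) (q := q) r i (hc.adj i r) ⟨h', h⟩)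
      rw [pow_two, map_mul, map_mul] at this
      exact ⟨1, this.trans (by rw [map_one, one_mul]; rfl)⟩

end IsChain

end VV

namespace VV

open scoped Classical

variable {k : Type u} [Field k] {p q : kˣ} {ν : kˣ →₀ ℕ} {n : ℕ}

/-! ### Signed positions and descents -/

/-- The signed position of `u` in the sequence `i`. -/
def position (i : Seqs ν (n + 1)) (u : kˣ) : ℤ := ∑ r : Fin (n + 1), ((r : ℤ) + 1) * pair (i.1 r) u

theorem position_inv (i : Seqs ν (n + 1)) (u : kˣ) : position i u⁻¹ = -position i u := by
  simp only [position, pair_inv_right, mul_neg, Finset.sum_neg_distrib]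

theorem position_val (h1 : ∀ u, ν u ≤ 1) (i : Seqs ν (n + 1)) (r : Fin (n + 1)) :
    position i (i.1 r) = r + 1 := by
  rw [position, Finset.sum_eq_single r]
  · rw [pair_self (i.val_ne_inv h1 r r), mul_one]
  · intro t _ ht
    rw [pair_of_ne (fun h => ht (i.val_injective h1 h)) (i.val_ne_inv h1 _ _), mul_zero]
  · simp

theorem exists_position (h1 : ∀ u, ν u ≤ 1) (i : Seqs ν (n + 1)) {u : kˣ} (hu : u ∈ ν.support) :
    ∃ r : Fin (n + 1), (u = i.1 r ∧ position i u = r + 1) ∨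
      (u = (i.1 r)⁻¹ ∧ position i u = -(r + 1)) := by
  obtain ⟨r, rfl | rfl⟩ := i.exists_of_mem hu
  · exact ⟨r, Or.inl ⟨rfl, position_val h1 i r⟩⟩
  · exact ⟨r, Or.inr ⟨rfl, by rw [position_inv, position_val h1 i r]⟩⟩

theorem position_injOn (h1 : ∀ u, ν u ≤ 1) (i : Seqs ν (n + 1)) {u v : kˣ} (hu : u ∈ ν.support)
    (hv : v ∈ ν.support) (h : position i u = position i v) : u = v := by
  obtain ⟨r, ⟨hu, hr⟩ | ⟨hu, hr⟩⟩ := exists_position h1 i hu <;>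
    obtain ⟨t, ⟨hv, ht⟩ | ⟨hv, ht⟩⟩ := exists_position h1 i hv
  · rw [hu, hv, show r = t from Fin.ext (by omega)]
  · omega
  · omega
  · rw [hu, hv, show r = t from Fin.ext (by omega)]

theorem position_ne_zero (h1 : ∀ u, ν u ≤ 1) (i : Seqs ν (n + 1)) {u : kˣ} (hu : u ∈ ν.support) :
    position i u ≠ 0 := by
  obtain ⟨r, ⟨hu, hr⟩ | ⟨hu, hr⟩⟩ := exists_position h1 i hu <;> omega

/-- The simple reflections that bring the sequence `j` closer to `i`. -/
def Desc (i : Seqs ν (n + 1)) : Option (Fin n) → Seqs ν (n + 1) → Prop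
  | none, j => position i (j.1 0) < 0
  | some r, j => position i (j.1 r.succ) < position i (j.1 r.castSucc)

/-- A function that measures how far `j` is from `i`. -/
def dist (i j : Seqs ν (n + 1)) : ℤ := -∑ r : Fin (n + 1), ((r : ℤ) + 1) * position i (j.1 r)

/-- This is the rearrangement inequality: a descent puts two entries in the right order, or makes
the position of the first entry positive, and so increases the sum in `dist`. -/
theorem dist_act_lt {i j : Seqs ν (n + 1)} {o : Option (Fin n)} (h : Desc i o j) :
    dist i (act o j) < dist i j := by
  rw [dist, dist, neg_lt_neg_iff, ← sub_pos, ← Finset.sum_sub_distrib]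
  cases o with
  | none =>
    change _ < ∑ r, (_ * position i (j.flip.1 r) - _)
    change position i (j.1 0) < 0 at h
    rw [Fin.sum_univ_succ, Finset.sum_eq_zero, Seqs.flip_val_zero, position_inv]
    · simp only [Fin.val_zero, Nat.cast_zero]
      omega
    · intro r _
      rw [Seqs.flip_val_of_ne _ (Fin.succ_ne_zero r), sub_self]
  | some r =>
    change _ < ∑ l, (_ * position i ((j.swap r).1 l) - _)
    change position i (j.1 r.succ) < position i (j.1 r.castSucc) at h
    rw [Fintype.sum_eq_add r.castSucc r.succ Fin.castSucc_lt_succ.ne, Seqs.swap_val_castSucc,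
      Seqs.swap_val_succ]
    · simp only [Fin.val_castSucc, Fin.val_succ]
      push_cast
      nlinarith
    · rintro l ⟨h1, h2⟩
      rw [Seqs.swap_val_of_ne _ h1 h2, sub_self]

theorem dist_flip_lt {i j : Seqs ν (n + 1)} (h : Desc i none j) : dist i j.flip < dist i j := by
  have h' := dist_act_lt h
  rwa [act] at h'

theorem dist_swap_lt {i j : Seqs ν (n + 1)} {r : Fin n} (h : Desc i (some r) j) :
    dist i (j.swap r) < dist i j := by
  have h' := dist_act_lt h
  rwa [act] at h'

theorem dist_wf (i : Seqs ν (n + 1)) : WellFounded fun j' j => dist i j' < dist i j := by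
  have : IsTrans (Seqs ν (n + 1)) fun j' j => dist i j' < dist i j := ⟨fun _ _ _ => lt_trans⟩
  have : Std.Irrefl fun j' j : Seqs ν (n + 1) => dist i j' < dist i j := ⟨fun _ => lt_irrefl _⟩
  exact Finite.wellFounded_of_trans_of_irrefl _

/-- Without descents the positions in `i` of the entries of `j` are positive and strictly
increasing. They are at most `n + 1`, so they must be `1, …, n + 1`. -/
theorem eq_of_no_desc (h1 : ∀ u, ν u ≤ 1) {i j : Seqs ν (n + 1)} (h : ∀ o, ¬ Desc i o j) :
    j = i := by
  have hpos : ∀ r : Fin (n + 1), (r : ℤ) + 1 ≤ position i (j.1 r) := by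
    intro r
    induction r using Fin.induction with
    | zero =>
      have h2 : ¬ position i (j.1 0) < 0 := h none
      have := position_ne_zero h1 i (j.mem_support 0)
      simp only [Fin.val_zero, Nat.cast_zero]
      omega
    | succ r ih =>
      have h2 : ¬ position i (j.1 r.succ) < position i (j.1 r.castSucc) := h (some r)
      have h3 : position i (j.1 r.succ) ≠ position i (j.1 r.castSucc) := fun h =>
        Fin.castSucc_lt_succ.ne' (j.val_injective h1
          (position_injOn h1 i (j.mem_support _) (j.mem_support _) h))
      simp only [Fin.val_castSucc, Fin.val_succ] at ih ⊢
      push_cast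
      omega
  have hle : ∀ r : Fin (n + 1), position i (j.1 r) ≤ (r : ℤ) + 1 := by
    intro r
    induction r using Fin.reverseInduction with
    | last =>
      obtain ⟨t, ⟨_, ht⟩ | ⟨_, ht⟩⟩ := exists_position h1 i (j.mem_support (Fin.last n)) <;>
        have := t.is_le <;> simp only [Fin.val_last] <;> omega
    | cast r ih =>
      have h2 : ¬ position i (j.1 r.succ) < position i (j.1 r.castSucc) := h (some r)
      have h3 : position i (j.1 r.succ) ≠ position i (j.1 r.castSucc) := fun h =>
        Fin.castSucc_lt_succ.ne' (j.val_injective h1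
          (position_injOn h1 i (j.mem_support _) (j.mem_support _) h))
      simp only [Fin.val_castSucc, Fin.val_succ] at ih ⊢
      push_cast at ih
      omega
  refine Subtype.ext (funext fun r => position_injOn h1 i (j.mem_support _) (i.mem_support _) ?_)
  rw [position_val h1]
  exact le_antisymm (hle r) (hpos r)

theorem not_desc_self (h1 : ∀ u, ν u ≤ 1) (i : Seqs ν (n + 1)) (o : Option (Fin n)) :
    ¬ Desc i o i := by
  cases o with
  | none =>
    change ¬ position i (i.1 0) < 0
    rw [position_val h1]
    omega
  | some r =>
    change ¬ position i (i.1 r.succ) < position i (i.1 r.castSucc)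
    rw [position_val h1, position_val h1]
    simp

theorem desc_act (h1 : ∀ u, ν u ≤ 1) {i j : Seqs ν (n + 1)} {o : Option (Fin n)}
    (h : ¬ Desc i o j) :
    Desc i o (act o j) := by
  cases o with
  | none =>
    change position i (j.flip.1 0) < 0
    change ¬ position i (j.1 0) < 0 at h
    have := position_ne_zero h1 i (j.mem_support 0)
    rw [Seqs.flip_val_zero, position_inv]
    omega
  | some r =>
    change position i ((j.swap r).1 r.succ) < position i ((j.swap r).1 r.castSucc)
    change ¬ position i (j.1 r.succ) < position i (j.1 r.castSucc) at h
    have h3 : position i (j.1 r.succ) ≠ position i (j.1 r.castSucc) := fun h =>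
      Fin.castSucc_lt_succ.ne' (j.val_injective h1
        (position_injOn h1 i (j.mem_support _) (j.mem_support _) h))
    rw [Seqs.swap_val_succ, Seqs.swap_val_castSucc]
    omega

/-! ### The basis elements -/

variable (p q) in
/-- A product of generators along a shortest way from `i` to `j`. -/
def tau (i : Seqs ν (n + 1)) : Seqs ν (n + 1) → Alg p q ν n :=
  (dist_wf i).fix fun j rec =>
    if h : ∃ o, Desc i o j then hT p q ν n h.choose * rec (act h.choose j)
      (dist_act_lt h.choose_spec)
    else he p q i

theorem tau_eq (i j : Seqs ν (n + 1)) : tau p q i j =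
    if h : ∃ o, Desc i o j then hT p q ν n h.choose * tau p q i (act h.choose j) else he p q i :=
  (dist_wf i).fix_eq _ _

variable {c : ℕ → kˣ} {s : ℕ}

namespace IsChain

variable (hc : IsChain p q ν n c s)
include hc

theorem tau_self (i : Seqs ν (n + 1)) : tau p q i i = he p q i := by
  rw [tau_eq, dif_neg]
  rintro ⟨o, h⟩
  exact not_desc_self hc.le_one i o h

/-- Both `π` and `σ_r` can be continued by three more descents to the same sequence. The induction
hypothesis unfolds both products along these ways, and the braid relation of length four compares
them. -/
theorem tau_flip_swap {i j : Seqs ν (n + 1)}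
    (ih : ∀ j', dist i j' < dist i j → ∀ o, Desc i o j' →
      tau p q i j' = hT p q ν n o * tau p q i (act o j'))
    {r : Fin n} (hr : (r : ℕ) = 0) (h1 : Desc i none j) (h2 : Desc i (some r) j) :
    hT p q ν n none * tau p q i j.flip = hT p q ν n (some r) * tau p q i (j.swap r) := by
  have ihp : ∀ j', dist i j' < dist i j → Desc i none j' →
      tau p q i j' = hT p q ν n none * tau p q i j'.flip := fun j' h h' => ih j' h none h'
  have ihs : ∀ j' r, dist i j' < dist i j → Desc i (some r) j' →
      tau p q i j' = hT p q ν n (some r) * tau p q i (j'.swap r) := fun j' r h h' =>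
        ih j' h (some r) h'
  have h1' : position i (j.1 0) < 0 := h1
  have h2' : position i (j.1 r.succ) < position i (j.1 r.castSucc) := h2
  have h0 := Seqs.castSucc_eq_zero hr
  have e1 : ∀ j : Seqs ν (n + 1), (j.swap r).1 0 = j.1 r.succ := fun j => by
    rw [← h0, Seqs.swap_val_castSucc]
  have e2 : ∀ j : Seqs ν (n + 1), (j.swap r).1 r.succ = j.1 0 := fun j => by
    rw [← h0, Seqs.swap_val_succ]
  have e3 : ∀ j : Seqs ν (n + 1), j.flip.1 r.succ = j.1 r.succ := fun j =>
    Seqs.flip_val_of_ne _ (Fin.succ_ne_zero r)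
  rw [h0] at h2'
  have dσ : ∀ j' : Seqs ν (n + 1), position i (j'.1 r.succ) < position i (j'.1 0) →
      Desc i (some r) j' := fun j' h => by rw [← h0] at h; exact h
  -- The `a`'s are the descents on the way that begins with `π`, the `b`'s those on the way that
  -- begins with `σ_r`.
  have a1 : Desc i (some r) j.flip := dσ _ (by
    rw [e3, Seqs.flip_val_zero, position_inv]; omega)
  have a2 : Desc i none (j.flip.swap r) := by
    change position i _ < 0
    rw [e1, e3]; omega
  have a3 : Desc i (some r) (j.flip.swap r).flip := dσ _ (by
    rw [e3, e2, Seqs.flip_val_zero, Seqs.flip_val_zero, e1, e3, position_inv, position_inv]; omega)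
  have b1 : Desc i none (j.swap r) := by
    change position i _ < 0
    rw [e1]; omega
  have b2 : Desc i (some r) (j.swap r).flip := dσ _ (by
    rw [e3, e2, Seqs.flip_val_zero, e1, position_inv]; omega)
  have b3 : Desc i none ((j.swap r).flip.swap r) := by
    change position i _ < 0
    rw [e1, e3, e2]; omega
  have lt1 : dist i j.flip < dist i j := dist_flip_lt h1
  have lt2 : dist i (j.flip.swap r) < dist i j := (dist_swap_lt a1).trans lt1
  have lt3 : dist i (j.flip.swap r).flip < dist i j := (dist_flip_lt a2).trans lt2
  have lt1' : dist i (j.swap r) < dist i j := dist_swap_lt h2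
  have lt2' : dist i (j.swap r).flip < dist i j := (dist_flip_lt b1).trans lt1'
  have lt3' : dist i ((j.swap r).flip.swap r) < dist i j := (dist_swap_lt b2).trans lt2'
  rw [ihs _ _ lt1 a1, ihp _ lt1' b1, ihp _ lt2 a2, ihs _ _ lt2' b2, ihs _ _ lt3 a3, ihp _ lt3' b3,
    Seqs.flip_swap_braid hr]
  simp only [← mul_assoc]
  rw [hc.pi_σ_braid hr]

/-- The same argument for two adjacent transpositions, with the braid relation of length three. -/
theorem tau_swap_swap {i j : Seqs ν (n + 1)}
    (ih : ∀ j', dist i j' < dist i j → ∀ o, Desc i o j' →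
      tau p q i j' = hT p q ν n o * tau p q i (act o j'))
    {r t : Fin n} (hrt' : (t : ℕ) = r + 1) (hr : Desc i (some r) j) (ht : Desc i (some t) j) :
    hT p q ν n (some r) * tau p q i (j.swap r) = hT p q ν n (some t) * tau p q i (j.swap t) := by
  have ihs : ∀ j' r, dist i j' < dist i j → Desc i (some r) j' →
      tau p q i j' = hT p q ν n (some r) * tau p q i (j'.swap r) := fun j' r h h' =>
        ih j' h (some r) h'
  have hr' : position i (j.1 r.succ) < position i (j.1 r.castSucc) := hr
  have ht' : position i (j.1 t.succ) < position i (j.1 t.castSucc) := ht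
  have h1 : r.succ = t.castSucc := Seqs.succ_eq_castSucc hrt'
  have h2 : r.castSucc ≠ t.castSucc := by rw [← h1]; exact Fin.castSucc_lt_succ.ne
  have h3 : r.castSucc ≠ t.succ := fun h => by
    have := congrArg Fin.val h
    simp at this
    omega
  have h4 : t.succ ≠ t.castSucc := Fin.castSucc_lt_succ.ne'
  have e1 : ∀ j : Seqs ν (n + 1), (j.swap t).1 r.castSucc = j.1 r.castSucc := fun j =>
    Seqs.swap_val_of_ne _ h2 h3
  have e2 : ∀ j : Seqs ν (n + 1), (j.swap r).1 t.succ = j.1 t.succ := fun j =>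
    Seqs.swap_val_of_ne _ h3.symm (h1 ▸ h4)
  have e3 : ∀ j : Seqs ν (n + 1), (j.swap r).1 t.castSucc = j.1 r.castSucc := fun j => by
    rw [← h1, Seqs.swap_val_succ]
  have e4 : ∀ j : Seqs ν (n + 1), (j.swap r).1 r.castSucc = j.1 t.castSucc := fun j => by
    rw [← h1, Seqs.swap_val_castSucc]
  rw [h1] at hr'
  have dσ : ∀ j' : Seqs ν (n + 1), position i (j'.1 t.castSucc) < position i (j'.1 r.castSucc) →
      Desc i (some r) j' := fun j' h => by rw [← h1] at h; exact h
  have a1 : Desc i (some t) (j.swap r) := by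
    change position i _ < position i _
    rw [e2, e3]; omega
  have a2 : Desc i (some r) ((j.swap r).swap t) := dσ _ (by
    rw [Seqs.swap_val_castSucc, e2, e1, e4]; omega)
  have b1 : Desc i (some r) (j.swap t) := dσ _ (by
    rw [Seqs.swap_val_castSucc, e1]; omega)
  have b2 : Desc i (some t) ((j.swap t).swap r) := by
    change position i _ < position i _
    rw [e2, e3, e1, Seqs.swap_val_succ]; omega
  have lt1 : dist i (j.swap r) < dist i j := dist_swap_lt hr
  have lt2 : dist i ((j.swap r).swap t) < dist i j := (dist_swap_lt a1).trans lt1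
  have lt1' : dist i (j.swap t) < dist i j := dist_swap_lt ht
  have lt2' : dist i ((j.swap t).swap r) < dist i j := (dist_swap_lt b1).trans lt1'
  rw [ihs _ _ lt1 a1, ihs _ _ lt1' b1, ihs _ _ lt2 a2, ihs _ _ lt2' b2, Seqs.swap_braid hrt']
  simp only [← mul_assoc]
  rw [hc.σ_braid hrt']

/-- Two descents `o` and `o'` of `j` give the same product if this is known for all sequences that
are closer to `i`. -/
theorem tau_rank_two {i j : Seqs ν (n + 1)}
    (ih : ∀ j', dist i j' < dist i j → ∀ o, Desc i o j' →
      tau p q i j' = hT p q ν n o * tau p q i (act o j'))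
    (o o' : Option (Fin n)) (ho : Desc i o j) (ho' : Desc i o' j) :
    hT p q ν n o * tau p q i (act o j) = hT p q ν n o' * tau p q i (act o' j) := by
  have hcomm : ∀ o o' : Option (Fin n), hT p q ν n o * hT p q ν n o'
      = hT p q ν n o' * hT p q ν n o →
      act o' (act o j) = act o (act o' j) → Desc i o j → Desc i o' j → Desc i o' (act o j) →
      Desc i o (act o' j) →
      hT p q ν n o * tau p q i (act o j) = hT p q ν n o' * tau p q i (act o' j) := by
    intro o o' h1 h2 h3 h4 h5 h6
    rw [ih _ (dist_act_lt h3) o' h5, ih _ (dist_act_lt h4) o h6, ← mul_assoc, ← mul_assoc, h1, h2]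
  have hpi : ∀ r : Fin n, Desc i none j → Desc i (some r) j →
      hT p q ν n none * tau p q i (act none j)
        = hT p q ν n (some r) * tau p q i (act (some r) j) := by
    intro r h1 h2
    have h1' : position i (j.1 0) < 0 := h1
    have h2' : position i (j.1 r.succ) < position i (j.1 r.castSucc) := h2
    by_cases hr : (r : ℕ) = 0
    · exact hc.tau_flip_swap ih hr h1 h2
    · have h0 : r.castSucc ≠ 0 := fun h => hr (congrArg Fin.val h)
      refine hcomm _ _ (pi_mul_σ hr) (Seqs.flip_swap hr j).symm h1 h2 ?_ ?_
      · change position i (j.flip.1 r.succ) < position i (j.flip.1 r.castSucc)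
        rwa [Seqs.flip_val_of_ne _ (Fin.succ_ne_zero r), Seqs.flip_val_of_ne _ h0]
      · change position i ((j.swap r).1 0) < 0
        rwa [Seqs.swap_val_of_ne _ h0.symm (Fin.succ_ne_zero r).symm]
  have hσ : ∀ r t : Fin n, r < t → Desc i (some r) j → Desc i (some t) j →
      hT p q ν n (some r) * tau p q i (act (some r) j)
        = hT p q ν n (some t) * tau p q i (act (some t) j) := by
    intro r t hrt hr ht
    have hr' : position i (j.1 r.succ) < position i (j.1 r.castSucc) := hr
    have ht' : position i (j.1 t.succ) < position i (j.1 t.castSucc) := ht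
    by_cases hrt' : (t : ℕ) = r + 1
    · exact hc.tau_swap_swap ih hrt' hr ht
    · have hlt : (r : ℕ) < t := hrt
      refine hcomm _ _ (σ_mul_σ (by omega) hrt')
        (Seqs.swap_comm (r := t) (t := r) hrt' (by omega) j) hr ht ?_ ?_
      · change position i ((j.swap r).1 t.succ) < position i ((j.swap r).1 t.castSucc)
        rwa [Seqs.swap_val_of_ne, Seqs.swap_val_of_ne]
        all_goals simp only [ne_eq, Fin.ext_iff, Fin.val_castSucc, Fin.val_succ]; omega
      · change position i ((j.swap t).1 r.succ) < position i ((j.swap t).1 r.castSucc)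
        rwa [Seqs.swap_val_of_ne, Seqs.swap_val_of_ne]
        all_goals simp only [ne_eq, Fin.ext_iff, Fin.val_castSucc, Fin.val_succ]; omega
  cases o with
  | none =>
    cases o' with
    | none => rfl
    | some r => exact hpi r ho ho'
  | some r =>
    cases o' with
    | none => exact (hpi r ho' ho).symm
    | some t =>
      rcases lt_trichotomy r t with h | h | h
      · exact hσ r t h ho ho'
      · rw [h]
      · exact (hσ t r h ho' ho).symm

/-- By induction on `dist`, the descent chosen in the definition may be replaced by any other one.
This is the independence of the chosen shortest way. -/
theorem tau_of_desc (i j : Seqs ν (n + 1)) : ∀ (o : Option (Fin n)), Desc i o j →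
    tau p q i j = hT p q ν n o * tau p q i (act o j) := by
  induction j using (dist_wf i).induction with
  | _ j ih =>
    intro o ho
    have h : ∃ o, Desc i o j := ⟨o, ho⟩
    rw [tau_eq i j, dif_pos h]
    exact hc.tau_rank_two ih _ _ h.choose_spec ho

theorem hT_mul_tau_of_not_desc {i j : Seqs ν (n + 1)} {o : Option (Fin n)} (h : ¬ Desc i o j) :
    hT p q ν n o * tau p q i j = tau p q i (act o j) := by
  rw [hc.tau_of_desc i (act o j) o (desc_act hc.le_one h), act_act]

theorem he_mul_tau (i j : Seqs ν (n + 1)) : he p q j * tau p q i j = tau p q i j := by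
  induction j using (dist_wf i).induction with
  | _ j ih =>
    by_cases h : ∃ o, Desc i o j
    · obtain ⟨o, ho⟩ := h
      have h2 := ih _ (dist_act_lt ho)
      have h3 := hT_mul_he (p := p) (q := q) o (act o j)
      rw [act_act] at h3
      rw [hc.tau_of_desc i j o ho, ← mul_assoc, ← h3, mul_assoc, h2]
    · rw [eq_of_no_desc hc.le_one (not_exists.1 h), hc.tau_self, he_mul_self]

/-- The combinations of the elements `tau i j` with central coefficients. -/
def combination (i : Seqs ν (n + 1)) : (Seqs ν (n + 1) → Poly k n) →ₗ[k] Alg p q ν n where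
  toFun P := ∑ j, hc.toCenter (P j) * tau p q i j
  map_add' P Q := by simp only [Pi.add_apply, map_add, add_mul, Finset.sum_add_distrib]
  map_smul' r P := by
    simp only [Pi.smul_apply, map_smul, smul_mul_assoc, Finset.smul_sum, RingHom.id_apply]

theorem toCenter_mul_tau_mem (i j : Seqs ν (n + 1)) (P : Poly k n) :
    hc.toCenter P * tau p q i j ∈ LinearMap.range (hc.combination i) := by
  refine ⟨fun l => if l = j then P else 0, ?_⟩
  change ∑ l, hc.toCenter (if l = j then P else 0) * tau p q i l = _
  rw [Finset.sum_eq_single j]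
  · rw [if_pos rfl]
  · intro l _ hl
    rw [if_neg hl, map_zero, zero_mul]
  · simp

/-- Each generator sends `tau i j` to a central multiple of some `tau i j'`. Only the case of a
descent needs thought: there the generator meets its own first factor, and its square is central at
the idempotent. -/
theorem mul_mem_range_combination (i : Seqs ν (n + 1)) (v : Alg p q ν n) :
    ∀ w ∈ LinearMap.range (hc.combination i), v * w ∈ LinearMap.range (hc.combination i) := by
  let U : Subalgebra k (Alg p q ν n) :=
    { carrier := {v | ∀ w ∈ LinearMap.range (hc.combination i),
        v * w ∈ LinearMap.range (hc.combination i)}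
      mul_mem' := fun {a b} ha hb w hw => by
        rw [mul_assoc]
        exact ha _ (hb _ hw)
      add_mem' := fun {a b} ha hb w hw => by
        rw [add_mul]
        exact Submodule.add_mem _ (ha _ hw) (hb _ hw)
      algebraMap_mem' := fun r w hw => by
        rw [← Algebra.smul_def]
        exact Submodule.smul_mem _ _ hw }
  have gen : ∀ v : Alg p q ν n, (∀ j, ∃ Q j', v * tau p q i j = hc.toCenter Q * tau p q i j') →
      v ∈ U := by
    rintro v hv _ ⟨P, rfl⟩
    change v * ∑ j, hc.toCenter (P j) * tau p q i j ∈ _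
    rw [Finset.mul_sum]
    refine Submodule.sum_mem _ fun j _ => ?_
    obtain ⟨Q, j', h⟩ := hv j
    rw [← mul_assoc, ← hc.toCenter_commute, mul_assoc, h, ← mul_assoc, ← map_mul]
    exact hc.toCenter_mul_tau_mem i j' _
  refine eq_top_of_generators U ?_ ?_ ?_ v
  · intro l
    refine gen _ fun j => ⟨yhat n c s (j.1 l), j, ?_⟩
    rw [← hc.he_mul_tau i j, ← mul_assoc, hc.hx_mul_he_eq, mul_assoc]
  · intro l
    refine gen _ fun j => ?_
    by_cases h : l = j
    · exact ⟨1, j, by rw [h, hc.he_mul_tau, map_one, one_mul]⟩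
    · exact ⟨0, j, by rw [← hc.he_mul_tau i j, ← mul_assoc, he_mul_ne h, map_zero, zero_mul,
        zero_mul]⟩
  · intro o
    refine gen _ fun j => ?_
    by_cases h : Desc i o j
    · obtain ⟨P, hP⟩ := hc.exists_hT_mul_hT_mul_he o (act o j)
      refine ⟨P, act o j, ?_⟩
      rw [hc.tau_of_desc i j o h, ← hc.he_mul_tau i (act o j), ← mul_assoc, ← mul_assoc, hP,
        ← mul_assoc]
    · exact ⟨1, act o j, by rw [hc.hT_mul_tau_of_not_desc h, map_one, one_mul]⟩

theorem exists_mul_he_eq (v : Alg p q ν n) (i : Seqs ν (n + 1)) :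
    ∃ P : Seqs ν (n + 1) → Poly k n, v * he p q i = ∑ j, hc.toCenter (P j) * tau p q i j := by
  have h := hc.mul_mem_range_combination i v _ (hc.toCenter_mul_tau_mem i i 1)
  rw [map_one, one_mul, hc.tau_self] at h
  obtain ⟨P, hP⟩ := h
  exact ⟨P, hP.symm⟩

/-- Every element is a combination of the elements `tau i j` with central coefficients. -/
theorem exists_eq_sum (v : Alg p q ν n) : ∃ P : Seqs ν (n + 1) → Seqs ν (n + 1) → Poly k n,
    v = ∑ i, ∑ j, hc.toCenter (P j i) * tau p q i j := by
  choose P hP using hc.exists_mul_he_eq v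
  refine ⟨fun j i => P i j, ?_⟩
  rw [← Finset.sum_congr rfl fun i _ => hP i, ← Finset.mul_sum, sum_he, mul_one]

end IsChain

end VV

namespace VV

open scoped Classical
open TwoCycle

variable {k : Type u} [Field k] {p q : kˣ} {ν : kˣ →₀ ℕ} {n : ℕ} {c : ℕ → kˣ} {s : ℕ}

/-! ### Signs -/

/-- The quantity whose sign tells on which side of a wall the sequence `i` lies. -/
def delta (q : kˣ) (c : ℕ → kˣ) (i : Seqs ν (n + 1)) : Option (Fin n) → ℤ
  | none => position i q
  | some t => position i (c (t + 1)) - position i (c t)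

/-- The side of the walls on which the sequence `i` lies. -/
def side (q : kˣ) (c : ℕ → kˣ) (i : Seqs ν (n + 1)) (o : Option (Fin n)) : TwoCycle :=
  if 0 < delta q c i o then one else two

/-- The exchange of the neighbours `u`, `v` crosses the wall with index `t`. -/
def Link (c : ℕ → kˣ) (t : ℕ) (u v : kˣ) : Prop :=
  u = c t ∧ v = c (t + 1) ∨ u = (c (t + 1))⁻¹ ∧ v = (c t)⁻¹

theorem position_swap (h1 : ∀ u, ν u ≤ 1) (j : Seqs ν (n + 1)) (r : Fin n) (l : Fin (n + 1)) :
    position (j.swap r) (j.1 l)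
      = if (l : ℕ) = r then (r : ℤ) + 2 else if (l : ℕ) = r + 1 then (r : ℤ) + 1 else l + 1 := by
  have h := position_val h1 (j.swap r) (Equiv.swap r.castSucc r.succ l)
  rw [Seqs.swap_val, Equiv.swap_apply_self] at h
  rw [h, Equiv.swap_apply_def]
  simp only [Fin.ext_iff, Fin.val_castSucc, Fin.val_succ]
  split_ifs <;> simp
  ring

theorem position_flip (h1 : ∀ u, ν u ≤ 1) (j : Seqs ν (n + 1)) (l : Fin (n + 1)) :
    position j.flip (j.1 l) = if (l : ℕ) = 0 then -1 else (l : ℤ) + 1 := by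
  have h := position_val h1 j.flip l
  by_cases hl : l = 0
  · subst hl
    rw [Seqs.flip_val_zero, position_inv] at h
    simp only [Fin.val_zero, if_true, Nat.cast_zero] at h ⊢
    omega
  · rw [Seqs.flip_val_of_ne _ hl] at h
    rw [h, if_neg fun h : (l : ℕ) = 0 => hl (Fin.ext h)]

theorem crossing_self {K : Type} [Fintype K] (g : K → TwoCycle) : crossing k g g = 1 :=
  Finset.prod_eq_one fun κ _ => by cases g κ <;> rfl

theorem crossing_ne_zero {K : Type} [Fintype K] (g h : K → TwoCycle) : crossing k g h ≠ 0 := by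
  refine Finset.prod_ne_zero_iff.2 fun κ _ => ?_
  cases g κ <;> cases h κ <;> simp [wt]

theorem crossing_step {K : Type} [Fintype K] {g g' h : K → TwoCycle} {w : MvPolynomial K k} (κ : K)
    (hg : ∀ κ', κ' ≠ κ → g κ' = g' κ') (hw : wt κ (g κ) (h κ) = w * wt κ (g' κ) (h κ)) :
    crossing k g h = w * crossing k g' h := by
  rw [crossing, crossing, ← Finset.mul_prod_erase _ _ (Finset.mem_univ κ),
    ← Finset.mul_prod_erase _ (fun κ => wt κ (g' κ) (h κ)) (Finset.mem_univ κ), hw, mul_assoc]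
  congr 2
  refine Finset.prod_congr rfl fun κ' hκ' => ?_
  rw [hg κ' (Finset.ne_of_mem_erase hκ')]

namespace IsChain

variable (hc : IsChain p q ν n c s)
include hc

theorem c_mem {j : ℕ} (hj : j ≤ n) : c j ∈ ν.support := (hc.mem _).2 ⟨j, hj, Or.inl rfl⟩

/-- A link determines the two orbits `{c_t^{±1}}` and `{c_{t+1}^{±1}}`, hence `t`. -/
theorem link_unique {t t' : Fin n} {u v : kˣ} (h : Link c t u v ∨ Link c t v u)
    (h' : Link c t' u v ∨ Link c t' v u) : t = t' := by
  have ht := t.2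
  have ht' := t'.2
  have key : ∀ a ≤ n, ∀ b ≤ n, ∀ w, (w = c a ∨ w = (c a)⁻¹) → (w = c b ∨ w = (c b)⁻¹) → a = b := by
    rintro a ha b hb w (h1 | h1) (h2 | h2)
    · exact hc.inj a ha b hb (h1.symm.trans h2)
    · exact absurd (h1.symm.trans h2) (hc.ne_inv a ha b hb)
    · exact absurd (h2.symm.trans h1) (hc.ne_inv b hb a ha)
    · exact hc.inj a ha b hb (inv_injective (h1.symm.trans h2))
  have key' : ∀ {t : Fin n} {u v : kˣ}, Link c t u v ∨ Link c t v u →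
      ((u = c t ∨ u = (c t)⁻¹) ∧ (v = c (t + 1) ∨ v = (c (t + 1))⁻¹)) ∨
      ((v = c t ∨ v = (c t)⁻¹) ∧ (u = c (t + 1) ∨ u = (c (t + 1))⁻¹)) := by
    rintro t u v ((⟨h1, h2⟩ | ⟨h1, h2⟩) | (⟨h1, h2⟩ | ⟨h1, h2⟩)) <;> simp [h1, h2]
  refine Fin.ext ?_
  rcases key' h with ⟨h1, h2⟩ | ⟨h1, h2⟩ <;> rcases key' h' with ⟨h3, h4⟩ | ⟨h3, h4⟩
  · exact key _ (by omega) _ (by omega) u h1 h3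
  · have e1 := key _ (by omega) _ (by omega) u h1 h4
    have e2 := key _ (by omega) _ (by omega) v h2 h3
    omega
  · have e1 := key _ (by omega) _ (by omega) u h2 h3
    have e2 := key _ (by omega) _ (by omega) v h1 h4
    omega
  · exact key _ (by omega) _ (by omega) v h1 h3

theorem exists_position_c_c (j : Seqs ν (n + 1)) (t : Fin n) : ∃ l l' : Fin (n + 1), (l : ℕ) ≠ l' ∧
    (c t = j.1 l ∧ position j (c t) = l + 1 ∨ c t = (j.1 l)⁻¹ ∧ position j (c t) = -(l + 1)) ∧
    (c (t + 1) = j.1 l' ∧ position j (c (t + 1)) = l' + 1 ∨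
      c (t + 1) = (j.1 l')⁻¹ ∧ position j (c (t + 1)) = -(l' + 1)) := by
  have ht := t.2
  obtain ⟨l, hl⟩ := exists_position hc.le_one j (hc.c_mem (by omega : (t : ℕ) ≤ n))
  obtain ⟨l', hl'⟩ := exists_position hc.le_one j (hc.c_mem (by omega : (t : ℕ) + 1 ≤ n))
  refine ⟨l, l', ?_, hl, hl'⟩
  intro h
  rw [← Fin.ext h] at hl'
  rcases hl with ⟨h1, _⟩ | ⟨h1, _⟩ <;> rcases hl' with ⟨h2, _⟩ | ⟨h2, _⟩
  · have := hc.inj _ (by omega) _ (by omega) (h1.trans h2.symm)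
    omega
  · exact hc.ne_inv t (by omega) (t + 1) (by omega) (by rw [h1, h2, inv_inv])
  · exact hc.ne_inv t (by omega) (t + 1) (by omega) (by rw [h1, h2])
  · have := hc.inj _ (by omega) _ (by omega) (h1.trans h2.symm)
    omega

/-- Exchanging two adjacent places reverses the comparison of `c_t` and `c_{t+1}` only if they sit
exactly there and with equal signs. It never changes the sign of the position of `q`. -/
theorem side_swap_eq_or (j : Seqs ν (n + 1)) (r : Fin n) (o : Option (Fin n)) :
    side q c (j.swap r) o = side q c j o ∨ ∃ t, o = some t ∧
      (Link c t (j.1 r.castSucc) (j.1 r.succ) ∨ Link c t (j.1 r.succ) (j.1 r.castSucc)) := by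
  unfold Link
  cases o with
  | none =>
    left
    obtain ⟨l, ⟨hl, h⟩ | ⟨hl, h⟩⟩ := exists_position hc.le_one j hc.q_mem
    · have h2 := position_swap hc.le_one j r l
      rw [← hl] at h2
      simp only [side, delta]
      congr 1
      rw [h, h2]
      refine propext ⟨fun _ => by omega, fun _ => ?_⟩
      split_ifs <;> omega
    · have h2 := position_swap hc.le_one j r l
      rw [← inv_inv (j.1 l), ← hl, position_inv, neg_eq_iff_eq_neg] at h2
      simp only [side, delta]
      congr 1
      rw [h, h2]
      refine propext ⟨fun h => ?_, fun _ => by omega⟩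
      split_ifs at h <;> omega
  | some t =>
    have ht := t.2
    obtain ⟨l, l', hne, hl, hl'⟩ := hc.exists_position_c_c j t
    by_cases hll : ((l : ℕ) = r ∧ (l' : ℕ) = r + 1) ∨ ((l : ℕ) = r + 1 ∧ (l' : ℕ) = r)
    · rcases hl with ⟨h1, e1⟩ | ⟨h1, e1⟩ <;> rcases hl' with ⟨h2, e2⟩ | ⟨h2, e2⟩
      · right
        refine ⟨t, rfl, ?_⟩
        rcases hll with ⟨h3, h4⟩ | ⟨h3, h4⟩
        · left; left
          rw [h1, h2]
          exact ⟨congrArg j.1 (Fin.ext h3.symm), congrArg j.1 (Fin.ext h4.symm)⟩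
        · right; left
          rw [h1, h2]
          exact ⟨congrArg j.1 (Fin.ext h3.symm), congrArg j.1 (Fin.ext h4.symm)⟩
      -- With opposite signs the signs alone decide the comparison, and the exchange preserves them.
      · left
        have h5 := position_swap hc.le_one j r l
        have h6 := position_swap hc.le_one j r l'
        rw [← h1] at h5
        rw [← inv_inv (j.1 l'), ← h2, position_inv, neg_eq_iff_eq_neg] at h6
        simp only [side, delta]
        congr 1
        rw [e1, e2, h5, h6]
        apply propext
        split_ifs <;> omega
      · left
        have h5 := position_swap hc.le_one j r l
        have h6 := position_swap hc.le_one j r l'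
        rw [← h2] at h6
        rw [← inv_inv (j.1 l), ← h1, position_inv, neg_eq_iff_eq_neg] at h5
        simp only [side, delta]
        congr 1
        rw [e1, e2, h5, h6]
        apply propext
        split_ifs <;> omega
      · right
        refine ⟨t, rfl, ?_⟩
        rcases hll with ⟨h3, h4⟩ | ⟨h3, h4⟩
        · right; right
          rw [h1, h2, inv_inv, inv_inv]
          exact ⟨congrArg j.1 (Fin.ext h4.symm), congrArg j.1 (Fin.ext h3.symm)⟩
        · left; right
          rw [h1, h2, inv_inv, inv_inv]
          exact ⟨congrArg j.1 (Fin.ext h4.symm), congrArg j.1 (Fin.ext h3.symm)⟩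
    · left
      have h5 := position_swap hc.le_one j r l
      have h6 := position_swap hc.le_one j r l'
      simp only [side, delta]
      congr 1
      apply propext
      rcases hl with ⟨h1, e1⟩ | ⟨h1, e1⟩ <;> rcases hl' with ⟨h2, e2⟩ | ⟨h2, e2⟩
      · rw [← h1] at h5
        rw [← h2] at h6
        rw [e1, e2, h5, h6]
        split_ifs <;> omega
      · rw [← h1] at h5
        rw [← inv_inv (j.1 l'), ← h2, position_inv, neg_eq_iff_eq_neg] at h6
        rw [e1, e2, h5, h6]
        split_ifs <;> omega
      · rw [← h2] at h6
        rw [← inv_inv (j.1 l), ← h1, position_inv, neg_eq_iff_eq_neg] at h5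
        rw [e1, e2, h5, h6]
        split_ifs <;> omega
      · rw [← inv_inv (j.1 l), ← h1, position_inv, neg_eq_iff_eq_neg] at h5
        rw [← inv_inv (j.1 l'), ← h2, position_inv, neg_eq_iff_eq_neg] at h6
        rw [e1, e2, h5, h6]
        split_ifs <;> omega

/-- The first place has the smallest absolute position. If one of the two elements sits there, the
sign of the other one decides the comparison, before and after the inversion. -/
theorem side_flip_some (j : Seqs ν (n + 1)) (t : Fin n) :
    side q c j.flip (some t) = side q c j (some t) := by
  obtain ⟨l, l', hne, hl, hl'⟩ := hc.exists_position_c_c j t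
  have h5 := position_flip hc.le_one j l
  have h6 := position_flip hc.le_one j l'
  simp only [side, delta]
  congr 1
  apply propext
  rcases hl with ⟨h1, e1⟩ | ⟨h1, e1⟩ <;> rcases hl' with ⟨h2, e2⟩ | ⟨h2, e2⟩
  · rw [← h1] at h5
    rw [← h2] at h6
    rw [e1, e2, h5, h6]
    split_ifs <;> omega
  · rw [← h1] at h5
    rw [← inv_inv (j.1 l'), ← h2, position_inv, neg_eq_iff_eq_neg] at h6
    rw [e1, e2, h5, h6]
    split_ifs <;> omega
  · rw [← h2] at h6
    rw [← inv_inv (j.1 l), ← h1, position_inv, neg_eq_iff_eq_neg] at h5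
    rw [e1, e2, h5, h6]
    split_ifs <;> omega
  · rw [← inv_inv (j.1 l), ← h1, position_inv, neg_eq_iff_eq_neg] at h5
    rw [← inv_inv (j.1 l'), ← h2, position_inv, neg_eq_iff_eq_neg] at h6
    rw [e1, e2, h5, h6]
    split_ifs <;> omega

theorem side_flip_none (j : Seqs ν (n + 1)) (h : j.1 0 ≠ q) (h' : (j.1 0)⁻¹ ≠ q) :
    side q c j.flip none = side q c j none := by
  obtain ⟨l, hl⟩ := exists_position hc.le_one j hc.q_mem
  have h5 := position_flip hc.le_one j l
  have hl0 : (l : ℕ) ≠ 0 := by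
    intro h0
    rw [show l = 0 from Fin.ext h0] at hl
    rcases hl with ⟨h1, _⟩ | ⟨h1, _⟩
    · exact h h1.symm
    · exact h' h1.symm
  rw [if_neg hl0] at h5
  simp only [side, delta]
  congr 1
  apply propext
  rcases hl with ⟨h1, e1⟩ | ⟨h1, e1⟩
  · rw [← h1] at h5
    rw [e1, h5]
  · rw [← inv_inv (j.1 l), ← h1, position_inv, neg_eq_iff_eq_neg] at h5
    rw [e1, h5]

/-- Only the wall of `q` matters. If `j` begins with `q⁻¹`, then `i` and `j.flip` are on side `one`
and `j` is on side `two`, which costs the variable. If `j` begins with `q`, then `i` is on side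
`two`, and the factor is `1` on both sides. -/
theorem crossing_flip {i j : Seqs ν (n + 1)} (h : Desc i none j) :
    crossing k (side q c j) (side q c i)
      = omegaZero q n c s (j.flip.1 0) * crossing k (side q c j.flip) (side q c i) := by
  have h' : position i (j.1 0) < 0 := h
  refine crossing_step none ?_ ?_
  · rintro (_ | t) ht
    · exact absurd rfl ht
    · exact (hc.side_flip_some j t).symm
  · rw [Seqs.flip_val_zero, omegaZero]
    have e0 := position_val hc.le_one j 0
    have f0 := position_flip hc.le_one j 0
    simp only [Fin.val_zero, Nat.cast_zero, if_true] at e0 f0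
    split_ifs with hq
    · rw [hq, hc.yhat_q]
      rw [← inv_inv (j.1 0), hq, position_inv] at h' e0 f0
      rw [show side q c j none = two from if_neg (by change ¬ 0 < position j q; omega),
        show side q c j.flip none = one from if_pos (by change 0 < position j.flip q; omega),
        show side q c i none = one from if_pos (by change 0 < position i q; omega)]
      simp [wt]
    · by_cases hq' : j.1 0 = q
      · rw [hq'] at h' e0
        rw [show side q c j none = one from if_pos (by change 0 < position j q; omega),
          show side q c i none = two from if_neg (by change ¬ 0 < position i q; omega)]
        cases side q c j.flip none <;> simp [wt]
      · rw [hc.side_flip_none j hq' hq, one_mul]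

/-- An arrow from the left entry of `j` to the right one means that a wall separates `j`, on side
`two`, from `i` and `j.swap r`, on side `one`. For an arrow in the other direction `i` is on side
`two` and nothing is paid; without an arrow no wall is crossed. -/
theorem crossing_swap {i j : Seqs ν (n + 1)} {r : Fin n} (h : Desc i (some r) j) :
    crossing k (side q c j) (side q c i)
      = omega p n c s ((j.swap r).1 r.castSucc) ((j.swap r).1 r.succ)
        * crossing k (side q c (j.swap r)) (side q c i) := by
  have h' : position i (j.1 r.succ) < position i (j.1 r.castSucc) := h
  have e1 := position_val hc.le_one j r.castSucc
  have e2 := position_val hc.le_one j r.succ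
  have f1 := position_swap hc.le_one j r r.castSucc
  have f2 := position_swap hc.le_one j r r.succ
  simp only [Fin.val_castSucc, Fin.val_succ, if_true, Nat.succ_ne_self, if_false] at e1 e2 f1 f2
  push_cast at e2
  rw [Seqs.swap_val_castSucc, Seqs.swap_val_succ]
  have main : ∀ t : Fin n, Link c t (j.1 r.castSucc) (j.1 r.succ) ∨
      Link c t (j.1 r.succ) (j.1 r.castSucc) →
      ∀ o, o ≠ some t → side q c j o = side q c (j.swap r) o := by
    intro t ht o ho
    obtain h | ⟨t', rfl, h⟩ := hc.side_swap_eq_or j r o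
    · exact h.symm
    · exact absurd (congrArg some (hc.link_unique h ht)) ho
  have hlt : ∀ t : Fin n, Link c t (j.1 r.succ) (j.1 r.castSucc) → ∀ m : Seqs ν (n + 1),
      side q c m (some t) = if position m (j.1 r.succ) < position m (j.1 r.castSucc)
        then one else two := by
    rintro t (⟨h1, h2⟩ | ⟨h1, h2⟩) m <;> rw [h1, h2, side]
    · simp only [delta, sub_pos]
    · simp only [delta, sub_pos, position_inv, neg_lt_neg_iff]
  have hgt : ∀ t : Fin n, Link c t (j.1 r.castSucc) (j.1 r.succ) → ∀ m : Seqs ν (n + 1),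
      side q c m (some t) = if position m (j.1 r.castSucc) < position m (j.1 r.succ)
        then one else two := by
    rintro t (⟨h1, h2⟩ | ⟨h1, h2⟩) m <;> rw [h1, h2, side]
    · simp only [delta, sub_pos]
    · simp only [delta, sub_pos, position_inv, neg_lt_neg_iff]
  by_cases hA : Arr p (j.1 r.castSucc) (j.1 r.succ)
  · obtain ⟨t, ht⟩ : ∃ t : Fin n, Link c t (j.1 r.succ) (j.1 r.castSucc) := by
      obtain ⟨t, htn, ht⟩ :=
        (hc.arr _ (j.mem_support _) _ (j.mem_support _) (hc.adj_inv j r)).1 hA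
      exact ⟨⟨t, htn⟩, ht.imp And.symm And.symm⟩
    have htn := t.2
    have hω : omega p n c s (j.1 r.succ) (j.1 r.castSucc) = MvPolynomial.X (some t) := by
      rw [omega, if_pos hA]
      rcases ht with ⟨h1, h2⟩ | ⟨h1, h2⟩
      · rw [h1, h2, hc.yhat_c (by omega), hc.yhat_c (by omega), y_succ_sub _ htn]
      · rw [h1, h2, yhat_inv, yhat_inv, hc.yhat_c (by omega), hc.yhat_c (by omega), neg_sub_neg,
          y_succ_sub _ htn]
    rw [hω]
    refine crossing_step (some t) (main t (Or.inr ht)) ?_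
    rw [hlt t ht j, hlt t ht i, hlt t ht (j.swap r), if_neg (by omega), if_pos h',
      if_pos (by omega)]
    simp [wt]
  · rw [omega, if_neg hA]
    by_cases hB : ∃ t : Fin n, Link c t (j.1 r.castSucc) (j.1 r.succ)
    · obtain ⟨t, ht⟩ := hB
      refine crossing_step (some t) (main t (Or.inl ht)) ?_
      rw [hgt t ht j, hgt t ht i, hgt t ht (j.swap r), if_pos (by omega), if_neg (by omega),
        if_neg (by omega)]
      simp [wt]
    · rw [one_mul]
      congr 1
      funext o
      obtain h | ⟨t, rfl, h | h⟩ := hc.side_swap_eq_or j r o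
      · exact h.symm
      · exact absurd ⟨t, h⟩ hB
      · refine absurd ((hc.arr _ (j.mem_support _) _ (j.mem_support _) (hc.adj_inv j r)).2 ?_) hA
        exact ⟨t, t.2, h.imp And.symm And.symm⟩

/-! ### The image of the polynomial representation -/

theorem rep_he (j : Seqs ν (n + 1)) : hc.rep (he p q j) = Matrix.single j j 1 := by
  rw [he, rep_mk, freeRep_E]
  ext1 g h
  rw [mono_apply, Matrix.single_apply]
  by_cases hg : j = g <;> by_cases hh : j = h
  · subst hg; subst hh; simp
  · subst hg; simp [hh]
  · subst hh; simp [hg, Ne.symm hg]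
  · simp [hg, hh, Ne.symm hh]

omit hc in
theorem _root_.VV.mono_mul_single (t : Seqs ν (n + 1) → Seqs ν (n + 1))
    (a : Seqs ν (n + 1) → Poly k n)
    (i j : Seqs ν (n + 1)) (x : Poly k n) :
    mono t a * Matrix.single i j x = Matrix.single (t i) j (a i * x) := by
  ext1 g h
  by_cases hh : j = h
  · subst hh
    rw [Matrix.mul_single_apply_same, mono_apply, Matrix.single_apply]
    by_cases hg : g = t i
    · subst hg; simp
    · simp [hg, Ne.symm hg]
  · rw [Matrix.mul_single_apply_of_ne _ _ _ _ _ (Ne.symm hh), Matrix.single_apply,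
      if_neg fun h => hh h.2]

/-- The central subalgebra acts by scalars. -/
theorem rep_toCenter_mul_single (P : Poly k n) (j : Seqs ν (n + 1)) :
    hc.rep (hc.toCenter P) * Matrix.single j j 1 = Matrix.single j j P := by
  have hadd : ∀ {P Q : Poly k n}, hc.rep (hc.toCenter P) * Matrix.single j j 1
      = Matrix.single j j P →
      hc.rep (hc.toCenter Q) * Matrix.single j j 1 = Matrix.single j j Q →
      hc.rep (hc.toCenter (P + Q)) * Matrix.single j j 1 = Matrix.single j j (P + Q) := by
    intro P Q hP hQ
    rw [map_add, map_add, add_mul, hP, hQ, Matrix.single_add]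
  have hneg : ∀ {P : Poly k n}, hc.rep (hc.toCenter P) * Matrix.single j j 1 = Matrix.single j j P →
      hc.rep (hc.toCenter (-P)) * Matrix.single j j 1 = Matrix.single j j (-P) := by
    intro P hP
    rw [map_neg, map_neg, neg_mul, hP, ← Matrix.single_neg]
  have hval : ∀ l, hc.rep (hc.toCenter (yhat n c s (j.1 l))) * Matrix.single j j 1
      = Matrix.single j j (yhat n c s (j.1 l)) := by
    intro l
    rw [← hc.rep_he j, ← map_mul, ← hc.hx_mul_he_eq, map_mul, hx, rep_mk, freeRep_X, hc.rep_he,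
      mono_mul_single, mul_one]
  have hy : ∀ t ≤ n, hc.rep (hc.toCenter (y s t)) * Matrix.single j j 1
      = Matrix.single j j (y s t) := by
    intro t ht
    obtain ⟨l, h | h⟩ := j.exists_of_mem (hc.c_mem ht)
    · rw [← hc.yhat_c ht, ← h]
      exact hval l
    · rw [← hc.yhat_c ht, ← h, yhat_inv]
      exact hneg (hval l)
  induction P using MvPolynomial.induction_on with
  | C a =>
    have : (MvPolynomial.C a : Poly k n) = algebraMap k (Poly k n) a := rfl
    rw [this, AlgHom.commutes, AlgHom.commutes, Algebra.algebraMap_eq_smul_one, smul_mul_assoc,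
      one_mul, Matrix.smul_single, Algebra.algebraMap_eq_smul_one]
  | add P Q hP hQ => exact hadd hP hQ
  | mul_X P o hP =>
    have hX : hc.rep (hc.toCenter (MvPolynomial.X o)) * Matrix.single j j 1
        = Matrix.single j j (MvPolynomial.X o) := by
      cases o with
      | none =>
        rw [← y_self s]
        exact hy s hc.s_le
      | some t =>
        have ht := t.2
        rw [show (MvPolynomial.X (some t) : Poly k n) = y s (t + 1) - y s t from
          (y_succ_sub s ht).symm, sub_eq_add_neg]
        exact hadd (hy _ ht) (hneg (hy _ ht.le))
    have h2 : Matrix.single j j (MvPolynomial.X o : Poly k n)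
        = Matrix.single j j 1 * Matrix.single j j (MvPolynomial.X o) := by
      rw [Matrix.single_mul_single_same, one_mul]
    rw [map_mul, map_mul, mul_assoc, hX, h2, ← mul_assoc, hP, Matrix.single_mul_single_same]

/-- Along the way from `i` to `j` every step contributes its weight, and `crossing_flip` and
`crossing_swap` say that `crossing` grows by the same factor. -/
theorem rep_tau (i j : Seqs ν (n + 1)) :
    hc.rep (tau p q i j) = Matrix.single j i (crossing k (side q c j) (side q c i)) := by
  induction j using (dist_wf i).induction with
  | _ j ih =>
    by_cases h : ∃ o, Desc i o j
    · obtain ⟨o, ho⟩ := h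
      rw [hc.tau_of_desc i j o ho, map_mul, ih _ (dist_act_lt ho)]
      cases o with
      | none =>
        rw [hT, rep_mk, freeRep_Pi, act, mono_mul_single, Seqs.flip_flip, hc.crossing_flip ho]
      | some r =>
        rw [hT, rep_mk, freeRep_σ, act, mono_mul_single, Seqs.swap_swap, hc.crossing_swap ho]
    · rw [eq_of_no_desc hc.le_one (not_exists.1 h), hc.tau_self, hc.rep_he, crossing_self]

theorem rep_toCenter_mul_tau (P : Poly k n) (i j : Seqs ν (n + 1)) :
    hc.rep (hc.toCenter P * tau p q i j)
      = Matrix.single j i (P * crossing k (side q c j) (side q c i)) := by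
  have h : Matrix.single j i (crossing k (side q c j) (side q c i))
      = Matrix.single j j 1 * Matrix.single j i (crossing k (side q c j) (side q c i)) := by
    rw [Matrix.single_mul_single_same, one_mul]
  rw [map_mul, hc.rep_tau, h, ← mul_assoc, hc.rep_toCenter_mul_single,
    Matrix.single_mul_single_same]

theorem rep_sum (P : Seqs ν (n + 1) → Seqs ν (n + 1) → Poly k n) (g h : Seqs ν (n + 1)) :
    hc.rep (∑ i, ∑ j, hc.toCenter (P j i) * tau p q i j) g h
      = P g h * crossing k (side q c g) (side q c h) := by
  simp only [map_sum, hc.rep_toCenter_mul_tau]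
  have h2 := Matrix.matrix_eq_sum_single
    (Matrix.of fun j i => P j i * crossing k (side q c j) (side q c i))
  simp only [Matrix.of_apply] at h2
  rw [Finset.sum_comm, ← h2, Matrix.of_apply]

/-- The entries of the image are the coefficients times nonzero polynomials, and the polynomial ring
is a domain, so all coefficients vanish. -/
theorem rep_injective : Function.Injective hc.rep := by
  rw [injective_iff_map_eq_zero]
  intro v hv
  obtain ⟨P, rfl⟩ := hc.exists_eq_sum v
  refine Finset.sum_eq_zero fun i _ => Finset.sum_eq_zero fun j _ => ?_
  have h := hc.rep_sum P j i
  rw [hv, Matrix.zero_apply] at h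
  rw [(mul_eq_zero.1 h.symm).resolve_right (crossing_ne_zero _ _), map_zero, zero_mul]

theorem crossing_dvd_rep (v : Alg p q ν n) (g h : Seqs ν (n + 1)) :
    crossing k (side q c g) (side q c h) ∣ hc.rep v g h := by
  obtain ⟨P, rfl⟩ := hc.exists_eq_sum v
  rw [hc.rep_sum]
  exact dvd_mul_left _ _

theorem exists_rep_eq (M : Matrix (Seqs ν (n + 1)) (Seqs ν (n + 1)) (Poly k n))
    (hM : ∀ g h, crossing k (side q c g) (side q c h) ∣ M g h) : ∃ v, hc.rep v = M := by
  choose P hP using hM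
  refine ⟨∑ i, ∑ j, hc.toCenter (P j i) * tau p q i j, ?_⟩
  ext1 g h
  rw [hc.rep_sum, hP, mul_comm]

/-! ### The Morita equivalence -/

/-- The matrices on sign vectors are embedded as the block at the chosen sequences, and the
divisibility conditions agree because `sec` is a section of `side`. This identifies `B` with the
corner at the sum of the chosen idempotents. -/
theorem isMoritaEquivalent_of_side {B : Type u} [Ring B] [Algebra k B]
    (Ψ : B →ₐ[k] Matrix (Option (Fin n) → TwoCycle) (Option (Fin n) → TwoCycle) (Poly k n))
    (hinj : Function.Injective Ψ) (hdvd : ∀ f g h, crossing k g h ∣ Ψ f g h)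
    (hex : ∀ M, (∀ g h, crossing k g h ∣ M g h) → ∃ f, Ψ f = M)
    (sec : (Option (Fin n) → TwoCycle) → Seqs ν (n + 1)) (hsec : ∀ ε, side q c (sec ε) = ε) :
    IsMoritaEquivalent k (Alg p q ν n) B := by
  let U : Matrix (Seqs ν (n + 1)) (Option (Fin n) → TwoCycle) (Poly k n) :=
    Matrix.of fun g ε => if g = sec ε then 1 else 0
  have hsec' : ∀ ε ε', sec ε = sec ε' ↔ ε = ε' := fun ε ε' =>
    ⟨fun h => by rw [← hsec ε, h, hsec], fun h => by rw [h]⟩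
  have hUU : U.transpose * U = 1 := by
    ext1 ε ε'
    rw [Matrix.mul_apply, Matrix.one_apply]
    simp [U, hsec', eq_comm]
  have happ : ∀ (M : Matrix (Seqs ν (n + 1)) (Seqs ν (n + 1)) (Poly k n)) ε ε',
      (U.transpose * M * U) ε ε' = M (sec ε) (sec ε') := by
    intro M ε ε'
    simp [U, Matrix.mul_apply]
  have hF : ∀ b, ∃ v, hc.rep v = U * Ψ b * U.transpose := by
    intro b
    refine hc.exists_rep_eq _ fun g h => ?_
    rw [Matrix.mul_apply]
    refine Finset.dvd_sum fun ε' _ => ?_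
    rw [Matrix.mul_apply, Finset.sum_mul]
    refine Finset.dvd_sum fun ε _ => ?_
    by_cases hg : g = sec ε
    · by_cases hh : h = sec ε'
      · rw [hg, hh, hsec, hsec]
        exact (hdvd b ε ε').mul_left _ |>.mul_right _
      · simp [U, hh]
    · simp [U, hg]
  choose F hF using hF
  let φ : B →ₙₐ[k] Alg p q ν n :=
    { toFun := F
      map_smul' := fun r b => hc.rep_injective (by
        change hc.rep (F (r • b)) = hc.rep (r • F b)
        rw [hF, map_smul, map_smul, hF, Matrix.mul_smul, Matrix.smul_mul])
      map_zero' := hc.rep_injective (by rw [hF, map_zero, map_zero, Matrix.mul_zero,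
        Matrix.zero_mul])
      map_add' := fun a b => hc.rep_injective (by
        rw [hF, map_add, map_add, hF, hF, Matrix.mul_add, Matrix.add_mul])
      map_mul' := fun a b => hc.rep_injective (by
        rw [hF, map_mul, map_mul, hF, hF]
        calc U * (Ψ a * Ψ b) * U.transpose
            = U * (Ψ a * (1 : Matrix _ _ _) * Ψ b) * U.transpose := by rw [Matrix.mul_one]
          _ = _ := by rw [← hUU]; simp only [Matrix.mul_assoc]) }
  have hφ : ∀ b, hc.rep (φ b) = U * Ψ b * U.transpose := hF
  have hφ1 : hc.rep (φ 1) = U * U.transpose := by rw [hφ, map_one, Matrix.mul_one]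
  refine IsMoritaEquivalent.of_corner φ ?_ ?_
    -- The sequence `i` and the chosen one with the same side are joined by elements of weight `1`
    -- in both directions; going there and back gives `e(i)`, and these sum to `1`.
    (fun i : Seqs ν (n + 1) => tau p q (sec (side q c i)) i)
    (fun i => tau p q i (sec (side q c i))) ?_
  · intro a b h
    apply hinj
    have h2 : U.transpose * (U * Ψ a * U.transpose) * U
        = U.transpose * (U * Ψ b * U.transpose) * U := by
      rw [← hφ, ← hφ, h]
    simp only [Matrix.mul_assoc, hUU, Matrix.mul_one] at h2
    simpa only [← Matrix.mul_assoc, hUU, Matrix.one_mul] using h2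
  · intro v
    obtain ⟨b, hb⟩ := hex (U.transpose * hc.rep v * U) fun ε ε' => by
      rw [happ]
      have := hc.crossing_dvd_rep v (sec ε) (sec ε')
      rwa [hsec, hsec] at this
    refine ⟨b, hc.rep_injective ?_⟩
    rw [map_mul, map_mul, hφ1, hφ, hb]
    simp only [Matrix.mul_assoc]
  · apply hc.rep_injective
    rw [map_sum, map_one hc.rep, ← Matrix.diagonal_one, ← Matrix.sum_single_eq_diagonal]
    refine Finset.sum_congr rfl fun i _ => ?_
    rw [map_mul, map_mul, hc.rep_tau, hc.rep_tau, hsec, crossing_self, hφ1,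
      Matrix.single_mul_mul_single]
    have : (U * U.transpose) (sec (side q c i)) (sec (side q c i)) = 1 := by
      simp [U, Matrix.mul_apply, hsec']
    rw [this, one_mul, one_mul]

end IsChain

/-! ### Sequences on given sides of the walls -/

/-- The permutation that folds `0, …, n` at `s`: the numbers `s, …, n` come first, in increasing
order, and are followed by the numbers below `s`, in decreasing order. -/
def foldPerm (hs : s ≤ n) : Equiv.Perm (Fin (n + 1)) where
  toFun r := if h : r + s ≤ n then ⟨s + r, by omega⟩ else ⟨n - r, by omega⟩
  invFun j := if h : s ≤ j then ⟨j - s, by omega⟩ else ⟨n - j, by omega⟩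
  left_inv r := by
    have := r.2
    by_cases h : r + s ≤ n
    · simp [h]
    · simp only [h, dif_neg, not_false_eq_true]
      rw [dif_neg (by omega)]
      exact Fin.ext (by simp; omega)
  right_inv j := by
    have := j.2
    by_cases h : s ≤ j
    · simp only [h, dif_pos]
      rw [dif_pos (by omega)]
      exact Fin.ext (by simp; omega)
    · simp only [h, dif_neg, not_false_eq_true]
      rw [dif_neg (by omega)]
      exact Fin.ext (by simp; omega)

theorem foldPerm_symm_val (hs : s ≤ n) (j : Fin (n + 1)) :
    (((foldPerm hs).symm j : Fin (n + 1)) : ℕ) = if s ≤ j then j - s else n - j := by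
  change ((if h : s ≤ j then ⟨j - s, _⟩ else ⟨n - j, _⟩ : Fin (n + 1)) : ℕ) = _
  split_ifs <;> rfl

namespace IsChain

variable (hc : IsChain p q ν n c s)
include hc

theorem sum_single : ∑ j : Fin (n + 1),
    (Finsupp.single (c j) 1 + Finsupp.single (c j)⁻¹ 1) = ν := by
  ext u
  simp only [Finsupp.finsetSum_apply, Finsupp.add_apply, Finsupp.single_apply]
  by_cases hu : u ∈ ν.support
  · have h1 : ν u = 1 := le_antisymm (hc.le_one u)
        (Nat.one_le_iff_ne_zero.2 (Finsupp.mem_support_iff.1 hu))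
    obtain ⟨j, hj, h⟩ := (hc.mem u).1 hu
    rw [h1, Finset.sum_eq_single (⟨j, by omega⟩ : Fin (n + 1))]
    · rcases h with rfl | rfl
      · rw [if_pos rfl, if_neg (hc.ne_inv j hj j hj).symm, add_zero]
      · rw [if_neg (hc.ne_inv j hj j hj), if_pos rfl, zero_add]
    · intro l _ hl
      have hl' : ∀ v, c l = v → v ≠ c j := fun v hv h =>
        hl (Fin.ext (hc.inj l (by omega) j hj (hv.trans h)))
      have h2 := hc.ne_inv l (by omega) j hj
      rcases h with rfl | rfl
      · rw [if_neg fun h => hl' _ h rfl, if_neg fun h => h2 (by rw [← h, inv_inv]),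
          add_zero]
      · rw [if_neg h2, if_neg fun h => hl' _ (inv_injective h) rfl, add_zero]
    · simp
  · rw [Finsupp.notMem_support_iff.1 hu]
    refine Finset.sum_eq_zero fun j _ => ?_
    rw [if_neg fun h => hu ((hc.mem u).2 ⟨j, by omega, Or.inl h.symm⟩),
      if_neg fun h => hu ((hc.mem u).2 ⟨j, by omega, Or.inr h.symm⟩), add_zero]

/-- There is a sequence with prescribed positions up to sign, and prescribed signs. -/
theorem exists_position_eq (a : Equiv.Perm (Fin (n + 1))) (P : ℕ → Prop) :
    ∃ i : Seqs ν (n + 1), ∀ j : Fin (n + 1),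
      position i (c j) = if P j then ((a.symm j : ℕ) : ℤ) + 1 else -(((a.symm j : ℕ) : ℤ) + 1) := by
  let f : Fin (n + 1) → kˣ := fun r => if P (a r) then c (a r) else (c (a r))⁻¹
  have hf : ∑ r, Finsupp.single (f r) 1 + ∑ r, Finsupp.single (f r)⁻¹ 1 = ν := by
    rw [← Finset.sum_add_distrib]
    refine Eq.trans ?_ hc.sum_single
    rw [← Equiv.sum_comp a (fun j : Fin (n + 1) =>
      Finsupp.single (c j) 1 + Finsupp.single (c j)⁻¹ 1)]
    refine Finset.sum_congr rfl fun r _ => ?_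
    dsimp only [f]
    split_ifs
    · rfl
    · rw [inv_inv, add_comm]
  obtain ⟨i, hi⟩ : ∃ i : Seqs ν (n + 1), i.1 = f := ⟨⟨f, hf⟩, rfl⟩
  refine ⟨i, fun j => ?_⟩
  have h := position_val hc.le_one i (a.symm j)
  have h2 : i.1 (a.symm j) = if P j then c j else (c j)⁻¹ := by
    rw [hi]
    simp only [f, Equiv.apply_symm_apply]
  rw [h2] at h
  split_ifs at h ⊢
  · exact h
  · rw [position_inv] at h
    omega

/-- The folded order makes absolute positions grow along the chain away from `s` on either side. So
at every wall the sign of the element farther from `s` decides, these elements are distinct for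
distinct walls, and the sign of `q` itself is left for the last wall. -/
theorem exists_side_eq (ε : Option (Fin n) → TwoCycle) : ∃ i : Seqs ν (n + 1), side q c i = ε := by
  -- The default value is never consulted: only indices of walls, which are below `n`, matter.
  let ε' : ℕ → TwoCycle := fun t => if h : t < n then ε (some ⟨t, h⟩) else one
  obtain ⟨i, hi⟩ := hc.exists_position_eq (foldPerm hc.s_le) fun j =>
    -- Above `s` the element `c_j` is the upper end of its wall, and side `one` needs a positive
    -- sign; below `s` it is the lower end, and side `one` needs a negative sign.
    if j = s then ε none = one else if s < j then ε' (j - 1) = one else ε' j = two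
  have hε : ∀ κ, ε κ ≠ one ↔ ε κ = two := fun κ => by cases ε κ <;> simp
  refine ⟨i, funext fun κ => ?_⟩
  have key : 0 < delta q c i κ ↔ ε κ = one := by
    cases κ with
    | none =>
      have h := hi ⟨s, Nat.lt_succ_of_le hc.s_le⟩
      rw [hc.c_s, if_pos rfl, foldPerm_symm_val] at h
      change 0 < position i q ↔ _
      rw [h]
      split_ifs with h1 <;> simp [h1]
    | some t =>
      have ht := t.2
      have h := hi ⟨t, by omega⟩
      have h' := hi ⟨t + 1, by omega⟩
      rw [foldPerm_symm_val] at h h'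
      change 0 < position i (c (t + 1)) - position i (c t) ↔ _
      have e : ε' t = ε (some t) := dif_pos ht
      simp only [Nat.add_sub_cancel] at h h'
      by_cases hst : s ≤ t
      · simp only [if_neg (by omega : (t : ℕ) + 1 ≠ s), if_pos (by omega : s < (t : ℕ) + 1), e,
          if_pos (by omega : s ≤ (t : ℕ) + 1)] at h'
        simp only [if_pos hst] at h
        by_cases h1 : ε (some t) = one
        · rw [if_pos h1] at h'
          simp only [h1, iff_true]
          split_ifs at h <;> omega
        · rw [if_neg h1] at h'
          simp only [h1, iff_false]
          split_ifs at h <;> omega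
      · simp only [if_neg (by omega : (t : ℕ) ≠ s), if_neg (by omega : ¬ s < (t : ℕ)), e,
          if_neg hst] at h
        by_cases h1 : ε (some t) = one
        · rw [if_neg (by rw [h1]; simp)] at h
          simp only [h1, iff_true]
          split_ifs at h' <;> omega
        · rw [if_pos ((hε _).1 h1)] at h
          simp only [h1, iff_false]
          split_ifs at h' <;> omega
  rw [side]
  split_ifs with h
  · exact (key.1 h).symm
  · exact ((hε κ).1 fun h' => h (key.2 h')).symm

theorem isMoritaEquivalent :
    IsMoritaEquivalent k (Alg p q ν n)
      ((⨂[k] _ : Fin n, TwoCycleAlgebra k) ⊗[k] TwoCycleAlgebra k) := by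
  obtain ⟨Ψ, hinj, hdvd, hex⟩ := TwoCycle.exists_toMatrix (k := k) n
  choose sec hsec using hc.exists_side_eq
  exact hc.isMoritaEquivalent_of_side Ψ hinj hdvd hex sec hsec

end IsChain

end VV

end

open scoped TensorProduct in
theorem mainTheorem6 {k : Type*} [Field k] (hchar : ringChar k ≠ 2) (p q : kˣ)
    (hpq : ∀ n : ℤ, p ≠ q ^ n) (hqp : ∀ n : ℤ, q ≠ p ^ n)
    (hone : (1 : kˣ) ∉ VV.orbit p q) (hnegone : (-1 : kˣ) ∉ VV.orbit p q)
    (hpI : p ∉ VV.orbit p q) (hroot : ∀ n : ℕ, 0 < n → p ^ n ≠ 1)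
    (ν : kˣ →₀ ℕ) (hν : VV.IsDimVector (VV.orbit p q) ν)
    (hmult : VV.MultiplicityOne ν) (hconn : VV.ConnectedSupport p ν) (hq : 1 ≤ ν q)
    (n : ℕ) (hheight : VV.height ν = 2 * (n + 1)) :
    IsMoritaEquivalent k (VV.VVAlgebra p q ν n)
      ((⨂[k] _ : Fin n, TwoCycleAlgebra k) ⊗[k] TwoCycleAlgebra k) := by
  obtain ⟨c, s, hc⟩ :=
    VV.exists_isChain hone hnegone hroot hν.2 hmult hconn hq n hheight
  exact hc.isMoritaEquivalent
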